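/- All multigraphs are finite and loopless; $V(G)$ and $E(G)$ denote the vertex and edge sets. A \emph{2-fold cover} of a multigraph $G$ is a pair $(L,\mathcal H)$, where $\mathcal H$ is a loopless multigraph and $L$ assigns to every $v\in V(G)$ a two-element set $L(v)\subseteq V(\mathcal H)$, such that: the sets $L(v)$ partition $V(\mathcal H)$; each $\mathcal H[L(v)]$ is complete; for $u\ne v$ there are edges of $\mathcal H$ between $L(u)$ and $L(v)$ only if $uv\in E(G)$; and if $uv$ has multiplicity $k\ge 1$ in $G$, then the edges of $\mathcal H$ between $L(u)$ and $L(v)$ form a union of at least one and at most $k$ perfect matchings between $L(u)$ and $L(v)$. The vertex set of $\mathcal H$ is partitioned into \emph{poor} and \emph{rich} vertices so that every $L(v)$ contains exactly one of each. For integers $0\le i\le j$, an \emph{$(i,j)$-coloring} of the cover is an injective map $\phi:V(G)\to V(\mathcal H)$ with $\phi(v)\in L(v)$ for all $v$, such that in the subgraph $\mathcal H_\phi$ of $\mathcal H$ induced by $\phi(V(G))$ every poor vertex has degree at most $i$ and every rich vertex has degree at most $j$ (degrees count edges with multiplicity). $G$ is \emph{$(i,j)$-colorable} (that is, $(i,j)$-defective-DP-colorable)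 if every 2-fold cover of $G$, with every such choice of poor and rich vertices, has an $(i,j)$-coloring. Let $G$ be a multigraph. Below, ``subgraph'' means a subgraph with at least one vertex. \begin{enumerate} \item If $j\ge 1$ and $|E(H)|\le |V(H)|+j-1$ for every subgraph $H$ of $G$, then $G$ is $(0,j)$-colorable. \item If $i\ge 1$, $j\ge 2i+1$ and $|E(H)|\le \frac{(2i+1)|V(H)|-(2i-j+1)}{i+1}$ for every subgraph $H$ of $G$, then $G$ is $(i,j)$-colorable. \item If $i\ge 1$, $i+2\le j\le 2i$ and $|E(H)|\le \frac{2j|V(H)|+1}{j+1}$ for every subgraph $H$ of $G$, then $G$ is $(i,j)$-colorable. \item If $i\ge 1$ and $|E(H)|\le \frac{2i^2+4i+1}{i^2+3i+1}|V(H)|$ for every subgraph $H$ of $G$, then $G$ is $(i,i+1)$-colorable. \item If $i\ge 1$ and $|E(H)|\le \frac{(2i+2)|V(H)|-1}{i+2}$ for every subgraph $H$ of $G$, then $G$ is $(i,i)$-colorable. \end{enumerate} Each condition is sharp, in the following sense. For each admissible pair $(i,j)$ there are infinitely many $n$ (in Part 1: for every $j\ge1$, all $n\ge 2j+2$) for which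 there is an $n$-vertex multigraph $G$ that is not $(i,j)$-colorable, such that every proper subgraph $H$ of $G$ satisfies the condition of the respective part, while $|E(G)|$ exceeds the bound only by the least possible change of its numerator, i.e. $|E(G)|$ equals, respectively, \[ n+j,\qquad \tfrac{(2i+1)n-(2i-j)}{i+1},\qquad \tfrac{2jn+2}{j+1},\qquad \tfrac{(2i^2+4i+1)n+1}{i^2+3i+1},\qquad \tfrac{(2i+2)n}{i+2}. \] -/

import Mathlib

open scoped Graph

namespace DefectiveDP

/-- A finite multigraph without loops (parallel edges are allowed). -/
structure IsFiniteMultigraph {α β : Type*} (G : Graph α β) : Prop where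
  loopless : G.Loopless
  finite_vertexSet : V(G).Finite
  finite_edgeSet : E(G).Finite

/-- `M` is a set of edges of `H` forming a perfect matching between the vertex sets `A` and `B`. -/
structure IsPerfectMatching {γ δ : Type*} (H : Graph γ δ) (M : Set δ) (A B : Set γ) : Prop where
  isLink : ∀ f ∈ M, ∃ x ∈ A, ∃ y ∈ B, H.IsLink f x y
  left : ∀ x ∈ A, ∃! f, f ∈ M ∧ H.Inc f x
  right : ∀ y ∈ B, ∃! f, f ∈ M ∧ H.Inc f y

/-- `(L, H)` is a 2-fold cover of the multigraph `G`. The cover graph `H` is itself a loopless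
multigraph. If `u v` has multiplicity `k > 0` in `G`, then the edges of `H` between `L u` and `L v`
are the union of at most `k` perfect matchings: `M e` is the matching of the edge `e` (matchings of
parallel edges may share edges or even coincide). -/
structure IsTwoFoldCover {α β γ δ : Type*} (G : Graph α β) (L : α → Set γ) (H : Graph γ δ) :
    Prop where
  loopless : H.Loopless
  disjoint : V(G).PairwiseDisjoint L
  union : (⋃ v ∈ V(G), L v) = V(H)
  card : ∀ v ∈ V(G), (L v).ncard = 2
  complete : ∀ v ∈ V(G), ∀ x ∈ L v, ∀ y ∈ L v, x ≠ y → ∃! f, H.IsLink f x y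
  adj : ∀ u ∈ V(G), ∀ v ∈ V(G), u ≠ v → (∃ x ∈ L u, ∃ y ∈ L v, H.Adj x y) → G.Adj u v
  matchings : ∃ M : β → Set δ,
    (∀ e u v, G.IsLink e u v → IsPerfectMatching H (M e) (L u) (L v)) ∧
    (∀ u ∈ V(G), ∀ v ∈ V(G), u ≠ v → ∀ f, ∀ x ∈ L u, ∀ y ∈ L v, H.IsLink f x y →
      ∃ e, G.IsLink e u v ∧ f ∈ M e)

/-- The vertices of the cover graph are partitioned into poor ones (`P`) and rich ones (`R`), such
that every list has exactly one poor and exactly one rich vertex. -/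
structure IsPoorRichPartition {α β γ δ : Type*} (G : Graph α β) (L : α → Set γ) (H : Graph γ δ)
    (P R : Set γ) : Prop where
  union : P ∪ R = V(H)
  disjoint : Disjoint P R
  poor : ∀ v ∈ V(G), (L v ∩ P).ncard = 1
  rich : ∀ v ∈ V(G), (L v ∩ R).ncard = 1

/-- The degree of a vertex in a loopless multigraph: the number of edges incident with it. -/
noncomputable def degree {γ δ : Type*} (H : Graph γ δ) (x : γ) : ℕ∞ :=
  (H.incidenceSet x).encard

/-- `φ` is an `(i, j)`-defective-DP-coloring of the cover `(L, H)` of `G` with poor vertices `P` and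
rich vertices `R`: an injective choice of a vertex from every list, such that in the subgraph of `H`
induced by the chosen vertices, poor vertices have degree at most `i` and rich vertices have degree
at most `j`. -/
structure IsDefectiveColoring {α β γ δ : Type*} (G : Graph α β) (L : α → Set γ) (H : Graph γ δ)
    (P R : Set γ) (i j : ℕ) (φ : V(G) → γ) : Prop where
  injective : Function.Injective φ
  mem : ∀ v : V(G), φ v ∈ L v
  poor : ∀ x ∈ Set.range φ, x ∈ P → degree (H.induce (Set.range φ)) x ≤ i
  rich : ∀ x ∈ Set.range φ, x ∈ R → degree (H.induce (Set.range φ)) x ≤ j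

/-- `G` is `(i, j)`-defective-DP-colorable: every 2-fold cover of `G`, with any choice of poor and
rich vertices, has an `(i, j)`-defective-DP-coloring. (Covers of finite multigraphs have finitely
many vertices and edges, so types in the lowest universe carry all of them up to isomorphism.) -/
def IsColorable {α β : Type*} (i j : ℕ) (G : Graph α β) : Prop :=
  ∀ (γ δ : Type) (L : α → Set γ) (H : Graph γ δ) (P R : Set γ),
    IsTwoFoldCover G L H → IsPoorRichPartition G L H P R →
      ∃ φ : V(G) → γ, IsDefectiveColoring G L H P R i j φ

/-- Every non-null subgraph `H` of `G` satisfies `|E(H)| ≤ f |V(H)|`. -/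
def AllSubgraphsSparse {α β : Type*} (f : ℚ → ℚ) (G : Graph α β) : Prop :=
  ∀ H : Graph α β, H ≤ G → V(H).Nonempty → (E(H).ncard : ℚ) ≤ f V(H).ncard

/-- Every non-null proper subgraph `H` of `G` satisfies `|E(H)| ≤ f |V(H)|`. -/
def ProperSubgraphsSparse {α β : Type*} (f : ℚ → ℚ) (G : Graph α β) : Prop :=
  ∀ H : Graph α β, H < G → V(H).Nonempty → (E(H).ncard : ℚ) ≤ f V(H).ncard

/-- There is an `n`-vertex multigraph that is not `(i, j)`-colorable, has exactly `g n` edges, and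
all of whose non-null proper subgraphs `H` satisfy `|E(H)| ≤ f |V(H)|`. -/
def SharpAt (i j : ℕ) (f g : ℚ → ℚ) (n : ℕ) : Prop :=
  ∃ G : Graph ℕ ℕ, IsFiniteMultigraph G ∧ V(G).ncard = n ∧ (E(G).ncard : ℚ) = g n ∧
    ProperSubgraphsSparse f G ∧ ¬ IsColorable i j G

end DefectiveDP

/-! ### Conflict networks and residual capacities. -/

namespace DefectiveDP

/-! A cover enters only through the numbers of conflicts between colored vertices, so colorability
is proved for conflict networks, and for arbitrary capacities `x v b`: color `b` at `v` needs fewer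
than `x v b` conflicts, so capacity `0` forbids a color. The graph conditions become lower bounds
for a potential, the sum of vertex weights `f (x v false) (x v true)` minus `D` times the number of
edges, on all nonempty vertex sets. General capacities make induction possible: after a set `A` is
colored, the rest is an instance with smaller capacities.

For `1 ≤ i ≤ j ≤ 2 * i` (`colorable_of_hasPotential`), take a proper nonempty subset `A` of least
potential. Any coloring of `A` can be extended with all conflicts across the boundary forbidden,
unless the whole complement has too little potential left. In that exceptional case one conflict is
permitted, or two colorings of `A` are used across a bridge. Hence all proper subsets of a minimal
counterexample have large potential. Then vertices of small degree can be colored last, so all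
degrees are large and the handshake identity makes the total potential too small.

For `j ≥ 2 * i + 1` (`colorable_of_hasRichPotential`), the scheme is similar, but a vertex that has
lost its rich color has to be accounted for separately, and many conflicts may be permitted at once.
For `i = 0` (`colorable_of_edges_le`), whole components of the graph of poor-rich conflicts receive
one color each; a spanning tree of such a component uses edges that cannot also produce rich-rich
conflicts.

Sharpness uses trees of stars with double leaves. A double edge with one straight and one crossed
matching yields exactly one conflict in every coloring, so leaves use up capacity, and single edges
then force colors until a contradiction arises. For `i = j` no color is forced absolutely, and a
path that forces its ends to differ is closed to a cycle. `HasGadget` carries the color constraints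
and subset potentials through the construction. -/

/-- The data of a cover of a multigraph that matter for defective colorings. The vertices have two
colors, `false` (poor) and `true` (rich); `mult u v` is the multiplicity of `u v`, `conf u a v b`
is the number of cover edges between the vertex of color `a` in the list of `u` and the vertex of
color `b` in the list of `v`, and `edges S` is the number of edges inside `S`. -/
structure ConflictNetwork (α : Type*) where
  mult : α → α → ℕ
  conf : α → Bool → α → Bool → ℕ
  edges : Finset α → ℕ
  mult_symm : ∀ u v, mult u v = mult v u
  mult_self : ∀ v, mult v v = 0
  conf_symm : ∀ u a v b, conf u a v b = conf v b u a
  conf_le : ∀ u a v, conf u a v false + conf u a v true ≤ mult u v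
  two_mul_edges : ∀ S, 2 * edges S = ∑ u ∈ S, ∑ v ∈ S, mult u v

namespace ConflictNetwork

open Finset

variable {α : Type*} (N : ConflictNetwork α)

/-- The number of edges between `v` and `A`. -/
def degTo (v : α) (A : Finset α) : ℕ := ∑ u ∈ A, N.mult v u

/-- The number of conflicts of `v`, when colored `b`, with a colored set `A`. -/
def confTo (v : α) (b : Bool) (A : Finset α) (φ : α → Bool) : ℕ := ∑ u ∈ A, N.conf v b u (φ u)

/-- The number of edges between `B` and `A`. -/
def cross (B A : Finset α) : ℕ := ∑ v ∈ B, N.degTo v A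

/-- The coloring `φ` of `S` respects the capacities `x`: a vertex `v` of color `b` has fewer than
`x v b` conflicts. -/
def IsColoring (S : Finset α) (x : α → Bool → ℕ) (φ : α → Bool) : Prop :=
  ∀ v ∈ S, N.confTo v (φ v) S φ < x v (φ v)

/-- There is a coloring of `S` that respects the capacities `x`. -/
def Colorable (S : Finset α) (x : α → Bool → ℕ) : Prop := ∃ φ, N.IsColoring S x φ

/-- The potential of `S` for vertex weights `w` and edge weight `D`. -/
def potential (D : ℤ) (w : α → ℤ) (S : Finset α) : ℤ := ∑ v ∈ S, w v - D * N.edges S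

lemma conf_le' (u : α) (v : α) (b : Bool) : N.conf u false v b + N.conf u true v b ≤ N.mult u v := by
  rw [N.conf_symm u, N.conf_symm u, N.mult_symm]
  exact N.conf_le v b u

lemma conf_self (v : α) (a b : Bool) : N.conf v a v b = 0 := by
  have h := N.conf_le v a v
  rw [N.mult_self] at h
  cases b <;> omega

lemma confTo_add_le (v : α) (A : Finset α) (φ : α → Bool) :
    N.confTo v false A φ + N.confTo v true A φ ≤ N.degTo v A := by
  unfold confTo degTo
  rw [← sum_add_distrib]
  exact sum_le_sum fun u _ => N.conf_le' v u (φ u)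

lemma confTo_le (v : α) (b : Bool) (A : Finset α) (φ : α → Bool) :
    N.confTo v b A φ ≤ N.degTo v A := by
  have := N.confTo_add_le v A φ
  cases b <;> omega

lemma confTo_congr {A : Finset α} {φ ψ : α → Bool} (h : ∀ u ∈ A, φ u = ψ u) (v : α) (b : Bool) :
    N.confTo v b A φ = N.confTo v b A ψ :=
  sum_congr rfl fun u hu => by rw [h u hu]

variable [DecidableEq α]

lemma degTo_union {A B : Finset α} (h : Disjoint A B) (v : α) :
    N.degTo v (A ∪ B) = N.degTo v A + N.degTo v B := sum_union h

lemma confTo_union {A B : Finset α} (h : Disjoint A B) (v : α) (b : Bool) (φ : α → Bool) :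
    N.confTo v b (A ∪ B) φ = N.confTo v b A φ + N.confTo v b B φ := sum_union h

omit [DecidableEq α] in
lemma cross_comm (A B : Finset α) : N.cross A B = N.cross B A := by
  unfold cross degTo
  rw [sum_comm]
  exact sum_congr rfl fun u _ => sum_congr rfl fun v _ => N.mult_symm v u

omit [DecidableEq α] in
lemma two_mul_edges' (S : Finset α) : 2 * N.edges S = ∑ v ∈ S, N.degTo v S := N.two_mul_edges S

lemma edges_union {A B : Finset α} (h : Disjoint A B) :
    N.edges (A ∪ B) = N.edges A + N.edges B + N.cross B A := by
  have h1 := N.two_mul_edges' (A ∪ B)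
  rw [sum_union h] at h1
  simp only [N.degTo_union h, sum_add_distrib] at h1
  have h2 := N.two_mul_edges' A
  have h3 := N.two_mul_edges' B
  have h4 := N.cross_comm A B
  unfold cross at *
  omega

omit [DecidableEq α] in
lemma edges_singleton (v : α) : N.edges {v} = 0 := by
  have := N.two_mul_edges {v}
  simp [N.mult_self] at this
  exact this

lemma potential_union {A B : Finset α} (h : Disjoint A B) (D : ℤ) (w : α → ℤ) :
    N.potential D w (A ∪ B) = N.potential D w A + N.potential D w B - D * N.cross B A := by
  unfold potential
  rw [sum_union h, N.edges_union h]
  push_cast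
  ring

omit [DecidableEq α] in
lemma potential_singleton (D : ℤ) (w : α → ℤ) (v : α) : N.potential D w {v} = w v := by
  simp [potential, N.edges_singleton]

omit [DecidableEq α] in
lemma potential_drop (D : ℤ) {w w' c : α → ℤ} {T : Finset α} (h : ∀ v ∈ T, w v - w' v ≤ c v) :
    N.potential D w T - ∑ v ∈ T, c v ≤ N.potential D w' T := by
  unfold potential
  have := sum_le_sum h
  rw [sum_sub_distrib] at this
  linarith

omit [DecidableEq α] in
lemma two_mul_potential (D : ℤ) (w : α → ℤ) (S : Finset α) :
    2 * N.potential D w S = ∑ v ∈ S, (2 * w v - D * N.degTo v S) := by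
  have h : (2 * N.edges S : ℤ) = ∑ v ∈ S, (N.degTo v S : ℤ) := by
    exact_mod_cast N.two_mul_edges' S
  unfold potential
  rw [sum_sub_distrib, ← mul_sum, ← mul_sum, ← h]
  ring

omit [DecidableEq α] in
lemma cross_singleton (v : α) (A : Finset α) : N.cross {v} A = N.degTo v A := by simp [cross]

omit [DecidableEq α] in
lemma degTo_mono (v : α) {T B : Finset α} (h : T ⊆ B) : N.degTo v T ≤ N.degTo v B :=
  sum_le_sum_of_subset h

omit [DecidableEq α] in
lemma degTo_le_cross {v : α} {B : Finset α} (hv : v ∈ B) (A : Finset α) :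
    N.degTo v A ≤ N.cross B A :=
  single_le_sum (f := fun v => N.degTo v A) (fun _ _ => Nat.zero_le _) hv

omit [DecidableEq α] in
lemma mult_le_degTo {u : α} {A : Finset α} (hu : u ∈ A) (v : α) : N.mult v u ≤ N.degTo v A :=
  single_le_sum (f := fun u => N.mult v u) (fun _ _ => Nat.zero_le _) hu

/-- Two colorings of disjoint sets can be joined if the conflicts between them fit. -/
lemma Colorable.glue {A B : Finset α} (h : Disjoint A B) {x : α → Bool → ℕ} {φ ψ : α → Bool}
    (hA : ∀ v ∈ A, N.confTo v (φ v) A φ + N.confTo v (φ v) B ψ < x v (φ v))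
    (hB : ∀ v ∈ B, N.confTo v (ψ v) A φ + N.confTo v (ψ v) B ψ < x v (ψ v)) :
    N.Colorable (A ∪ B) x := by
  refine ⟨fun v => if v ∈ A then φ v else ψ v, fun v hv => ?_⟩
  have hnB : ∀ u ∈ B, u ∉ A := fun u hu hA => (disjoint_left.1 h) hA hu
  have h1 : ∀ b, N.confTo v b A (fun v => if v ∈ A then φ v else ψ v) = N.confTo v b A φ :=
    fun b => N.confTo_congr (fun u hu => by simp [hu]) v b
  have h2 : ∀ b, N.confTo v b B (fun v => if v ∈ A then φ v else ψ v) = N.confTo v b B ψ :=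
    fun b => N.confTo_congr (fun u hu => by simp [hnB u hu]) v b
  rw [N.confTo_union h, h1, h2]
  rcases mem_union.1 hv with hv | hv
  · simpa [hv] using hA v hv
  · simpa [hnB v hv] using hB v hv

/-- The capacities that remain on `B` if `A` is colored by `φ` and `p v u` conflicts are permitted
between `v ∈ B` and `u ∈ A`. -/
noncomputable def residual (x : α → Bool → ℕ) (A : Finset α) (φ : α → Bool) (p : α → α → ℕ) :
    α → Bool → ℕ := by
  classical
  exact fun v b => if ∀ u ∈ A, N.conf v b u (φ u) ≤ p v u then x v b - N.confTo v b A φ else 0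

omit [DecidableEq α] in
lemma residual_le (x : α → Bool → ℕ) (A : Finset α) (φ : α → Bool) (p : α → α → ℕ) (v : α)
    (b : Bool) : N.residual x A φ p v b ≤ x v b := by
  unfold residual
  split_ifs <;> omega

lemma Colorable.of_residual {A B : Finset α} (h : Disjoint A B) {x : α → Bool → ℕ} {φ : α → Bool}
    {p : α → α → ℕ}
    (hA : ∀ u ∈ A, N.confTo u (φ u) A φ + ∑ v ∈ B, p v u < x u (φ u))
    (hB : N.Colorable B (N.residual x A φ p)) : N.Colorable (A ∪ B) x := by
  obtain ⟨ψ, hψ⟩ := hB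
  have key : ∀ v ∈ B, (∀ u ∈ A, N.conf v (ψ v) u (φ u) ≤ p v u) ∧
      N.confTo v (ψ v) B ψ < x v (ψ v) - N.confTo v (ψ v) A φ := by
    intro v hv
    have := hψ v hv
    unfold residual at this
    split_ifs at this with h1
    · exact ⟨h1, this⟩
    · omega
  refine Colorable.glue N h (φ := φ) (ψ := ψ) (fun u hu => ?_) fun v hv => ?_
  · refine lt_of_le_of_lt (Nat.add_le_add_left ?_ _) (hA u hu)
    exact sum_le_sum fun v hv => by rw [N.conf_symm]; exact (key v hv).1 u hu
  · have := (key v hv).2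
    omega

/-- Minimality of the potential of `A` controls `A ∪ T` only when this is a proper subset of `S`;
the whole complement is the one remaining case. -/
lemma sdiff_eq_of_union {A S T : Finset α} (hT : T ⊆ S \ A) (h : ¬ A ∪ T ⊂ S) (hA : A ⊆ S) :
    T = S \ A := by
  refine Subset.antisymm hT fun v hv => ?_
  have hs : A ∪ T ⊆ S := union_subset hA (hT.trans sdiff_subset)
  have : A ∪ T = S := by
    by_contra hne
    exact h (hs.ssubset_of_ne hne)
  rw [mem_sdiff] at hv
  rw [← this, mem_union] at hv
  tauto

/-- A nonempty proper subset of least potential. -/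
lemma exists_min_potential (D : ℤ) (w : α → ℤ) {S : Finset α} (hS : 2 ≤ S.card) :
    ∃ A ⊂ S, A.Nonempty ∧ ∀ T ⊂ S, T.Nonempty → N.potential D w A ≤ N.potential D w T := by
  classical
  obtain ⟨v, hv⟩ : S.Nonempty := card_pos.1 (by omega)
  have hne : (S.ssubsets.filter Finset.Nonempty).Nonempty := by
    refine ⟨{v}, ?_⟩
    simp only [mem_filter, mem_ssubsets, singleton_nonempty, and_true]
    refine (singleton_subset_iff.2 hv).ssubset_of_ne fun h => ?_
    rw [← h, card_singleton] at hS
    omega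
  obtain ⟨A, hA, hmin⟩ := exists_min_image _ (N.potential D w) hne
  simp only [mem_filter, mem_ssubsets] at hA hmin
  exact ⟨A, hA.1, hA.2, fun T hT hT' => hmin T ⟨hT, hT'⟩⟩

end ConflictNetwork

end DefectiveDP

/-! ### Potential functions and extension from a set of least potential. -/

namespace DefectiveDP

/-- The properties of a potential function `f` of the capacities and of its parameters that make
all vertex sets of potential at least `θ` colorable. -/
structure IsPotentialFunction (D g θ u₁ u₂ κ : ℤ) (X Y : ℕ) (f : ℕ → ℕ → ℤ) : Prop where
  zero : f 0 0 < θ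
  -- Forbidding a color costs `g` less than the edge responsible for it is worth. This gain pays for
  -- the extension.
  forbid_poor : ∀ x y, x ≤ X → y ≤ Y → f x y - f 0 y ≤ D - g
  forbid_rich : ∀ x y, x ≤ X → y ≤ Y → f x y - f x 0 ≤ D - g
  -- `u₁` and `u₂` bound the costs of taking one unit from one color and from both colors.
  dec_poor : ∀ x y, f x y - f (x - 1) y ≤ u₁
  dec_rich : ∀ x y, f x y - f x (y - 1) ≤ u₁
  dec_both : ∀ x y, f x y - f (x - 1) (y - 1) ≤ u₂
  g_nonneg : 0 ≤ g
  le_g : θ ≤ g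
  u₁_nonneg : 0 ≤ u₁
  u₁_le : u₁ ≤ D - g
  -- These two inequalities pay for a spare unit at a vertex of `A` when one edge, or at least two
  -- edges, leave `A`.
  u₁_add_le : u₁ + θ ≤ g + 1
  u₂_add_le : u₂ + θ ≤ 2 * g + 1
  -- The next three conditions serve to color a vertex of degree at most three last.
  two_dec : θ ≤ D - 3 * u₁ + 1
  three_dec : ∀ x y, x ≤ X → y ≤ Y → f x y ≤ 3 * (D - u₁)
  pos_of_big : ∀ x y, x ≤ X → y ≤ Y → D - u₁ < f x y → 1 ≤ x ∧ 1 ≤ y ∧ 2 ≤ max x y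
  -- Final count: every vertex contributes at most `κ` to twice the total potential.
  count_four : ∀ x y, x ≤ X → y ≤ Y → 2 * f x y - 4 * D ≤ κ
  count_three : ∀ x y, x ≤ X → y ≤ Y → max x y ≤ 2 → D - u₁ < f x y → 2 * f x y - 3 * D ≤ κ
  κ_neg : κ < 0
  κ_lt : κ < 2 * θ

namespace ConflictNetwork

open Finset

variable {α : Type*} [DecidableEq α] (N : ConflictNetwork α)

/-- Every nonempty subset of `S` has potential at least `θ`. -/
def HasPotential (D θ : ℤ) (f : ℕ → ℕ → ℤ) (x : α → Bool → ℕ) (S : Finset α) : Prop :=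
  ∀ T ⊆ S, T.Nonempty → θ ≤ N.potential D (fun v => f (x v false) (x v true)) T

variable {N} {D g θ u₁ u₂ κ : ℤ} {X Y : ℕ} {f : ℕ → ℕ → ℤ} {x : α → Bool → ℕ} {S A : Finset α}
  {u₀ v₀ : α}

lemma _root_.DefectiveDP.IsPotentialFunction.dec_poor_mul
    (h : IsPotentialFunction D g θ u₁ u₂ κ X Y f) (a b m : ℕ) :
    f a b - f (a - m) b ≤ u₁ * m := by
  induction m with
  | zero => simp
  | succ m ih =>
    have := h.dec_poor (a - m) b
    rw [Nat.sub_sub] at this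
    push_cast
    linarith

lemma _root_.DefectiveDP.IsPotentialFunction.dec_rich_mul
    (h : IsPotentialFunction D g θ u₁ u₂ κ X Y f) (a b m : ℕ) :
    f a b - f a (b - m) ≤ u₁ * m := by
  induction m with
  | zero => simp
  | succ m ih =>
    have := h.dec_rich a (b - m)
    rw [Nat.sub_sub] at this
    push_cast
    linarith

/-- The set of capacity functions for which smaller sets are known to be colorable. -/
def SmallerColorable (N : ConflictNetwork α) (D θ : ℤ) (X Y : ℕ) (f : ℕ → ℕ → ℤ)
    (S : Finset α) : Prop :=
  ∀ B ⊂ S, ∀ x : α → Bool → ℕ, (∀ v ∈ B, x v false ≤ X ∧ x v true ≤ Y) →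
    N.HasPotential D θ f x B → N.Colorable B x

omit [DecidableEq α] in
-- An edge to `A` conflicts with at most one color of `v`. Hence losing one color uses at least one
-- edge and losing both uses two, while each loss costs at most `D - g`.
lemma residual_zero_drop (h : IsPotentialFunction D g θ u₁ u₂ κ X Y f) (A : Finset α)
    (φ : α → Bool) {v : α} (hv : x v false ≤ X ∧ x v true ≤ Y) :
    f (x v false) (x v true) -
      f (N.residual x A φ (fun _ _ => 0) v false) (N.residual x A φ (fun _ _ => 0) v true) ≤
      (D - g) * N.degTo v A := by
  have hle := N.confTo_add_le v A φ
  have hpos : 0 ≤ D - g := h.u₁_nonneg.trans h.u₁_le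
  have key : ∀ b, N.residual x A φ (fun _ _ => 0) v b =
      if N.confTo v b A φ = 0 then x v b else 0 := by
    intro b
    have : (∀ u ∈ A, N.conf v b u (φ u) ≤ 0) ↔ N.confTo v b A φ = 0 := by
      simp [confTo, sum_eq_zero_iff]
    simp only [residual, this]
    split_ifs with h1
    · rw [h1, Nat.sub_zero]
    · rfl
  rw [key, key]
  have h1 := h.forbid_poor (x v false) (x v true) hv.1 hv.2
  have h2 := h.forbid_rich (x v false) (x v true) hv.1 hv.2
  have h3 := h.forbid_rich 0 (x v true) (Nat.zero_le _) hv.2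
  split_ifs with h4 h5 h5
  · simp only [sub_self]; positivity
  · have : (1 : ℤ) ≤ N.degTo v A := by exact_mod_cast (by omega : 1 ≤ N.degTo v A)
    nlinarith
  · have : (1 : ℤ) ≤ N.degTo v A := by exact_mod_cast (by omega : 1 ≤ N.degTo v A)
    nlinarith
  · have : (2 : ℤ) ≤ N.degTo v A := by exact_mod_cast (by omega : 2 ≤ N.degTo v A)
    nlinarith

/-- The permitted conflict lets one edge cost `u₁` instead of `D - g`. If `u₀` conflicts twice with
some color, that color is lost, but then two edges are available to pay for it. -/
lemma residual_single_drop (h : IsPotentialFunction D g θ u₁ u₂ κ X Y f)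
    (φ : α → Bool) (hv : x v₀ false ≤ X ∧ x v₀ true ≤ Y) (hu₀ : u₀ ∈ A)
    (hm : 1 ≤ N.mult v₀ u₀) (p : α → α → ℕ) (hp : ∀ u, p v₀ u = if u = u₀ then 1 else 0) :
    f (x v₀ false) (x v₀ true) -
      f (N.residual x A φ p v₀ false) (N.residual x A φ p v₀ true) ≤
      u₁ + (D - g) * (N.degTo v₀ A - 1) := by
  have hpos : 0 ≤ D - g := h.u₁_nonneg.trans h.u₁_le
  have hu₁ := h.u₁_nonneg
  have hA : insert u₀ (A.erase u₀) = A := insert_erase hu₀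
  have hdeg : N.degTo v₀ A = N.mult v₀ u₀ + N.degTo v₀ (A.erase u₀) := by
    conv_lhs => rw [← hA]
    exact sum_insert (notMem_erase u₀ A)
  have hconf : ∀ b, N.confTo v₀ b A φ = N.conf v₀ b u₀ (φ u₀) + N.confTo v₀ b (A.erase u₀) φ := by
    intro b
    conv_lhs => rw [← hA]
    exact sum_insert (notMem_erase u₀ A)
  have hr := N.confTo_add_le v₀ (A.erase u₀) φ
  have hc := N.conf_le' v₀ u₀ (φ u₀)
  have key : ∀ b, N.residual x A φ p v₀ b =
      if N.conf v₀ b u₀ (φ u₀) ≤ 1 ∧ N.confTo v₀ b (A.erase u₀) φ = 0 then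
        x v₀ b - N.conf v₀ b u₀ (φ u₀) else 0 := by
    intro b
    have : (∀ u ∈ A, N.conf v₀ b u (φ u) ≤ p v₀ u) ↔
        N.conf v₀ b u₀ (φ u₀) ≤ 1 ∧ N.confTo v₀ b (A.erase u₀) φ = 0 := by
      conv_lhs => rw [← hA]
      rw [forall_mem_insert, hp]
      simp only [if_true, confTo, sum_eq_zero_iff]
      refine and_congr_right fun _ => forall₂_congr fun u hu => ?_
      rw [hp, if_neg (ne_of_mem_erase hu), Nat.le_zero]
    simp only [residual, this, hconf]
    split_ifs with h1
    · rw [h1.2, Nat.add_zero]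
    · rfl
  rw [key, key, hdeg]
  generalize N.conf v₀ false u₀ (φ u₀) = c at *
  generalize N.conf v₀ true u₀ (φ u₀) = c' at *
  generalize N.confTo v₀ false (A.erase u₀) φ = r at *
  generalize N.confTo v₀ true (A.erase u₀) φ = r' at *
  generalize x v₀ false = a at *
  generalize x v₀ true = b at *
  have h1 := h.forbid_poor a b hv.1 hv.2
  have h2 := h.forbid_rich a b hv.1 hv.2
  have h3 := h.forbid_rich 0 b (Nat.zero_le _) hv.2
  have key2 : ∀ k : ℕ, k ≤ N.mult v₀ u₀ + N.degTo v₀ (A.erase u₀) →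
      (D - g) * (k - 1) ≤
        (D - g) * (((N.mult v₀ u₀ + N.degTo v₀ (A.erase u₀) : ℕ) : ℤ) - 1) := by
    intro k hk
    apply mul_le_mul_of_nonneg_left _ hpos
    have : (k : ℤ) ≤ ((N.mult v₀ u₀ + N.degTo v₀ (A.erase u₀) : ℕ) : ℤ) := by exact_mod_cast hk
    linarith
  have hle := h.u₁_le
  split_ifs with h4 h5 h5
  · have h6 := h.dec_poor_mul a b c
    have h7 := h.dec_rich_mul (a - c) b c'
    by_cases h8 : c + c' ≤ 1
    · have := key2 1 (by omega)
      have h9 : (c : ℤ) + c' ≤ 1 := by exact_mod_cast h8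
      push_cast at *
      nlinarith
    · have := key2 2 (by omega)
      have h9 : (c : ℤ) = 1 := by exact_mod_cast (by omega : c = 1)
      have h10 : (c' : ℤ) = 1 := by exact_mod_cast (by omega : c' = 1)
      rw [h9] at h6
      rw [h10] at h7
      push_cast at *
      linarith
  · have h6 := h.dec_poor_mul a 0 c
    have := key2 2 (by omega)
    have h9 : u₁ * c ≤ u₁ := by
      have : (c : ℤ) ≤ 1 := by exact_mod_cast h4.1
      nlinarith
    push_cast at *
    linarith
  · have h6 := h.dec_rich_mul 0 b c'
    have := key2 2 (by omega)
    have h9 : u₁ * c' ≤ u₁ := by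
      have : (c' : ℤ) ≤ 1 := by exact_mod_cast h5.1
      nlinarith
    push_cast at *
    linarith
  · have := key2 3 (by omega)
    push_cast at *
    linarith

omit [DecidableEq α] in
lemma residual_bounded {B : Finset α} (hx : ∀ v ∈ B, x v false ≤ X ∧ x v true ≤ Y)
    (φ : α → Bool) (p : α → α → ℕ) :
    ∀ v ∈ B, N.residual x A φ p v false ≤ X ∧ N.residual x A φ p v true ≤ Y := fun v hv =>
  ⟨(N.residual_le ..).trans (hx v hv).1, (N.residual_le ..).trans (hx v hv).2⟩

lemma union_sdiff_ssubset {T : Finset α} (hA : A ⊂ S) (hne : A.Nonempty) :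
    S \ A ⊂ S ∧ Disjoint A (S \ A) ∧ A ∪ S \ A = S ∧ (T ⊆ S \ A → Disjoint A T) :=
  ⟨sdiff_ssubset hA.subset hne, disjoint_sdiff, union_sdiff_of_subset hA.subset,
    fun hT => disjoint_sdiff.mono_right hT⟩

/-- If a set of least potential is colored so that one conflict at an edge to the rest can be
permitted, the coloring extends if the potential stays large enough. -/
lemma colorable_of_permitted (h : IsPotentialFunction D g θ u₁ u₂ κ X Y f)
    (hx : ∀ v ∈ S, x v false ≤ X ∧ x v true ≤ Y) (hS : N.HasPotential D θ f x S)
    (ih : N.SmallerColorable D θ X Y f S) (hA : A ⊂ S) (hne : A.Nonempty)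
    (hmin : ∀ T ⊂ S, T.Nonempty →
      N.potential D (fun v => f (x v false) (x v true)) A ≤
        N.potential D (fun v => f (x v false) (x v true)) T)
    (hu₀ : u₀ ∈ A) (hv₀ : v₀ ∈ S \ A) (hm : 1 ≤ N.mult v₀ u₀) {φ : α → Bool}
    (hφ : ∀ v ∈ A, N.confTo v (φ v) A φ + (if v = u₀ then 1 else 0) < x v (φ v))
    (hp : θ + N.potential D (fun v => f (x v false) (x v true)) A ≤
      N.potential D (fun v => f (x v false) (x v true)) S +
        (D - u₁ + g * (N.cross (S \ A) A - 1))) :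
    N.Colorable S x := by
  obtain ⟨hB, hdisj, hunion, -⟩ := union_sdiff_ssubset (T := ∅) hA hne
  rw [← hunion]
  set w := fun v => f (x v false) (x v true) with hw
  set p : α → α → ℕ := fun v u => if v = v₀ ∧ u = u₀ then 1 else 0 with hpdef
  refine Colorable.of_residual N hdisj (φ := φ) (p := p) (fun u hu => ?_) ?_
  · convert hφ u hu using 2
    rw [sum_eq_single_of_mem v₀ hv₀ fun v _ hv => by simp [p, hv]]
    simp [p]
  refine ih _ hB _ (residual_bounded (fun v hv => hx v (mem_sdiff.1 hv).1) φ p) fun T hT hTne => ?_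
  have hTA := (union_sdiff_ssubset (T := T) hA hne).2.2.2 hT
  have hun := N.potential_union hTA D w
  have hg := h.g_nonneg
  have hcmp : ∀ v ∈ T, w v - f (N.residual x A φ p v false) (N.residual x A φ p v true) ≤
      (D - g) * N.degTo v A + if v = v₀ then u₁ - (D - g) else 0 := by
    intro v hv
    have hvS := hx v (mem_sdiff.1 (hT hv)).1
    by_cases hvv : v = v₀
    · subst hvv
      have := residual_single_drop (N := N) h φ hvS hu₀ hm p (fun u => by simp [p])
      simp only [if_true]
      linarith
    · have h1 := residual_zero_drop (N := N) h A φ hvS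
      have h2 : ∀ b, N.residual x A φ p v b = N.residual x A φ (fun _ _ => 0) v b := by
        intro b
        simp [residual, p, hvv]
      rw [if_neg hvv, add_zero, h2, h2]
      exact h1
  have hdrop := N.potential_drop D hcmp
  have hsum : ∑ v ∈ T, ((D - g) * (N.degTo v A : ℤ) + if v = v₀ then u₁ - (D - g) else 0) =
      (D - g) * N.cross T A + if v₀ ∈ T then u₁ - (D - g) else 0 := by
    rw [sum_add_distrib, ← mul_sum, sum_ite_eq' T v₀, cross]
    push_cast
    rfl
  rw [hsum] at hdrop
  have hle := h.u₁_le
  have hθ := h.le_g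
  by_cases hc : N.cross T A = 0
  -- Without edges to `A` nothing is lost on `T`.
  · have hTθ := hS T (hT.trans sdiff_subset) hTne
    rw [hc] at hdrop
    have : (if v₀ ∈ T then u₁ - (D - g) else 0) ≤ 0 := by split_ifs <;> linarith
    simp only [Nat.cast_zero, mul_zero, zero_add] at hdrop
    linarith
  · have hc1 : (1 : ℤ) ≤ N.cross T A := by exact_mod_cast Nat.one_le_iff_ne_zero.2 hc
    by_cases hs : A ∪ T ⊂ S
    -- Minimality of `A` gives `T` at least `D` per crossing edge. Only `D - g` of it is spent,
    -- which leaves at least `g ≥ θ`.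
    · have hpT := hmin _ hs (hne.mono subset_union_left)
      have : (if v₀ ∈ T then u₁ - (D - g) else 0) ≤ 0 := by split_ifs <;> linarith
      nlinarith
    · have := sdiff_eq_of_union hT hs hA.subset
      subst this
      rw [if_pos hv₀] at hdrop
      rw [hunion] at hun
      linarith

/-- A coloring of a set of least potential extends if the potential stays large enough when all
conflicts with it are forbidden. -/
lemma colorable_of_forbidden (h : IsPotentialFunction D g θ u₁ u₂ κ X Y f)
    (hx : ∀ v ∈ S, x v false ≤ X ∧ x v true ≤ Y) (hS : N.HasPotential D θ f x S)
    (ih : N.SmallerColorable D θ X Y f S) (hA : A ⊂ S) (hne : A.Nonempty)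
    (hmin : ∀ T ⊂ S, T.Nonempty →
      N.potential D (fun v => f (x v false) (x v true)) A ≤
        N.potential D (fun v => f (x v false) (x v true)) T)
    (hp : N.cross (S \ A) A = 0 ∨ θ + N.potential D (fun v => f (x v false) (x v true)) A ≤
      N.potential D (fun v => f (x v false) (x v true)) S + g * N.cross (S \ A) A) :
    N.Colorable S x := by
  obtain ⟨φ, hφ⟩ := ih A hA x (fun v hv => hx v (hA.subset hv))
    fun T hT => hS T (hT.trans hA.subset)
  obtain ⟨hB, hdisj, hunion, -⟩ := union_sdiff_ssubset (T := ∅) hA hne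
  rw [← hunion]
  set w := fun v => f (x v false) (x v true) with hw
  refine Colorable.of_residual N hdisj (φ := φ) (p := fun _ _ => 0)
    (fun u hu => by simpa using hφ u hu) ?_
  refine ih _ hB _ (residual_bounded (fun v hv => hx v (mem_sdiff.1 hv).1) φ _) fun T hT hTne => ?_
  have hTA := (union_sdiff_ssubset (T := T) hA hne).2.2.2 hT
  have hun := N.potential_union hTA D w
  have hg := h.g_nonneg
  have hdrop := N.potential_drop D fun v hv =>
    residual_zero_drop (N := N) h A φ (hx v (mem_sdiff.1 (hT hv)).1)
  have hsum : ∑ v ∈ T, ((D - g) * (N.degTo v A : ℤ)) = (D - g) * N.cross T A := by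
    rw [← mul_sum, cross]
    push_cast
    rfl
  rw [hsum] at hdrop
  have hθ := h.le_g
  by_cases hc : N.cross T A = 0
  · have hTθ := hS T (hT.trans sdiff_subset) hTne
    rw [hc] at hdrop
    simp only [Nat.cast_zero, mul_zero] at hdrop
    linarith
  · have hc1 : (1 : ℤ) ≤ N.cross T A := by exact_mod_cast Nat.one_le_iff_ne_zero.2 hc
    by_cases hs : A ∪ T ⊂ S
    · have hpT := hmin _ hs (hne.mono subset_union_left)
      nlinarith
    · have := sdiff_eq_of_union hT hs hA.subset
      subst this
      rw [hunion] at hun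
      rcases hp with hp | hp
      · exact absurd hp hc
      · linarith

end ConflictNetwork

end DefectiveDP

/-! ### Minimal counterexamples: bridges, vertices of small degree, and the final count. -/

namespace DefectiveDP

namespace ConflictNetwork

open Finset

variable {α : Type*} [DecidableEq α] {N : ConflictNetwork α} {D g θ u₁ u₂ κ : ℤ} {X Y : ℕ}
  {f : ℕ → ℕ → ℤ} {x : α → Bool → ℕ} {S A : Finset α}

omit [DecidableEq α] in
lemma exists_mult_pos {B A : Finset α} (h : 1 ≤ N.cross B A) :
    ∃ v ∈ B, ∃ u ∈ A, 1 ≤ N.mult v u := by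
  obtain ⟨v, hv, hv'⟩ := exists_ne_zero_of_sum_ne_zero (by unfold cross at h; omega :
    ∑ v ∈ B, N.degTo v A ≠ 0)
  obtain ⟨u, hu, hu'⟩ := exists_ne_zero_of_sum_ne_zero hv'
  exact ⟨v, hv, u, hu, Nat.one_le_iff_ne_zero.2 hu'⟩

lemma mult_eq_zero_of_cross_eq_one {B A : Finset α} (h : N.cross B A = 1) {v₀ u₀ : α}
    (hv₀ : v₀ ∈ B) (hu₀ : u₀ ∈ A) (hm : 1 ≤ N.mult v₀ u₀) {v u : α} (hv : v ∈ B) (hu : u ∈ A)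
    (hne : ¬ (v = v₀ ∧ u = u₀)) : N.mult v u = 0 := by
  have h1 : N.degTo v₀ A + ∑ w ∈ B.erase v₀, N.degTo w A = 1 := by
    rw [← h]
    exact add_sum_erase B (fun v => N.degTo v A) hv₀
  have h2 : N.mult v₀ u₀ + ∑ w ∈ A.erase u₀, N.mult v₀ w = N.degTo v₀ A :=
    add_sum_erase A (fun u => N.mult v₀ u) hu₀
  by_cases hvv : v = v₀
  · subst hvv
    have : u ∈ A.erase u₀ := mem_erase.2 ⟨fun h => hne ⟨rfl, h⟩, hu⟩
    have := single_le_sum (f := fun u => N.mult v u) (fun _ _ => Nat.zero_le _) this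
    omega
  · have h3 := single_le_sum (f := fun v => N.degTo v A) (fun _ _ => Nat.zero_le _)
      (mem_erase.2 ⟨hvv, hv⟩)
    have h4 := N.mult_le_degTo hu v
    omega

/-- Lower the capacity of `u₀` in the colors of `C` by one. -/
def lower (x : α → Bool → ℕ) (u₀ : α) (C : Finset Bool) : α → Bool → ℕ :=
  fun v b => if v = u₀ ∧ b ∈ C then x v b - 1 else x v b

lemma lower_le (x : α → Bool → ℕ) (u₀ : α) (C : Finset Bool) (v : α) (b : Bool) :
    lower x u₀ C v b ≤ x v b := by
  unfold lower
  split_ifs <;> omega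

/-- Only sets containing `u₀` lose potential, and all subsets of `A` start with at least the least
potential `p`. -/
lemma exists_coloring_lower (hx : ∀ v ∈ S, x v false ≤ X ∧ x v true ≤ Y)
    (ih : N.SmallerColorable D θ X Y f S) (hA : A ⊂ S)
    {p c : ℤ} (hmin : ∀ T ⊂ S, T.Nonempty →
      p ≤ N.potential D (fun v => f (x v false) (x v true)) T)
    (u₀ : α) (C : Finset Bool)
    (hc : f (x u₀ false) (x u₀ true) -
      f (lower x u₀ C u₀ false) (lower x u₀ C u₀ true) ≤ c) (hc0 : 0 ≤ c) (hp : θ + c ≤ p) :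
    N.Colorable A (lower x u₀ C) := by
  refine ih A hA _ (fun v hv => ⟨(lower_le ..).trans (hx v (hA.subset hv)).1,
    (lower_le ..).trans (hx v (hA.subset hv)).2⟩) fun T hT hTne => ?_
  have hdrop := N.potential_drop (T := T) (w := fun v => f (x v false) (x v true))
    (w' := fun v => f (lower x u₀ C v false) (lower x u₀ C v true)) D
    (c := fun v => if v = u₀ then c else 0) fun v hv => by
      by_cases hvu : v = u₀
      · subst hvu
        simpa using hc
      · simp [lower, hvu]
  rw [sum_ite_eq' T u₀] at hdrop
  have h1 := hmin T (hT.trans_ssubset hA) hTne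
  have h2 : (if u₀ ∈ T then c else 0) ≤ c := by split_ifs <;> linarith
  linarith

lemma IsColoring.of_lower {u₀ : α} {C : Finset Bool} {φ : α → Bool}
    (h : N.IsColoring A (lower x u₀ C) φ) : N.IsColoring A x φ := fun v hv =>
  (h v hv).trans_le (lower_le ..)

lemma IsColoring.slack_of_lower {u₀ : α} {C : Finset Bool} {φ : α → Bool}
    (h : N.IsColoring A (lower x u₀ C) φ) (hu : φ u₀ ∈ C) :
    ∀ v ∈ A, N.confTo v (φ v) A φ + (if v = u₀ then 1 else 0) < x v (φ v) := by
  intro v hv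
  have := h v hv
  unfold lower at this
  by_cases hvu : v = u₀
  · subst hvu
    rw [if_pos ⟨rfl, hu⟩] at this
    rw [if_pos rfl]
    omega
  · rw [if_neg (fun h => hvu h.1)] at this
    rwa [if_neg hvu]

/-- Two colorings that differ at the end of a bridge extend any coloring of the other side. -/
lemma colorable_of_bridge {A B : Finset α} (hdisj : Disjoint A B) (h : N.cross B A = 1)
    {v₀ u₀ : α} (hv₀ : v₀ ∈ B) (hu₀ : u₀ ∈ A) (hm : 1 ≤ N.mult v₀ u₀) {φ : Bool → α → Bool}
    (hφ : ∀ b, N.IsColoring A x (φ b)) (hφu : ∀ b, φ b u₀ = b) (hB : N.Colorable B x) :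
    N.Colorable (A ∪ B) x := by
  obtain ⟨ψ, hψ⟩ := hB
  have hdeg : N.mult v₀ u₀ ≤ 1 := by
    rw [← h]
    exact (N.mult_le_degTo hu₀ v₀).trans (N.degTo_le_cross hv₀ A)
  obtain ⟨b, hb⟩ : ∃ b, N.conf u₀ b v₀ (ψ v₀) = 0 := by
    have := N.conf_le' u₀ v₀ (ψ v₀)
    rw [N.mult_symm] at this
    by_cases h0 : N.conf u₀ false v₀ (ψ v₀) = 0
    · exact ⟨_, h0⟩
    · exact ⟨true, by omega⟩
  have key : ∀ u ∈ A, ∀ v ∈ B, N.conf u (φ b u) v (ψ v) = 0 := by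
    intro u hu v hv
    by_cases huv : v = v₀ ∧ u = u₀
    · rw [huv.1, huv.2, hφu, hb]
    · have h1 := mult_eq_zero_of_cross_eq_one h hv₀ hu₀ hm hv hu huv
      have h2 := N.conf_le u (φ b u) v
      rw [N.mult_symm, h1] at h2
      cases ψ v <;> omega
  refine Colorable.glue N hdisj (φ := φ b) (ψ := ψ) (fun u hu => ?_) fun v hv => ?_
  · rw [show N.confTo u (φ b u) B ψ = 0 from sum_eq_zero fun v hv => key u hu v hv]
    exact hφ b u hu
  · rw [show N.confTo v (ψ v) A (φ b) = 0 from
      sum_eq_zero fun u hu => by rw [N.conf_symm]; exact key u hu v hv, zero_add]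
    exact hψ v hv

/-- In a minimal counterexample, all proper subsets have large potential. -/
lemma lt_potential_of_not_colorable (h : IsPotentialFunction D g θ u₁ u₂ κ X Y f)
    (hx : ∀ v ∈ S, x v false ≤ X ∧ x v true ≤ Y) (hS : N.HasPotential D θ f x S)
    (ih : N.SmallerColorable D θ X Y f S) (hcol : ¬ N.Colorable S x) (hcard : 2 ≤ S.card) :
    ∀ T ⊂ S, T.Nonempty → D - u₁ < N.potential D (fun v => f (x v false) (x v true)) T := by
  obtain ⟨A, hA, hne, hmin⟩ :=
    N.exists_min_potential D (fun v => f (x v false) (x v true)) hcard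
  refine fun T hT hTne => lt_of_lt_of_le ?_ (hmin T hT hTne)
  clear T hT hTne
  by_contra! hp
  obtain ⟨hB, hdisj, hunion, -⟩ := union_sdiff_ssubset (T := ∅) hA hne
  have hforb := mt (colorable_of_forbidden h hx hS ih hA hne hmin) hcol
  push Not at hforb
  -- As the potential of `S` is at least `θ`, `hlow` says that the potential of `A` exceeds `g`
  -- times the number of crossing edges. This surplus pays for lowering capacities at `u₀`.
  obtain ⟨hc0, hlow⟩ := hforb
  have hSθ := hS S Subset.rfl (hne.mono hA.subset)
  have hc1 : 1 ≤ N.cross (S \ A) A := Nat.one_le_iff_ne_zero.2 hc0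
  have hc1' : (1 : ℤ) ≤ N.cross (S \ A) A := by exact_mod_cast hc1
  have hg := h.g_nonneg
  obtain ⟨v₀, hv₀, u₀, hu₀, hm⟩ := exists_mult_pos hc1
  have hperm : ∀ φ : α → Bool, (∀ v ∈ A,
      N.confTo v (φ v) A φ + (if v = u₀ then 1 else 0) < x v (φ v)) → False := fun φ hφ =>
    hcol <| colorable_of_permitted h hx hS ih hA hne hmin hu₀ hv₀ hm hφ (by nlinarith)
  have hu₁ := h.u₁_add_le
  have hu₂ := h.u₂_add_le
  by_cases hc2 : N.cross (S \ A) A = 1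
  · rw [hc2] at hlow
    -- Lower the capacity of color `!b` at `u₀`. A coloring that still used `!b` there would have a
    -- spare unit and extend by `hperm`; so it uses `b`.
    have hex : ∀ b, ∃ φ, N.IsColoring A x φ ∧ φ u₀ = b := by
      intro b
      obtain ⟨φ, hφ⟩ := exists_coloring_lower hx ih hA hmin u₀ {!b} (c := u₁)
        (by
          cases b
          · simpa [lower] using h.dec_rich (x u₀ false) (x u₀ true)
          · simpa [lower] using h.dec_poor (x u₀ false) (x u₀ true))
        h.u₁_nonneg (by push_cast at hlow; linarith)
      refine ⟨φ, hφ.of_lower, ?_⟩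
      by_contra hb
      refine hperm φ (hφ.slack_of_lower ?_)
      rw [mem_singleton]
      cases b <;> simpa using hb
    choose φ hφ hφu using hex
    refine hcol (hunion ▸ colorable_of_bridge hdisj hc2 hv₀ hu₀ hm hφ hφu ?_)
    exact ih _ hB _ (fun v hv => hx v (hB.subset hv)) fun T hT => hS T (hT.trans hB.subset)
  -- With two crossing edges both colors of `u₀` can be lowered, so there is a spare unit whichever
  -- color is used.
  · have hc3 : (2 : ℤ) ≤ N.cross (S \ A) A := by
      exact_mod_cast (by omega : 2 ≤ N.cross (S \ A) A)
    obtain ⟨φ, hφ⟩ := exists_coloring_lower hx ih hA hmin u₀ univ (c := max 0 u₂)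
      (by
        refine le_max_of_le_right ?_
        simpa [lower] using h.dec_both (x u₀ false) (x u₀ true))
      (le_max_left _ _) (by
        have := h.le_g
        rw [← max_add_add_left, max_le_iff]
        constructor <;> nlinarith)
    exact hperm φ (hφ.slack_of_lower (mem_univ _))

/-- A vertex of small degree can be colored last. -/
lemma colorable_of_small_degree (h : IsPotentialFunction D g θ u₁ u₂ κ X Y f)
    (hx : ∀ v ∈ S, x v false ≤ X ∧ x v true ≤ Y) (hS : N.HasPotential D θ f x S)
    (ih : N.SmallerColorable D θ X Y f S)
    (hlow : ∀ T ⊂ S, T.Nonempty → D - u₁ < N.potential D (fun v => f (x v false) (x v true)) T)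
    {v : α} (hv : v ∈ S) (hd : N.degTo v S ≤ 3) {b : Bool} (hb : N.degTo v S ≤ x v b)
    (hb1 : 1 ≤ x v b) (hb2 : 1 ≤ x v !b) : N.Colorable S x := by
  have hB : S.erase v ⊂ S := erase_ssubset hv
  have hdisj : Disjoint (S.erase v) {v} := by simp
  have hunion : S.erase v ∪ {v} = S := by rw [union_comm, ← insert_eq, insert_erase hv]
  have hdeg : N.degTo v (S.erase v) = N.degTo v S := by
    rw [← hunion, N.degTo_union hdisj]
    simp [degTo, N.mult_self]
  set w := fun v => f (x v false) (x v true) with hw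
  -- The conflicts that color `b` at `v` would cause are charged to the neighbors in advance, at
  -- cost `u₁` per edge.
  obtain ⟨φ, hφ⟩ : N.Colorable (S.erase v) fun u c => x u c - N.conf v b u c := by
    refine ih _ hB _ (fun u hu => ?_) fun T hT hTne => ?_
    · have := hx u (hB.subset hu)
      omega
    have hdrop := N.potential_drop (T := T) (w := w)
      (w' := fun u => f (x u false - N.conf v b u false) (x u true - N.conf v b u true)) D
      (c := fun u => u₁ * N.mult v u) fun u hu => by
        have h1 := h.dec_poor_mul (x u false) (x u true) (N.conf v b u false)
        have h2 := h.dec_rich_mul (x u false - N.conf v b u false) (x u true) (N.conf v b u true)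
        have h3 : (N.conf v b u false + N.conf v b u true : ℤ) ≤ N.mult v u := by
          exact_mod_cast N.conf_le v b u
        have := h.u₁_nonneg
        simp only [hw]
        nlinarith
    rw [← mul_sum, ← Nat.cast_sum] at hdrop
    change _ - u₁ * (N.degTo v T : ℤ) ≤ _ at hdrop
    have hT2 : T ⊂ S := hT.trans_ssubset hB
    have h1 := hlow T hT2 hTne
    have h2 := h.two_dec
    have h3 := h.u₁_nonneg
    by_cases hd2 : N.degTo v T ≤ 2
    · have : (N.degTo v T : ℤ) ≤ 2 := by exact_mod_cast hd2
      nlinarith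
    -- Three units cost more than the bound for proper subsets may allow; here the bound for `T ∪
    -- {v}` is used, with `three_dec`.
    · have h4 : N.degTo v T ≤ 3 := ((N.degTo_mono v hT).trans_eq hdeg).trans hd
      have h5 : (N.degTo v T : ℤ) = 3 := by exact_mod_cast (by omega : N.degTo v T = 3)
      have hvT : Disjoint T {v} := by
        rw [disjoint_singleton_right]
        exact fun h => notMem_erase v S (hT h)
      have h6 := hS (T ∪ {v}) (hunion ▸ union_subset_union hT Subset.rfl)
        (hTne.mono subset_union_left)
      rw [N.potential_union hvT, N.potential_singleton, N.cross_singleton, h5] at h6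
      have h7 := h.three_dec (x v false) (x v true) (hx v hv).1 (hx v hv).2
      rw [h5] at hdrop
      nlinarith
  have hslack : ∀ u ∈ S.erase v, N.confTo u (φ u) (S.erase v) φ + N.conf v b u (φ u) < x u (φ u) :=
    fun u hu => by
      have : _ < x u (φ u) - N.conf v b u (φ u) := hφ u hu
      omega
  rw [← hunion]
  have hsum := N.confTo_add_le v (S.erase v) φ
  by_cases hb3 : N.confTo v b (S.erase v) φ < x v b
  · refine Colorable.glue N hdisj (φ := φ) (ψ := fun _ => b) (fun u hu => ?_) fun u hu => ?_
    · rw [show N.confTo u (φ u) {v} (fun _ => b) = N.conf v b u (φ u) by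
        simp [confTo, N.conf_symm u]]
      exact hslack u hu
    · rw [mem_singleton] at hu
      subst hu
      simpa [confTo, N.conf_self] using hb3
  -- If `b` fails, then all edges at `v` conflict with `b`, because `x v b` is at least the degree.
  -- So none conflicts with the other color.
  · have h0 : N.confTo v (!b) (S.erase v) φ = 0 := by
      cases b <;> simp only [Bool.not_false, Bool.not_true] at * <;> omega
    refine Colorable.glue N hdisj (φ := φ) (ψ := fun _ => !b) (fun u hu => ?_) fun u hu => ?_
    · have : N.conf v (!b) u (φ u) = 0 := (sum_eq_zero_iff.1 h0) u hu
      rw [show N.confTo u (φ u) {v} (fun _ => !b) = N.conf v (!b) u (φ u) by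
        simp [confTo, N.conf_symm u], this]
      have := hslack u hu
      omega
    · rw [mem_singleton] at hu
      subst hu
      rw [h0]
      simp only [confTo, sum_singleton, N.conf_self]
      omega

/-- If all nonempty subsets of `S` have potential at least `θ`, then `S` is colorable. -/
theorem colorable_of_hasPotential (h : IsPotentialFunction D g θ u₁ u₂ κ X Y f)
    (S : Finset α) : ∀ x : α → Bool → ℕ, (∀ v ∈ S, x v false ≤ X ∧ x v true ≤ Y) →
      N.HasPotential D θ f x S → N.Colorable S x := by
  induction S using Finset.strongInduction with
  | H S ih =>
  intro x hx hS
  rcases Nat.lt_or_ge S.card 2 with hcard | hcard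
  · rcases S.eq_empty_or_nonempty with rfl | hne
    · exact ⟨fun _ => false, by simp [IsColoring]⟩
    obtain ⟨v, rfl⟩ := card_eq_one.1 (by have := hne.card_pos; omega : S.card = 1)
    have h1 := hS _ Subset.rfl hne
    rw [N.potential_singleton] at h1
    have h0 := h.zero
    obtain ⟨b, hb⟩ : ∃ b, x v b ≠ 0 := by
      by_contra! hb
      rw [hb, hb] at h1
      linarith
    refine ⟨fun _ => b, fun u hu => ?_⟩
    rw [mem_singleton] at hu
    subst hu
    simp only [confTo, sum_singleton, N.conf_self]
    omega
  by_contra hcol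
  have hlow := lt_potential_of_not_colorable h hx hS ih hcol hcard
  have hne : S.Nonempty := card_pos.1 (by omega)
  -- A violation forces degree at most three. Then `v` can be colored last, except for degree three
  -- with both capacities at most two, which `count_three` excludes.
  have hcount : ∀ v ∈ S, 2 * f (x v false) (x v true) - D * N.degTo v S ≤ κ := by
    intro v hv
    have hxv := hx v hv
    have hss : {v} ⊂ S := (singleton_subset_iff.2 hv).ssubset_of_ne fun h => by
      rw [← h, card_singleton] at hcard
      omega
    have hbig := hlow {v} hss (singleton_nonempty v)
    rw [N.potential_singleton] at hbig
    obtain ⟨h1, h2, h3⟩ := h.pos_of_big _ _ hxv.1 hxv.2 hbig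
    have hD : 0 ≤ D := by linarith [h.g_nonneg, h.u₁_nonneg, h.u₁_le]
    obtain ⟨b, hb, hb'⟩ : ∃ b, x v b = max (x v false) (x v true) ∧ 1 ≤ x v !b := by
      rcases le_total (x v false) (x v true) with hle | hle
      · exact ⟨true, by simp [hle], h1⟩
      · exact ⟨false, by simp [hle], h2⟩
    by_contra! hκ
    have hdeg : N.degTo v S ≤ 3 := by
      by_contra! hd
      have : (4 : ℤ) ≤ N.degTo v S := by exact_mod_cast hd
      have := h.count_four _ _ hxv.1 hxv.2
      nlinarith
    refine hcol (colorable_of_small_degree h hx hS ih hlow hv hdeg (b := b) ?_ (by omega) hb')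
    by_contra! hlt
    have hd3 : (3 : ℤ) ≤ N.degTo v S := by exact_mod_cast (by omega : 3 ≤ N.degTo v S)
    have := h.count_three _ _ hxv.1 hxv.2 (by omega) hbig
    nlinarith
  have h1 := hS S Subset.rfl hne
  have h2 := N.two_mul_potential D (fun v => f (x v false) (x v true)) S
  have h3 := sum_le_card_nsmul S _ κ hcount
  rw [← h2, nsmul_eq_mul] at h3
  have h4 : (1 : ℤ) ≤ S.card := by exact_mod_cast hne.card_pos
  have := h.κ_neg
  have := h.κ_lt
  nlinarith

end ConflictNetwork

end DefectiveDP

/-! ### The potential functions for `i ≤ j ≤ 2 * i`. -/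

namespace DefectiveDP

/-- At full capacities `i + 1` and `j + 1` the first term of the minimum is the smaller one, so the
weight is `2 * j`. -/
lemma isPotentialFunction_of_le_two_mul {i j : ℕ} (hij : i + 2 ≤ j) (hj : j ≤ 2 * i) :
    IsPotentialFunction (j + 1) 0 (-1) 2 2 (-4) (i + 1) (j + 1)
      fun x y => min (2 * max (x : ℤ) y - 2) (2 * min (x : ℤ) y + j - 1) := by
  constructor <;> intros <;> (try constructor) <;> omega

/-- Both colors play the same role, and full capacities have weight `2 * i + 2`. -/
lemma isPotentialFunction_of_eq {i : ℕ} (hi : 1 ≤ i) :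
    IsPotentialFunction (i + 2) 1 1 1 2 (-1) (i + 1) (i + 1) fun x y => (x : ℤ) + y := by
  constructor <;> intros <;> (try constructor) <;> omega

/-- The correction for `y ≤ x` makes the weight of an uncolorable vertex negative. It vanishes at
full capacities `i + 1` and `i + 2`, whose weight is `2 * i ^ 2 + 4 * i + 1`. -/
lemma isPotentialFunction_of_eq_succ {i : ℕ} (hi : 1 ≤ i) :
    IsPotentialFunction (i ^ 2 + 3 * i + 1) i 0 (i + 1) (2 * i + 1) (-1) (i + 1) (i + 2)
      fun x y => (i + 1) * (x : ℤ) + i * y - if y ≤ x then 1 else 0 := by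
  have hi' : (1 : ℤ) ≤ i := by exact_mod_cast hi
  have key : ∀ x y : ℕ, x ≤ i + 1 → y ≤ i + 2 →
      (i + 1) * (x : ℤ) + i * y - (if y ≤ x then 1 else 0) ≤ 2 * i ^ 2 + 4 * i + 1 := by
    intro x y hx hy
    have hx' : (x : ℤ) ≤ i + 1 := by exact_mod_cast hx
    have hy' : (y : ℤ) ≤ i + 2 := by exact_mod_cast hy
    split_ifs <;> nlinarith
  constructor
  · simp
  · intro x y hx hy
    have hx' : (x : ℤ) ≤ i + 1 := by exact_mod_cast hx
    split_ifs <;> first | omega | (push_cast; nlinarith)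
  · intro x y hx hy
    have hy' : (y : ℤ) ≤ i + 2 := by exact_mod_cast hy
    split_ifs <;> first | omega | (push_cast; nlinarith)
  · intro x y
    rcases x with _ | x
    · simp; omega
    · simp only [Nat.add_sub_cancel]
      push_cast
      split_ifs <;> first | omega | nlinarith
  · intro x y
    rcases y with _ | y
    · simp; omega
    · simp only [Nat.add_sub_cancel]
      push_cast
      split_ifs <;> first | omega | nlinarith
  · intro x y
    rcases x with _ | x <;> rcases y with _ | y <;> simp only [Nat.add_sub_cancel, Nat.zero_sub] <;>
      push_cast <;> (try split_ifs) <;> first | omega | nlinarith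
  · omega
  · omega
  · omega
  · nlinarith
  · omega
  · omega
  · nlinarith
  · intro x y hx hy
    have := key x y hx hy
    nlinarith
  · intro x y hx hy hbig
    have hx' : (x : ℤ) ≤ i + 1 := by exact_mod_cast hx
    have hy' : (y : ℤ) ≤ i + 2 := by exact_mod_cast hy
    have hx1 : 1 ≤ x := by
      by_contra! h0
      obtain rfl : x = 0 := by omega
      split_ifs at hbig <;> (push_cast at hbig; nlinarith)
    have hy1 : 1 ≤ y := by
      by_contra! h0
      obtain rfl : y = 0 := by omega
      rw [if_pos (Nat.zero_le _)] at hbig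
      push_cast at hbig
      nlinarith
    refine ⟨hx1, hy1, ?_⟩
    by_contra! h2
    obtain ⟨rfl, rfl⟩ : x = 1 ∧ y = 1 := by omega
    simp at hbig
    nlinarith
  · intro x y hx hy
    have := key x y hx hy
    nlinarith
  · intro x y hx hy hm hbig
    have : (i + 1) * (x : ℤ) + i * y - (if y ≤ x then 1 else 0) ≤ 4 * i + 1 := by
      have hx' : (x : ℤ) ≤ 2 := by exact_mod_cast (le_max_left x y).trans hm
      have hy' : (y : ℤ) ≤ 2 := by exact_mod_cast (le_max_right x y).trans hm
      split_ifs with h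
      · nlinarith
      · have : (x : ℤ) ≤ 1 := by exact_mod_cast (by omega : x ≤ 1)
        nlinarith
    nlinarith
  · norm_num
  · norm_num

end DefectiveDP

/-! ### Colorability for `j ≥ 2 * i + 1`. -/

namespace DefectiveDP

/-- The potential of a vertex of capacities `x` and `y` in the case `j = 2 * i + 1 + τ`. A vertex
that must be poor (`y = 0`) is treated separately. -/
def richPotential (i τ : ℕ) (x y : ℕ) : ℤ := if y = 0 then x - 1 else min (i + x) (y - 1 - τ)

lemma richPotential_le {i τ x y : ℕ} (hx : x ≤ i + 1) : richPotential i τ x y ≤ 2 * i + 1 := by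
  unfold richPotential
  split_ifs <;> omega

namespace ConflictNetwork

open Finset

variable {α : Type*} [DecidableEq α] (N : ConflictNetwork α) {i τ : ℕ} {x : α → Bool → ℕ}
  {S A : Finset α}

/-- The potential of a vertex set in the case `j = 2 * i + 1 + τ`. -/
def richRho (i τ : ℕ) (x : α → Bool → ℕ) (S : Finset α) : ℤ :=
  N.potential (i + 1) (fun v => richPotential i τ (x v false) (x v true)) S

/-- Every nonempty subset of `S` has potential at least `k - τ`, and at least `k` if it contains a
vertex that must be poor. -/
def HasRichPotential (i τ : ℕ) (k : ℤ) (x : α → Bool → ℕ) (S : Finset α) : Prop :=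
  ∀ T ⊆ S, T.Nonempty →
    k - τ ≤ N.richRho i τ x T ∧ ((∃ v ∈ T, x v true = 0) → k ≤ N.richRho i τ x T)

variable {N}

lemma richRho_union {A B : Finset α} (h : Disjoint A B) :
    N.richRho i τ x (A ∪ B) =
      N.richRho i τ x A + N.richRho i τ x B - (i + 1) * N.cross B A := N.potential_union h _ _

omit [DecidableEq α] in
lemma richRho_singleton (v : α) :
    N.richRho i τ x {v} = richPotential i τ (x v false) (x v true) := N.potential_singleton _ _ v

omit [DecidableEq α] in
/-- The potential condition after a reduction of all capacities by `r`. -/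
lemma HasRichPotential.sub {k : ℕ} (h : N.HasRichPotential i τ k x A) {r : α → ℕ}
    (hr : ∑ v ∈ A, r v ≤ k) : N.HasRichPotential i τ 0 (fun v b => x v b - r v) A := by
  have hrv : ∀ v ∈ A, r v ≤ k := fun v hv =>
    (single_le_sum (f := r) (fun _ _ => Nat.zero_le _) hv).trans hr
  -- Singletons show that every available rich capacity exceeds `k`, so no reduction creates a new
  -- vertex that must be poor.
  have hv : ∀ v ∈ A, (x v true = 0 → k + 1 ≤ x v false) ∧ (x v true ≠ 0 → k + 1 ≤ x v true) := by
    intro v hv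
    have := h {v} (singleton_subset_iff.2 hv) (singleton_nonempty v)
    rw [richRho_singleton] at this
    unfold richPotential at this
    constructor <;> intro h0
    · have h1 := this.2 ⟨v, by simp, h0⟩
      rw [if_pos h0] at h1
      omega
    · have h1 := this.1
      rw [if_neg h0] at h1
      omega
  intro T hT hne
  have hdrop := N.potential_drop (T := T)
    (w := fun v => richPotential i τ (x v false) (x v true))
    (w' := fun v => richPotential i τ (x v false - r v) (x v true - r v)) (i + 1)
    (c := fun v => r v) fun v hvT => by
      have h1 := hv v (hT hvT)
      have h2 := hrv v (hT hvT)
      simp only [richPotential]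
      split_ifs <;> omega
  have h1 : (∑ v ∈ T, (r v : ℤ)) ≤ k := by
    exact_mod_cast (sum_le_sum_of_subset hT).trans hr
  have h2 := h T hT hne
  unfold richRho at *
  refine ⟨by linarith, fun ⟨v, hvT, hv0⟩ => ?_⟩
  have h3 := hv v (hT hvT)
  have h4 := hrv v (hT hvT)
  have h5 : x v true - r v = 0 := hv0
  have := h2.2 ⟨v, hvT, by omega⟩
  linarith

/-- The set of capacity functions for which smaller sets are known to be colorable. -/
def SmallerRichColorable (N : ConflictNetwork α) (i τ : ℕ) (S : Finset α) : Prop :=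
  ∀ B ⊂ S, ∀ x : α → Bool → ℕ, (∀ v ∈ B, x v false ≤ i + 1) → N.HasRichPotential i τ 0 x B →
    N.Colorable B x

/-- A coloring of `A` extends to `S` if all conflicts with the vertices of `K` are permitted, all
others are forbidden, and the potential of the remaining sets is large enough. -/
lemma colorable_of_permitted_set (hx : ∀ v ∈ S, x v false ≤ i + 1)
    (hS : N.HasRichPotential i τ 0 x S) (ih : N.SmallerRichColorable i τ S)
    (hA : A ⊂ S) (hne : A.Nonempty) {K : Finset α} (hK : K ⊆ S \ A)
    (hadj : ∀ v ∈ S \ A, N.degTo v A ≠ 0 →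
      N.degTo v A = 1 ∧ (i + 1 : ℤ) ≤ richPotential i τ (x v false) (x v true))
    (hcol : N.Colorable A fun u b => x u b - N.degTo u K)
    (hT : ∀ T ⊆ S \ A, T ≠ S \ A → N.cross T A ≠ 0 → (i + 1) * N.cross T A ≤ N.richRho i τ x T)
    (hB : N.cross (S \ A) A ≠ 0 →
      0 ≤ N.richRho i τ x (S \ A) - (i + 1) * N.cross (S \ A) A + i * N.cross K A ∨
      ((∀ v ∈ S \ A, N.degTo v A ≠ 0 → v ∈ K) ∧
        -τ ≤ N.richRho i τ x (S \ A) - (i + 1) * N.cross (S \ A) A + i * N.cross K A ∧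
        ((∃ v ∈ S, x v true = 0) →
          0 ≤ N.richRho i τ x (S \ A) - (i + 1) * N.cross (S \ A) A + i * N.cross K A))) :
    N.Colorable S x := by
  obtain ⟨hBS, hdisj, hunion, -⟩ := union_sdiff_ssubset (T := ∅) hA hne
  obtain ⟨φ, hφ⟩ := hcol
  set p : α → α → ℕ := fun v u => if v ∈ K then N.mult v u else 0 with hp
  set x' := N.residual x A φ p with hx'
  have hres1 : ∀ v ∈ K, ∀ b, x' v b = x v b - N.confTo v b A φ := by
    intro v hv b
    rw [hx', residual, if_pos]
    intro u hu
    have := N.conf_le' v u (φ u)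
    simp only [p, if_pos hv]
    cases b <;> omega
  have hres0 : ∀ v, N.degTo v A = 0 → ∀ b, x' v b = x v b := by
    intro v hv b
    have h0 : N.confTo v b A φ = 0 := by
      have := N.confTo_le v b A φ
      omega
    rw [hx', residual, if_pos, h0, Nat.sub_zero]
    intro u hu
    have := (sum_eq_zero_iff.1 h0) u hu
    omega
  have hres2 : ∀ v, v ∉ K → ∀ b, x' v b = if N.confTo v b A φ = 0 then x v b else 0 := by
    intro v hv b
    have : (∀ u ∈ A, N.conf v b u (φ u) ≤ p v u) ↔ N.confTo v b A φ = 0 := by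
      simp [p, hv, confTo, sum_eq_zero_iff]
    simp only [hx', residual, this]
    split_ifs with h1
    · rw [h1, Nat.sub_zero]
    · rfl
  rw [← hunion]
  refine Colorable.of_residual N hdisj (φ := φ) (p := p) (fun u hu => ?_) ?_
  · have h1 : ∑ v ∈ S \ A, p v u = N.degTo u K := by
      simp only [p, degTo, ← sum_filter]
      rw [filter_mem_eq_inter, inter_eq_right.2 hK]
      exact sum_congr rfl fun v _ => N.mult_symm v u
    have h2 : _ < x u (φ u) - N.degTo u K := hφ u hu
    omega
  refine ih _ hBS _ (fun v hv => (N.residual_le ..).trans (hx v (hBS.subset hv)))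
    fun T hTB hTne => ?_
  have hvx : ∀ v ∈ S \ A, N.degTo v A ≠ 0 →
      1 ≤ x v false ∧ x v false ≤ i + 1 ∧ τ + i + 2 ≤ x v true := by
    intro v hv hd
    have h1 := (hadj v hv hd).2
    have h2 := hx v (hBS.subset hv)
    unfold richPotential at h1
    split_ifs at h1 <;> omega
  -- A neighbor of `A` has one edge to `A`. The conflict costs at most `1` if permitted and at most
  -- `i + 1` if forbidden, so permitting it saves `i`.
  have hdrop := N.potential_drop (T := T)
    (w := fun v => richPotential i τ (x v false) (x v true))
    (w' := fun v => richPotential i τ (x' v false) (x' v true)) (i + 1)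
    (c := fun v => (i + 1) * N.degTo v A - if v ∈ K then i * (N.degTo v A : ℤ) else 0)
    fun v hvT => by
      by_cases hd : N.degTo v A = 0
      · simp [hres0 v hd, hd]
      obtain ⟨h1, h2, h3⟩ := hvx v (hTB hvT) hd
      have hd1 := (hadj v (hTB hvT) hd).1
      have h4 := N.confTo_add_le v A φ
      rw [hd1] at h4 ⊢
      by_cases hvK : v ∈ K
      · simp only [hres1 v hvK, if_pos hvK, richPotential]
        split_ifs <;> omega
      · simp only [hres2 v hvK, if_neg hvK, richPotential]
        split_ifs <;> omega
  have hsum : ∑ v ∈ T, ((i + 1) * (N.degTo v A : ℤ) - if v ∈ K then i * (N.degTo v A : ℤ) else 0) =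
      (i + 1) * N.cross T A - i * N.cross (T ∩ K) A := by
    rw [sum_sub_distrib, ← mul_sum, ← sum_filter, filter_mem_eq_inter, ← mul_sum, cross, cross]
    push_cast
    rfl
  rw [hsum] at hdrop
  change N.richRho i τ x T - _ ≤ N.richRho i τ x' T at hdrop
  have hnn : (0 : ℤ) ≤ i * N.cross (T ∩ K) A := by positivity
  by_cases hc : N.cross T A = 0
  · have hd0 : ∀ v ∈ T, N.degTo v A = 0 := sum_eq_zero_iff.1 hc
    have h1 := hS T (hTB.trans sdiff_subset) hTne
    rw [hc] at hdrop
    simp only [Nat.cast_zero, mul_zero] at hdrop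
    refine ⟨by linarith, fun ⟨v, hvT, hv0⟩ => ?_⟩
    rw [← hx', hres0 v (hd0 v hvT)] at hv0
    linarith [h1.2 ⟨v, hvT, hv0⟩]
  · by_cases hTeq : T = S \ A
    · subst hTeq
      rw [inter_eq_right.2 hK] at hdrop
      -- If all neighbors of `A` lie in `K`, no rich color is lost. Then the stronger bound is
      -- needed only if `S` already has a vertex that must be poor.
      rcases hB hc with h1 | ⟨h1, h2, h3⟩
      · exact ⟨by linarith, fun _ => by linarith⟩
      · refine ⟨by linarith, fun ⟨v, hvT, hv0⟩ => ?_⟩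
        suffices ∃ v ∈ S, x v true = 0 by linarith [h3 this]
        refine ⟨v, hBS.subset hvT, ?_⟩
        by_cases hd : N.degTo v A = 0
        · rwa [← hx', hres0 v hd] at hv0
        · have h4 := hvx v hvT hd
          have h5 := N.confTo_le v true A φ
          rw [(hadj v hvT hd).1] at h5
          rw [← hx', hres1 v (h1 v hvT hd)] at hv0
          omega
    · have := hT T hTB hTeq hc
      exact ⟨by linarith, fun _ => by linarith⟩

/-- Extension of a coloring to a single vertex if all conflicts are permitted. -/
lemma colorable_of_color_last {v : α} (hv : v ∈ S) (b : Bool)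
    (hb : N.degTo v (S.erase v) < x v b)
    (hcol : N.Colorable (S.erase v) fun u c => x u c - N.mult u v) : N.Colorable S x := by
  obtain ⟨φ, hφ⟩ := hcol
  have hunion : S.erase v ∪ {v} = S := by rw [union_comm, ← insert_eq, insert_erase hv]
  rw [← hunion]
  refine Colorable.glue N (by simp) (φ := φ) (ψ := fun _ => b) (fun u hu => ?_) fun u hu => ?_
  · have h1 : _ < x u (φ u) - N.mult u v := hφ u hu
    have h2 := N.confTo_le u (φ u) {v} (fun _ => b)
    simp only [degTo, sum_singleton] at h2
    omega
  · rw [mem_singleton] at hu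
    subst hu
    have := N.confTo_le u b (S.erase u) φ
    have h2 : N.confTo u b {u} (fun _ => b) = 0 := by simp [confTo, N.conf_self]
    omega

/-- Extension of a coloring to a vertex of degree two if one conflict is permitted. -/
lemma colorable_of_degree_two {v u₀ : α} (hv : v ∈ S) (hu₀ : u₀ ∈ S.erase v)
    (hm : 1 ≤ N.mult v u₀) (hd : N.degTo v (S.erase v) = 2) (hb : ∀ b, 2 ≤ x v b)
    (hcol : N.Colorable (S.erase v) fun u c => x u c - if u = u₀ then 1 else 0) :
    N.Colorable S x := by
  obtain ⟨φ, hφ⟩ := hcol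
  have hunion : S.erase v ∪ {v} = S := by rw [union_comm, ← insert_eq, insert_erase hv]
  have hA : insert u₀ ((S.erase v).erase u₀) = S.erase v := insert_erase hu₀
  have hconf : ∀ b, N.confTo v b (S.erase v) φ =
      N.conf v b u₀ (φ u₀) + N.confTo v b ((S.erase v).erase u₀) φ := fun b => by
    conv_lhs => rw [← hA]
    exact sum_insert (notMem_erase _ _)
  obtain ⟨b, hb0, hb1⟩ : ∃ b, N.confTo v b ((S.erase v).erase u₀) φ = 0 ∧
      N.conf v b u₀ (φ u₀) ≤ 1 := by
    have h1 : N.mult v u₀ + N.degTo v ((S.erase v).erase u₀) = 2 := by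
      rw [← hd]
      conv_rhs => rw [← hA]
      exact (sum_insert (notMem_erase _ _)).symm
    have h2 := N.confTo_add_le v ((S.erase v).erase u₀) φ
    have h3 := N.conf_le' v u₀ (φ u₀)
    by_cases h4 : N.confTo v false ((S.erase v).erase u₀) φ = 0 ∧ N.conf v false u₀ (φ u₀) ≤ 1
    · exact ⟨_, h4⟩
    · exact ⟨true, by omega⟩
  rw [← hunion]
  refine Colorable.glue N (by simp) (φ := φ) (ψ := fun _ => b) (fun u hu => ?_) fun u hu => ?_
  · have h1 : _ < x u (φ u) - (if u = u₀ then 1 else 0) := hφ u hu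
    have h2 : N.confTo u (φ u) {v} (fun _ => b) = N.conf v b u (φ u) := by
      simp [confTo, N.conf_symm u]
    rw [h2]
    by_cases huu : u = u₀
    · subst huu
      rw [if_pos rfl] at h1
      omega
    · have := (sum_eq_zero_iff.1 hb0) u (mem_erase.2 ⟨huu, hu⟩)
      omega
  · rw [mem_singleton] at hu
    subst hu
    have h2 : N.confTo u b {u} (fun _ => b) = 0 := by simp [confTo, N.conf_self]
    have := hb b
    have := hconf b
    omega

lemma degTo_erase_self (v : α) (hv : v ∈ S) : N.degTo v (S.erase v) = N.degTo v S := by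
  have := sum_erase_add S (fun u => N.mult v u) hv
  rw [N.mult_self, add_zero] at this
  exact this

/-- In a minimal counterexample, all proper subsets have large potential. -/
lemma lt_richRho_of_not_colorable (hi : 1 ≤ i) (hx : ∀ v ∈ S, x v false ≤ i + 1)
    (hS : N.HasRichPotential i τ 0 x S) (ih : N.SmallerRichColorable i τ S)
    (hcol : ¬ N.Colorable S x) (hcard : 2 ≤ S.card) :
    ∀ T ⊂ S, T.Nonempty → (i : ℤ) < N.richRho i τ x T := by
  obtain ⟨A, hA, hne, hmin⟩ := N.exists_min_potential (i + 1)
    (fun v => richPotential i τ (x v false) (x v true)) hcard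
  refine fun T hT hTne => lt_of_lt_of_le ?_ (hmin T hT hTne)
  clear T hT hTne
  change ∀ T ⊂ S, T.Nonempty → N.richRho i τ x A ≤ N.richRho i τ x T at hmin
  change (i : ℤ) < N.richRho i τ x A
  by_contra! hp
  refine hcol ?_
  obtain ⟨hB, hdisj, hunion, -⟩ := union_sdiff_ssubset (T := ∅) hA hne
  have hi' : (1 : ℤ) ≤ i := by exact_mod_cast hi
  have hmin' : ∀ T ⊆ S \ A, N.richRho i τ x A ≤ N.richRho i τ x (A ∪ T) →
      (i + 1) * N.cross T A ≤ N.richRho i τ x T := fun T hT hle => by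
    rw [richRho_union ((union_sdiff_ssubset (T := T) hA hne).2.2.2 hT)] at hle
    linarith
  have hdeg : ∀ v ∈ S \ A, N.richRho i τ x A ≤ N.richRho i τ x (A ∪ {v}) → N.degTo v A ≠ 0 →
      N.degTo v A = 1 ∧ (i + 1 : ℤ) ≤ richPotential i τ (x v false) (x v true) := by
    intro v hv hle hd
    have h1 := hmin' {v} (singleton_subset_iff.2 hv) hle
    rw [richRho_singleton, N.cross_singleton] at h1
    have h2 := richPotential_le (τ := τ) (y := x v true) (hx v (hB.subset hv))
    have h3 : (1 : ℤ) ≤ N.degTo v A := by exact_mod_cast Nat.one_le_iff_ne_zero.2 hd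
    have h4 : (N.degTo v A : ℤ) < 2 := by
      by_contra! h4
      nlinarith
    exact ⟨by omega, by nlinarith⟩
  have hSun : N.richRho i τ x S =
      N.richRho i τ x A + N.richRho i τ x (S \ A) - (i + 1) * N.cross (S \ A) A := by
    rw [← richRho_union hdisj, hunion]
  -- If `S` itself has at least the potential of `A`, minimality also covers the whole complement
  -- and all conflicts can be forbidden.
  by_cases hSp : N.richRho i τ x A ≤ N.richRho i τ x S
  · have hall : ∀ T ⊆ S \ A, N.richRho i τ x A ≤ N.richRho i τ x (A ∪ T) := by
      intro T hT
      by_cases hs : A ∪ T ⊂ S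
      · exact hmin _ hs (hne.mono subset_union_left)
      · rw [sdiff_eq_of_union hT hs hA.subset, hunion]
        exact hSp
    refine colorable_of_permitted_set hx hS ih hA hne (K := ∅) (empty_subset _)
      (fun v hv => hdeg v hv (hall _ (singleton_subset_iff.2 hv))) ?_
      (fun T hT _ _ => hmin' T hT (hall T hT)) fun _ => Or.inl ?_
    · simpa [degTo] using ih A hA x (fun v hv => hx v (hA.subset hv))
        fun T hT => hS T (hT.trans hA.subset)
    · simp only [cross, sum_empty, Nat.cast_zero, mul_zero, add_zero]
      have := hmin' _ Subset.rfl (hall _ Subset.rfl)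
      unfold cross at this
      linarith
  push Not at hSp
  have hSne := hne.mono hA.subset
  -- `k₀` is the excess of `A` over the bound that applies to `S`; so many conflicts in total can be
  -- reserved on `A`.
  obtain ⟨k₀, hk₀, hkS, hkA⟩ : ∃ k₀ : ℕ, 1 ≤ k₀ ∧
      N.richRho i τ x A - k₀ ≤ N.richRho i τ x S ∧
      ((k₀ : ℤ) = N.richRho i τ x A + τ ∧ (¬ ∃ v ∈ S, x v true = 0) ∨
      (k₀ : ℤ) = N.richRho i τ x A ∧ ∃ v ∈ S, x v true = 0) := by
    have h1 := hS S Subset.rfl hSne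
    by_cases hM : ∃ v ∈ S, x v true = 0
    · have h2 := h1.2 hM
      obtain ⟨k, hk⟩ := Int.eq_ofNat_of_zero_le (h2.trans hSp.le)
      exact ⟨k, by omega, by omega, Or.inr ⟨hk.symm, hM⟩⟩
    · have h2 := h1.1
      obtain ⟨k, hk⟩ := Int.eq_ofNat_of_zero_le (by linarith : 0 ≤ N.richRho i τ x A + τ)
      exact ⟨k, by omega, by omega, Or.inl ⟨hk.symm, hM⟩⟩
  have hred : ∀ r : α → ℕ, ∑ v ∈ A, r v ≤ k₀ → N.Colorable A fun v b => x v b - r v := by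
    intro r hr
    refine ih A hA _ (fun v hv => (Nat.sub_le _ _).trans (hx v (hA.subset hv))) ?_
    refine HasRichPotential.sub (k := k₀) (fun T hT hTne => ?_) hr
    have h1 := hmin T (hT.trans_ssubset hA) hTne
    rcases hkA with ⟨h2, h3⟩ | ⟨h2, h3⟩
    · exact ⟨by linarith, fun ⟨v, hv, hv0⟩ => absurd ⟨v, hA.subset (hT hv), hv0⟩ h3⟩
    · exact ⟨by linarith [(Nat.cast_nonneg τ : (0 : ℤ) ≤ τ)], fun _ => by linarith⟩
  -- For a single remaining vertex, adding it to `A` gives all of `S`, so minimality does not bound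
  -- its degree to `A`.
  by_cases hB1 : (S \ A).card = 1
  · obtain ⟨v, hv⟩ := card_eq_one.1 hB1
    have hvB : v ∈ S \ A := by simp [hv]
    have hvS : v ∈ S := hB.subset hvB
    have hAv : A = S.erase v := by
      rw [← sdiff_singleton_eq_erase, ← hv, Finset.sdiff_sdiff_eq_self hA.subset]
    rw [hv, richRho_singleton, N.cross_singleton] at hSun
    have hf := richPotential_le (τ := τ) (y := x v true) (hx v hvS)
    have hxv := hx v hvS
    by_cases hk : N.degTo v A ≤ k₀
    · obtain ⟨b, hb⟩ : ∃ b, N.degTo v A < x v b := by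
        rcases Nat.eq_zero_or_pos (N.degTo v A) with h0 | hpos
        · have h1 := hS {v} (singleton_subset_iff.2 hvS) (singleton_nonempty v)
          rw [richRho_singleton] at h1
          by_cases hv0 : x v true = 0
          · refine ⟨false, ?_⟩
            have h2 := h1.2 ⟨v, by simp, hv0⟩
            rw [richPotential, if_pos hv0] at h2
            omega
          · exact ⟨true, by omega⟩
        have he1 : (1 : ℤ) ≤ N.degTo v A := by exact_mod_cast hpos
        have he2 : (i : ℤ) ≤ i * N.degTo v A := by nlinarith
        by_cases hv0 : x v true = 0
        · refine ⟨false, ?_⟩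
          have hM : ∃ v ∈ S, x v true = 0 := ⟨v, hvS, hv0⟩
          have h2 := (hS S Subset.rfl hSne).2 hM
          rw [hSun, richPotential, if_pos hv0] at h2
          have : (N.degTo v A : ℤ) < x v false := by linarith
          exact_mod_cast this
        · refine ⟨true, ?_⟩
          have h2 := (hS S Subset.rfl hSne).1
          rw [hSun, richPotential, if_neg hv0] at h2
          have h3 : min ((i : ℤ) + x v false) (x v true - 1 - τ) ≤ x v true - 1 - τ :=
            min_le_right _ _
          have : (N.degTo v A : ℤ) < x v true := by linarith
          exact_mod_cast this
      rw [hAv] at hb hk hred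
      refine colorable_of_color_last hvS b hb (hred _ ?_)
      refine le_trans (le_of_eq ?_) hk
      exact sum_congr rfl fun u _ => N.mult_symm u v
    · push Not at hk
      have hk1 : (1 : ℤ) ≤ k₀ := by exact_mod_cast hk₀
      have hk2 : (k₀ : ℤ) + 1 ≤ N.degTo v A := by exact_mod_cast hk
      -- The bound `(i + 1) * deg ≤ 2 * i + 1 + k₀` with `deg > k₀` leaves only `k₀ = 1` and degree
      -- two, at weight `2 * i + 1`.
      have hk3 : k₀ = 1 := by
        by_contra hk3
        have : (2 : ℤ) ≤ k₀ := by exact_mod_cast (by omega : 2 ≤ k₀)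
        nlinarith
      have hd2 : N.degTo v A = 2 := by
        by_contra hd2
        have : (3 : ℤ) ≤ N.degTo v A := by exact_mod_cast (by omega : 3 ≤ N.degTo v A)
        nlinarith
      rw [hk3] at hkS hred
      rw [hd2] at hSun
      have hfull : (2 * i + 1 : ℤ) ≤ richPotential i τ (x v false) (x v true) := by
        push_cast at hkS hSun
        linarith
      have hb : ∀ b, 2 ≤ x v b := by
        unfold richPotential at hfull
        split_ifs at hfull
        · omega
        · intro b; cases b <;> omega
      obtain ⟨w, hw, u₀, hu₀, hm⟩ := exists_mult_pos (N := N) (B := {v}) (A := A)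
        (by rw [N.cross_singleton]; omega)
      rw [mem_singleton] at hw
      subst hw
      rw [hAv] at hu₀ hd2 hred
      refine colorable_of_degree_two hvS hu₀ hm hd2 hb (hred _ ?_)
      rw [sum_ite_eq' _ u₀, if_pos hu₀]
  · have hss : ∀ T ⊆ S \ A, T ≠ S \ A → A ∪ T ⊂ S := fun T hT hTne => by
      by_contra hs
      exact hTne (sdiff_eq_of_union hT hs hA.subset)
    have hle : ∀ T ⊆ S \ A, T ≠ S \ A → N.richRho i τ x A ≤ N.richRho i τ x (A ∪ T) :=
      fun T hT hTne => hmin _ (hss T hT hTne) (hne.mono subset_union_left)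
    have hadj : ∀ v ∈ S \ A, N.degTo v A ≠ 0 →
        N.degTo v A = 1 ∧ (i + 1 : ℤ) ≤ richPotential i τ (x v false) (x v true) := fun v hv =>
      hdeg v hv (hle _ (singleton_subset_iff.2 hv) fun h => hB1 (by rw [← h, card_singleton]))
    set C := (S \ A).filter fun v => N.degTo v A ≠ 0 with hC
    have hcrossK : ∀ K ⊆ C, N.cross K A = K.card := fun K hK => by
      rw [card_eq_sum_ones, cross]
      refine sum_congr rfl fun v hv => ?_
      have := mem_filter.1 (hK hv)
      exact (hadj v this.1 this.2).1
    have hcrossB : N.cross (S \ A) A = C.card := by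
      rw [← hcrossK C Subset.rfl, cross, cross, hC, sum_filter_ne_zero]
    -- Permit conflicts with as many neighbors of `A` as the reserve `k₀` allows.
    obtain ⟨K, hKC, hKcard⟩ := exists_subset_card_eq (min_le_left C.card k₀)
    have hKB : K ⊆ S \ A := hKC.trans (filter_subset _ _)
    refine colorable_of_permitted_set hx hS ih hA hne hKB hadj (hred _ ?_)
      (fun T hT hTne _ => hmin' T hT (hle T hT hTne)) fun hc => ?_
    · change N.cross A K ≤ k₀
      rw [N.cross_comm, hcrossK K hKC, hKcard]
      exact min_le_right _ _
    · have hrw : N.richRho i τ x (S \ A) - (i + 1) * N.cross (S \ A) A =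
          N.richRho i τ x S - N.richRho i τ x A := by linarith
      rw [hrw, hcrossK K hKC, hKcard]
      have hS1 := hS S Subset.rfl hSne
      rcases le_total C.card k₀ with hle | hle
      · right
        rw [min_eq_left hle]
        have hKeq : K = C := eq_of_subset_of_card_le hKC (by omega)
        have hC1 : (1 : ℤ) ≤ C.card := by
          exact_mod_cast Nat.one_le_iff_ne_zero.2 (hcrossB ▸ hc)
        refine ⟨fun v hv hd => hKeq ▸ mem_filter.2 ⟨hv, hd⟩, by nlinarith, fun hM => ?_⟩
        have := hS1.2 hM
        nlinarith
      · left
        rw [min_eq_right hle]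
        have hk1 : (1 : ℤ) ≤ k₀ := by exact_mod_cast hk₀
        nlinarith

/-- In a minimal counterexample every vertex has degree at least `τ + i + 2`, since otherwise it
could be colored rich last. Thus each vertex contributes at most `0` to twice the potential. Some
vertex has degree at least its rich capacity, since otherwise all could be rich; it contributes at
most `-2 - 2 * τ`, which contradicts the bound `-τ` for `S`. -/
theorem colorable_of_hasRichPotential (hi : 1 ≤ i) (S : Finset α) : ∀ x : α → Bool → ℕ,
    (∀ v ∈ S, x v false ≤ i + 1) → N.HasRichPotential i τ 0 x S → N.Colorable S x := by
  induction S using Finset.strongInduction with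
  | H S ih =>
  intro x hx hS
  rcases Nat.lt_or_ge S.card 2 with hcard | hcard
  · rcases S.eq_empty_or_nonempty with rfl | hne
    · exact ⟨fun _ => false, by simp [IsColoring]⟩
    obtain ⟨v, rfl⟩ := card_eq_one.1 (by have := hne.card_pos; omega : S.card = 1)
    obtain ⟨b, hb⟩ : ∃ b, x v b ≠ 0 := by
      by_contra! hb
      have h1 := (hS _ Subset.rfl hne).2 ⟨v, by simp, hb true⟩
      rw [richRho_singleton, hb, hb] at h1
      simp [richPotential] at h1
    refine ⟨fun _ => b, fun u hu => ?_⟩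
    rw [mem_singleton] at hu
    subst hu
    simp only [confTo, sum_singleton, N.conf_self]
    omega
  by_contra hcol
  have hlow := lt_richRho_of_not_colorable hi hx hS ih hcol hcard
  have hne : S.Nonempty := card_pos.1 (by omega)
  have hi' : (1 : ℤ) ≤ i := by exact_mod_cast hi
  have hvx : ∀ v ∈ S, τ + i + 2 ≤ x v true ∧
      richPotential i τ (x v false) (x v true) ≤ x v true - 1 - τ := by
    intro v hv
    have hss : {v} ⊂ S := (singleton_subset_iff.2 hv).ssubset_of_ne fun h => by
      rw [← h, card_singleton] at hcard
      omega
    have h1 := hlow {v} hss (singleton_nonempty v)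
    rw [richRho_singleton] at h1
    have := hx v hv
    unfold richPotential at *
    split_ifs at * <;> omega
  have hdeg : ∀ v ∈ S, τ + i + 2 ≤ N.degTo v S := by
    intro v hv
    by_contra! hd
    have hss := erase_ssubset hv
    refine hcol (colorable_of_color_last hv true
      (by rw [degTo_erase_self v hv]; linarith [(hvx v hv).1]) ?_)
    refine ih _ hss _ (fun u hu => (Nat.sub_le _ _).trans (hx u (hss.subset hu))) ?_
    refine HasRichPotential.sub (k := N.degTo v S) (fun T hT hTne => ?_) ?_
    · have h1 := hlow T (hT.trans_ssubset hss) hTne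
      refine ⟨by omega, fun ⟨u, hu, hu0⟩ => ?_⟩
      have := (hvx u (hss.subset (hT hu))).1
      omega
    · rw [← degTo_erase_self v hv]
      exact le_of_eq (sum_congr rfl fun u _ => N.mult_symm u v)
  obtain ⟨v₀, hv₀, hd₀⟩ : ∃ v ∈ S, x v true ≤ N.degTo v S := by
    by_contra! h
    exact hcol ⟨fun _ => true, fun v hv => (N.confTo_le v true S _).trans_lt (h v hv)⟩
  have h2 := N.two_mul_potential (i + 1) (fun v => richPotential i τ (x v false) (x v true)) S
  rw [← add_sum_erase S _ hv₀] at h2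
  have h3 : ∑ v ∈ S.erase v₀, (2 * richPotential i τ (x v false) (x v true) -
      (i + 1) * (N.degTo v S : ℤ)) ≤ 0 := by
    refine sum_nonpos fun v hv => ?_
    have hvS := mem_of_mem_erase hv
    have h4 := richPotential_le (τ := τ) (y := x v true) (hx v hvS)
    have h5 : (i + 2 : ℤ) ≤ N.degTo v S := by exact_mod_cast (by have := hdeg v hvS; omega)
    nlinarith
  have h4 : 2 * richPotential i τ (x v₀ false) (x v₀ true) - (i + 1) * (N.degTo v₀ S : ℤ) ≤
      -2 - 2 * τ := by
    have h5 := (hvx v₀ hv₀).2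
    have h6 : (x v₀ true : ℤ) ≤ N.degTo v₀ S := by exact_mod_cast hd₀
    nlinarith
  have h5 := (hS S Subset.rfl hne).1
  unfold richRho at h5
  linarith

end ConflictNetwork

end DefectiveDP

/-! ### Colorability for `i = 0`: monochromatic components of poor-rich conflicts. -/

namespace DefectiveDP

namespace ConflictNetwork

open Finset

variable {α : Type*} [DecidableEq α] (N : ConflictNetwork α) {S A K : Finset α}

/-- The indicator of the pairs for which a poor and a rich vertex are in conflict. -/
def mixed (u v : α) : ℕ := if N.conf u false v true = 0 ∧ N.conf u true v false = 0 then 0 else 1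

/-- `K` is a connected component of the graph of the mixed pairs in `S`. -/
structure IsMixedComponent (S K : Finset α) : Prop where
  subset : K ⊆ S
  nonempty : K.Nonempty
  two_mul_card_le : 2 * K.card ≤ ∑ u ∈ K, ∑ v ∈ K, N.mixed u v + 2
  closed : ∀ u ∈ K, ∀ v ∈ S, v ∉ K → N.mixed u v = 0

variable {N}

omit [DecidableEq α] in
lemma mixed_symm (u v : α) : N.mixed u v = N.mixed v u := by
  refine if_congr ?_ rfl rfl
  rw [N.conf_symm u false, N.conf_symm u true]
  exact and_comm

omit [DecidableEq α] in
lemma conf_eq_zero_of_mixed {u v : α} (h : N.mixed u v = 0) (b : Bool) : N.conf u b v (!b) = 0 := by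
  unfold mixed at h
  split_ifs at h with h1
  cases b
  · exact h1.1
  · exact h1.2

omit [DecidableEq α] in
lemma conf_add_mixed_le (u v : α) (b : Bool) : N.conf u b v b + N.mixed u v ≤ N.mult u v := by
  have h1 := N.conf_le u b v
  have h2 := N.conf_le' u v b
  have h3 : N.mixed u v ≤ N.conf u false v true + N.conf u true v false := by
    unfold mixed
    split_ifs <;> omega
  have h4 : N.mixed u v ≤ 1 := by
    unfold mixed
    split_ifs <;> omega
  cases b <;> omega

/-- Of connectedness only the edge count of a spanning tree is recorded. Adding a vertex with a
mixed pair to `K` preserves it, so a largest such set is closed. -/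
lemma exists_isMixedComponent {v : α} (hv : v ∈ S) : ∃ K, N.IsMixedComponent S K ∧ v ∈ K := by
  have hne : (S.powerset.filter fun K =>
      v ∈ K ∧ 2 * K.card ≤ ∑ u ∈ K, ∑ w ∈ K, N.mixed u w + 2).Nonempty :=
    ⟨{v}, by simp [hv]⟩
  obtain ⟨K, hK, hmax⟩ := exists_max_image _ card hne
  simp only [mem_filter, mem_powerset] at hK hmax
  refine ⟨K, ⟨hK.1, ⟨v, hK.2.1⟩, hK.2.2, fun u hu w hw hwK => ?_⟩, hK.2.1⟩
  by_contra h0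
  have h := hmax (insert w K) ⟨insert_subset hw hK.1, mem_insert_of_mem hK.2.1, ?_⟩
  · rw [card_insert_of_notMem hwK] at h
    omega
  have h1 : 1 ≤ ∑ z ∈ K, N.mixed w z := by
    rw [mixed_symm] at h0
    exact (Nat.one_le_iff_ne_zero.2 h0).trans
      (single_le_sum (f := fun z => N.mixed w z) (fun _ _ => Nat.zero_le _) hu)
  have h2 : ∑ z ∈ K, N.mixed z w = ∑ z ∈ K, N.mixed w z := sum_congr rfl fun z _ => mixed_symm z w
  rw [card_insert_of_notMem hwK, sum_insert hwK]
  simp only [sum_insert hwK, sum_add_distrib, h2]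
  have := hK.2.2
  omega

/-- At least `K.card - 1` edges are taken by mixed pairs; only the others can produce conflicts when
all of `K` has color `b`. -/
lemma IsMixedComponent.card_add_le (h : N.IsMixedComponent S K) {v : α} (hv : v ∈ K) (b : Bool) :
    K.card + ∑ u ∈ K, N.conf v b u b ≤ N.edges K + 1 := by
  have h1 := N.two_mul_edges K
  have h2 : ∑ u ∈ K, ∑ w ∈ K, (N.conf u b w b + N.mixed u w) ≤ 2 * N.edges K := by
    rw [h1]
    exact sum_le_sum fun u _ => sum_le_sum fun w _ => conf_add_mixed_le u w b
  simp only [sum_add_distrib] at h2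
  have h3 := h.two_mul_card_le
  have h4 : 2 * ∑ u ∈ K, N.conf v b u b ≤ ∑ u ∈ K, ∑ w ∈ K, N.conf u b w b := by
    rw [← add_sum_erase K (fun u => ∑ w ∈ K, N.conf u b w b) hv, two_mul]
    refine Nat.add_le_add_left ?_ _
    rw [← add_sum_erase K (fun u => N.conf v b u b) hv, N.conf_self, zero_add]
    refine sum_le_sum fun u _ => ?_
    rw [N.conf_symm v]
    exact single_le_sum (f := fun w => N.conf u b w b) (fun _ _ => Nat.zero_le _) hv
  omega

lemma IsMixedComponent.card_le (h : N.IsMixedComponent S K) : K.card ≤ N.edges K + 1 := by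
  obtain ⟨v, hv⟩ := h.nonempty
  have := h.card_add_le hv true
  omega

/-- A poor-poor conflict needs an edge beyond those of a spanning tree. -/
lemma IsMixedComponent.card_le_of_conf (h : N.IsMixedComponent S K) {u v : α} (hu : u ∈ K)
    (hv : v ∈ K) (h0 : N.conf u false v false ≠ 0) : K.card ≤ N.edges K := by
  have h1 := h.card_add_le hu false
  have h2 := single_le_sum (f := fun v => N.conf u false v false) (fun _ _ => Nat.zero_le _) hv
  have h3 : N.conf u false v false ≤ ∑ u_1 ∈ K, N.conf u false u_1 false := h2
  omega

/-- A coloring of a union of components of the graph of the mixed pairs, without conflicts at the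
poor vertices, and with few conflicts at the rich vertices. -/
structure IsFrugal (N : ConflictNetwork α) (S A : Finset α) (φ : α → Bool) : Prop where
  subset : A ⊆ S
  nonempty : A.Nonempty
  closed : ∀ u ∈ A, ∀ v ∈ S, v ∉ A → N.mixed u v = 0
  poor : ∀ v ∈ A, φ v = false → N.confTo v false A φ = 0
  rich : ∀ v ∈ A, φ v = true → A.card + N.confTo v true A φ ≤ N.edges A + 1
  card_le : A.card ≤ N.edges A + 1
  card_le_or : A.card ≤ N.edges A ∨
    ∀ K, N.IsMixedComponent S K → ∀ u ∈ K, ∀ v ∈ K, N.conf u false v false = 0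

/-- A component with a poor-poor conflict is preferred as the start: its surplus edge allows other
such components to be attached later. -/
lemma exists_isFrugal (hS : S.Nonempty) : ∃ A φ, N.IsFrugal S A φ := by
  have key : ∀ K, N.IsMixedComponent S K → (K.card ≤ N.edges K ∨
      ∀ K, N.IsMixedComponent S K → ∀ u ∈ K, ∀ v ∈ K, N.conf u false v false = 0) →
      N.IsFrugal S K fun _ => true := fun K hK h =>
    ⟨hK.subset, hK.nonempty, hK.closed, by simp, fun v hv _ => hK.card_add_le hv true,
      hK.card_le, h⟩
  by_cases h : ∀ K, N.IsMixedComponent S K → ∀ u ∈ K, ∀ v ∈ K, N.conf u false v false = 0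
  · obtain ⟨v, hv⟩ := hS
    obtain ⟨K, hK, -⟩ := exists_isMixedComponent (N := N) hv
    exact ⟨K, _, key K hK (Or.inr h)⟩
  · push Not at h
    obtain ⟨K, hK, u, hu, v, hv, h0⟩ := h
    exact ⟨K, _, key K hK (Or.inl (hK.card_le_of_conf hu hv h0))⟩

/-- If a poor vertex of `A` has a poor-poor conflict with `K`, color `K` rich; the edge at that
vertex then produces no conflict. If `K` has a poor-poor conflict inside, color `K` rich; the
surplus edges of `A` and `K` pay for the crossing edges. Otherwise `K` can be poor without any
conflict. -/
lemma IsFrugal.extend {φ : α → Bool} (h : N.IsFrugal S A φ) (hK : N.IsMixedComponent S K)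
    (hdisj : Disjoint A K) (hc : 1 ≤ N.cross K A) : ∃ ψ, N.IsFrugal S (A ∪ K) ψ := by
  have hcard := card_union_of_disjoint hdisj
  have hedges := N.edges_union hdisj
  have hKA : ∀ v ∈ K, v ∉ A := fun v hv hA => (disjoint_left.1 hdisj) hA hv
  have hmix : ∀ u ∈ A, ∀ v ∈ K, N.mixed u v = 0 := fun u hu v hv =>
    h.closed u hu v (hK.subset hv) (hKA v hv)
  have hmix' : ∀ v ∈ K, ∀ u ∈ A, N.mixed v u = 0 := fun v hv u hu => by
    rw [mixed_symm]
    exact hmix u hu v hv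
  have hclosed : ∀ u ∈ A ∪ K, ∀ v ∈ S, v ∉ A ∪ K → N.mixed u v = 0 := by
    intro u hu v hv hvn
    rw [mem_union, not_or] at hvn
    rcases mem_union.1 hu with hu | hu
    · exact h.closed u hu v hv hvn.1
    · exact hK.closed u hu v hv hvn.2
  have hKle := hK.card_le
  have hAle := h.card_le
  have hor : (A ∪ K).card ≤ N.edges (A ∪ K) ∨
      ∀ K, N.IsMixedComponent S K → ∀ u ∈ K, ∀ v ∈ K, N.conf u false v false = 0 := by
    refine h.card_le_or.imp_left fun _ => ?_
    omega
  have hcross : ∀ v ∈ A, N.degTo v K ≤ N.cross K A := fun v hv => by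
    rw [N.cross_comm]
    exact N.degTo_le_cross hv K
  set ψ : Bool → α → Bool := fun c v => if v ∈ A then φ v else c with hψ
  have hψA : ∀ c, ∀ v ∈ A, ψ c v = φ v := fun c v hv => if_pos hv
  have hψK : ∀ c, ∀ v ∈ K, ψ c v = c := fun c v hv => if_neg (hKA v hv)
  have hconf : ∀ c v b, N.confTo v b (A ∪ K) (ψ c) =
      N.confTo v b A φ + ∑ u ∈ K, N.conf v b u c := by
    intro c v b
    rw [N.confTo_union hdisj, N.confTo_congr (hψA c)]
    congr 1
    exact sum_congr rfl fun u hu => by rw [hψK c u hu]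
  have hzero : ∀ v ∈ A, ∀ b, ∑ u ∈ K, N.conf v b u (!b) = 0 := fun v hv b =>
    sum_eq_zero fun u hu => conf_eq_zero_of_mixed (hmix v hv u hu) b
  have hsub : A ∪ K ⊆ S := union_subset h.subset hK.subset
  have hne : (A ∪ K).Nonempty := h.nonempty.mono subset_union_left
  have hrichK : ∀ v ∈ K, K.card + ∑ u ∈ K, N.conf v true u true ≤ N.edges K + 1 := fun v hv =>
    hK.card_add_le hv true
  by_cases hpoor : ∃ u ∈ A, φ u = false ∧ ∃ z ∈ K, N.conf u false z false ≠ 0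
  · obtain ⟨u, hu, hφu, z, hz, huz⟩ := hpoor
    have hcu : ∑ a ∈ A.erase u, N.degTo a K + 1 ≤ N.cross K A := by
      rw [N.cross_comm, cross, ← sum_erase_add A _ hu]
      have h1 := N.mult_le_degTo hz u
      have h2 := N.conf_le u false z
      omega
    refine ⟨ψ true, hsub, hne, hclosed, fun v hv hv0 => ?_, fun v hv hv1 => ?_, by omega, hor⟩
    · rcases mem_union.1 hv with hv | hv
      · rw [hψA _ v hv] at hv0
        rw [hconf, h.poor v hv hv0, zero_add]
        exact hzero v hv false
      · simp [hψK _ v hv] at hv0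
    · rw [hconf]
      rcases mem_union.1 hv with hv | hv
      · rw [hψA _ v hv] at hv1
        have h1 := h.rich v hv hv1
        have h2 : ∑ u ∈ K, N.conf v true u true ≤ N.degTo v K :=
          N.confTo_le v true K fun _ => true
        have h3 : N.degTo v K ≤ ∑ a ∈ A.erase u, N.degTo a K :=
          single_le_sum (f := fun a => N.degTo a K) (fun _ _ => Nat.zero_le _)
            (mem_erase.2 ⟨by rintro rfl; simp [hφu] at hv1, hv⟩)
        omega
      · have h1 := hrichK v hv
        have h2 : N.confTo v true A φ ≤ ∑ a ∈ A.erase u, N.degTo a K := by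
          have h0 : N.conf v true u false = 0 := conf_eq_zero_of_mixed (hmix' v hv u hu) true
          rw [confTo, ← sum_erase_add A _ hu, hφu, h0, add_zero]
          refine sum_le_sum fun a _ => ?_
          have h3 := N.conf_le v true a
          have h4 := N.mult_le_degTo hv a
          rw [N.mult_symm] at h4
          cases φ a <;> omega
        omega
  push Not at hpoor
  by_cases hin : ∃ u ∈ K, ∃ v ∈ K, N.conf u false v false ≠ 0
  · obtain ⟨u, hu, z, hz, huz⟩ := hin
    have hA : A.card ≤ N.edges A := h.card_le_or.resolve_right fun h0 => huz (h0 K hK u hu z hz)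
    have hK1 := hK.card_le_of_conf hu hz huz
    refine ⟨ψ true, hsub, hne, hclosed, fun v hv hv0 => ?_, fun v hv hv1 => ?_, by omega, hor⟩
    · rcases mem_union.1 hv with hv | hv
      · rw [hψA _ v hv] at hv0
        rw [hconf, h.poor v hv hv0, zero_add]
        exact hzero v hv false
      · simp [hψK _ v hv] at hv0
    · rw [hconf]
      rcases mem_union.1 hv with hv | hv
      · rw [hψA _ v hv] at hv1
        have h1 := h.rich v hv hv1
        have h2 : ∑ u ∈ K, N.conf v true u true ≤ N.degTo v K :=
          N.confTo_le v true K fun _ => true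
        have h3 := hcross v hv
        omega
      · have h1 := hrichK v hv
        have h2 := N.confTo_le v true A φ
        have h3 := N.degTo_le_cross hv A
        omega
  push Not at hin
  refine ⟨ψ false, hsub, hne, hclosed, fun v hv hv0 => ?_, fun v hv hv1 => ?_, by omega, hor⟩
  · rw [hconf]
    rcases mem_union.1 hv with hv | hv
    · rw [hψA _ v hv] at hv0
      rw [h.poor v hv hv0, zero_add]
      exact sum_eq_zero fun u hu => hpoor v hv hv0 u hu
    · rw [sum_eq_zero fun u hu => hin v hv u hu, add_zero]
      refine sum_eq_zero fun u hu => ?_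
      by_cases hφu : φ u = false
      · rw [hφu, N.conf_symm]
        exact hpoor u hu hφu v hv
      · rw [Bool.not_eq_false] at hφu
        rw [hφu]
        exact conf_eq_zero_of_mixed (hmix' v hv u hu) false
  · rcases mem_union.1 hv with hv | hv
    · rw [hψA _ v hv] at hv1
      have h1 := h.rich v hv hv1
      have h2 := hzero v hv true
      simp only [Bool.not_true] at h2
      rw [hconf, h2]
      omega
    · simp [hψK _ v hv] at hv1

/-- A coloring without conflicts at the poor vertices. -/
theorem colorable_of_edges_le {j : ℕ} (S : Finset α)
    (hS : ∀ T ⊆ S, T.Nonempty → N.edges T + 1 ≤ T.card + j) :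
    N.Colorable S fun _ b => if b then j + 1 else 1 := by
  classical
  induction S using Finset.strongInduction with
  | H S ih =>
  rcases S.eq_empty_or_nonempty with rfl | hne
  · exact ⟨fun _ => false, by simp [IsColoring]⟩
  have hex : (S.powerset.filter fun A => ∃ φ, N.IsFrugal S A φ).Nonempty := by
    obtain ⟨A, φ, h⟩ := exists_isFrugal (N := N) hne
    exact ⟨A, mem_filter.2 ⟨mem_powerset.2 h.subset, φ, h⟩⟩
  obtain ⟨A, hA, hmax⟩ := exists_max_image _ card hex
  simp only [mem_filter, mem_powerset] at hA hmax
  obtain ⟨hAS, φ, hφ⟩ := hA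
  have hc : N.cross (S \ A) A = 0 := by
    by_contra hc
    obtain ⟨v, hv, u, hu, hm⟩ := exists_mult_pos (Nat.one_le_iff_ne_zero.2 hc)
    obtain ⟨K, hK, hvK⟩ := exists_isMixedComponent (N := N) hv
    have hKA : ∀ v ∈ K, v ∉ A := fun v hv => (mem_sdiff.1 (hK.subset hv)).2
    have hdisj : Disjoint A K := disjoint_right.2 hKA
    -- There are no mixed pairs between `A` and the rest, so a component of `S \ A` is also one of
    -- `S`.
    have hK' : N.IsMixedComponent S K := by
      refine ⟨hK.subset.trans sdiff_subset, hK.nonempty, hK.two_mul_card_le, fun a ha b hb hbK => ?_⟩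
      by_cases hbA : b ∈ A
      · rw [mixed_symm]
        exact hφ.closed b hbA a (mem_sdiff.1 (hK.subset ha)).1 (hKA a ha)
      · exact hK.closed a ha b (mem_sdiff.2 ⟨hb, hbA⟩) hbK
    obtain ⟨ψ, hψ⟩ := hφ.extend hK' hdisj
      (hm.trans ((N.mult_le_degTo hu v).trans (N.degTo_le_cross hvK A)))
    have h1 := hmax _ ⟨hψ.subset, ψ, hψ⟩
    rw [card_union_of_disjoint hdisj] at h1
    have := hK.nonempty.card_pos
    omega
  have hss := sdiff_ssubset hAS hφ.nonempty
  obtain ⟨ψ, hψ⟩ := ih _ hss fun T hT => hS T (hT.trans hss.subset)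
  rw [← union_sdiff_of_subset hAS]
  refine Colorable.glue N disjoint_sdiff (φ := φ) (ψ := ψ) (fun v hv => ?_) fun v hv => ?_
  · have h1 : N.confTo v (φ v) (S \ A) ψ = 0 := by
      have h2 := N.confTo_le v (φ v) (S \ A) ψ
      have h3 := N.degTo_le_cross hv (S \ A)
      rw [N.cross_comm] at h3
      omega
    rw [h1, add_zero]
    cases hv0 : φ v
    · simp [hφ.poor v hv hv0]
    · have h2 := hφ.rich v hv hv0
      have h3 := hS A hAS hφ.nonempty
      simp only [if_true]
      omega
  · have h1 : N.confTo v (ψ v) A φ = 0 := by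
      have h2 := N.confTo_le v (ψ v) A φ
      have h3 := N.degTo_le_cross hv A
      omega
    rw [h1, zero_add]
    exact hψ v hv

end ConflictNetwork

end DefectiveDP

/-! ### From covers to conflict networks, and the five sufficient conditions. -/

namespace DefectiveDP

open Finset

section Conversion

variable {α β γ δ : Type*} {G : Graph α β} {H : Graph γ δ}

/-- The multiplicity of `u v` in `G`. -/
noncomputable def edgeMult (G : Graph α β) (u v : α) : ℕ := {e | G.IsLink e u v}.ncard

lemma edgeMult_comm (G : Graph α β) (u v : α) : edgeMult G u v = edgeMult G v u := by
  unfold edgeMult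
  congr 1
  ext e
  exact ⟨fun h => h.symm, fun h => h.symm⟩

lemma IsFiniteMultigraph.edgeMult_self (hG : IsFiniteMultigraph G) (v : α) :
    edgeMult G v v = 0 := by
  have := hG.loopless
  have h : {e | G.IsLink e v v} = ∅ := by
    ext e
    simp only [Set.mem_ofPred_eq, Set.mem_empty_iff_false, iff_false]
    exact fun h => h.ne rfl
  rw [edgeMult, h, Set.ncard_empty]

lemma IsFiniteMultigraph.two_mul_ncard_edgeSet_induce (hG : IsFiniteMultigraph G) (S : Finset α) :
    2 * E(G.induce (S : Set α)).ncard = ∑ u ∈ S, ∑ v ∈ S, edgeMult G u v := by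
  classical
  have hl := hG.loopless
  have hfin : E(G.induce (S : Set α)).Finite := hG.finite_edgeSet.subset fun e he => by
    obtain ⟨x, y, h⟩ := Graph.exists_isLink_of_mem_edgeSet he
    exact h.1.edge_mem
  set F := hfin.toFinset with hF
  have h1 : ∀ u ∈ S, ∀ v ∈ S, edgeMult G u v = (F.filter fun e => G.IsLink e u v).card := by
    intro u hu v hv
    rw [edgeMult, ← Set.ncard_coe_finset]
    congr 1
    ext e
    simp only [Set.mem_ofPred_eq, coe_filter, hF, Set.Finite.mem_toFinset]
    refine ⟨fun h => ⟨?_, h⟩, fun h => h.2⟩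
    exact Graph.IsLink.edge_mem (G := G.induce (S : Set α)) (x := u) (y := v) ⟨h, hu, hv⟩
  have h2 : ∑ u ∈ S, ∑ v ∈ S, edgeMult G u v
      = ∑ p ∈ S ×ˢ S, (F.filter fun e => G.IsLink e p.1 p.2).card := by
    rw [sum_product]
    exact sum_congr rfl fun u hu => sum_congr rfl fun v hv => h1 u hu v hv
  have h3 : ∑ p ∈ S ×ˢ S, (F.filter fun e => G.IsLink e p.1 p.2).card
      = ∑ e ∈ F, ((S ×ˢ S).filter fun p => G.IsLink e p.1 p.2).card :=
    sum_card_bipartiteAbove_eq_sum_card_bipartiteBelow fun (p : α × α) e => G.IsLink e p.1 p.2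
  have h4 : ∀ e ∈ F, ((S ×ˢ S).filter fun p => G.IsLink e p.1 p.2).card = 2 := by
    intro e he
    obtain ⟨x, y, h, hx, hy⟩ := Graph.exists_isLink_of_mem_edgeSet (hfin.mem_toFinset.1 he)
    have hne := h.ne
    have : ((S ×ˢ S).filter fun p => G.IsLink e p.1 p.2) = {(x, y), (y, x)} := by
      ext ⟨a, b⟩
      simp only [mem_filter, mem_product, mem_insert, mem_singleton, Prod.mk.injEq]
      refine ⟨fun h' => ?_, ?_⟩
      · rcases h.eq_and_eq_or_eq_and_eq h'.2 with ⟨rfl, rfl⟩ | ⟨rfl, rfl⟩ <;> simp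
      · rintro (⟨rfl, rfl⟩ | ⟨rfl, rfl⟩)
        · exact ⟨⟨hx, hy⟩, h⟩
        · exact ⟨⟨hy, hx⟩, h.symm⟩
    rw [this, card_pair]
    simp [hne]
  rw [h2, h3, sum_congr rfl h4, sum_const, Set.ncard_eq_toFinset_card _ hfin, smul_eq_mul, mul_comm]

open Classical in
/-- The number of edges of the cover graph `H` between the vertex of color `a` in the list of `u`
and the vertex of color `b` in the list of `v`. -/
noncomputable def conflicts (G : Graph α β) (H : Graph γ δ) (nd : α → Bool → γ) (u : α) (a : Bool)
    (v : α) (b : Bool) : ℕ :=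
  -- Adjacency in a loopless graph excludes the edge inside a list and the vertices outside `V(G)`,
  -- where `nd` is arbitrary.
  if G.Adj u v then {f | H.IsLink f (nd u a) (nd v b)}.ncard else 0

lemma conflicts_comm (nd : α → Bool → γ) (u : α) (a : Bool) (v : α) (b : Bool) :
    conflicts G H nd u a v b = conflicts G H nd v b u a := by
  classical
  unfold conflicts
  have h1 : G.Adj u v ↔ G.Adj v u := ⟨fun h => h.symm, fun h => h.symm⟩
  have h2 : {f | H.IsLink f (nd u a) (nd v b)} = {f | H.IsLink f (nd v b) (nd u a)} := by
    ext f
    exact ⟨fun h => h.symm, fun h => h.symm⟩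
  rw [h2]
  simp only [h1]

/-- A matching has only one edge at `x`, so cover edges from `x` to `L v` are told apart by the
edges `uv` whose matchings contain them. -/
lemma exists_link_injOn (hG : IsFiniteMultigraph G) {L : α → Set γ} (hL : IsTwoFoldCover G L H)
    {u v : α} (huv : G.Adj u v) {x : γ} (hx : x ∈ L u) :
    ∃ F : δ → β, (∀ f, (∃ y ∈ L v, H.IsLink f x y) → G.IsLink (F f) u v) ∧
      Set.InjOn F {f | ∃ y ∈ L v, H.IsLink f x y} := by
  classical
  have hl := hG.loopless
  obtain ⟨M, hM, hM'⟩ := hL.matchings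
  obtain ⟨e₀, he₀⟩ := huv
  have h : ∀ f, ∃ e, (∃ y ∈ L v, H.IsLink f x y) → G.IsLink e u v ∧ f ∈ M e := by
    intro f
    by_cases hf : ∃ y ∈ L v, H.IsLink f x y
    · obtain ⟨y, hy, hf⟩ := hf
      obtain ⟨e, he⟩ := hM' u he₀.left_mem v he₀.right_mem he₀.ne f x hx y hy hf
      exact ⟨e, fun _ => he⟩
    · exact ⟨e₀, fun h => absurd h hf⟩
  choose F hF using h
  refine ⟨F, fun f hf => (hF f hf).1, fun f hf g hg hfg => ?_⟩
  obtain ⟨k, -, hk⟩ := (hM _ _ _ (hF f hf).1).left x hx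
  obtain ⟨y, hyv, hy⟩ := hf
  obtain ⟨z, hzv, hz⟩ := hg
  have h1 := hk f ⟨(hF f ⟨y, hyv, hy⟩).2, ⟨y, hy⟩⟩
  have h2 := hk g ⟨hfg ▸ (hF g ⟨z, hzv, hz⟩).2, ⟨z, hz⟩⟩
  rw [h1, h2]

lemma IsFiniteMultigraph.finite_isLink (hG : IsFiniteMultigraph G) (u v : α) :
    {e | G.IsLink e u v}.Finite :=
  hG.finite_edgeSet.subset fun _ h => Graph.IsLink.edge_mem h

lemma finite_links (hG : IsFiniteMultigraph G) {L : α → Set γ} (hL : IsTwoFoldCover G L H)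
    {u v : α} (huv : G.Adj u v) {x : γ} (hx : x ∈ L u) :
    {f | ∃ y ∈ L v, H.IsLink f x y}.Finite := by
  obtain ⟨F, hF, hinj⟩ := exists_link_injOn hG hL huv hx
  exact Set.Finite.of_injOn (fun f hf => hF f hf) hinj (hG.finite_isLink u v)

lemma conflicts_le (hG : IsFiniteMultigraph G) {L : α → Set γ} (hL : IsTwoFoldCover G L H)
    {nd : α → Bool → γ} (hnd : ∀ v ∈ V(G), ∀ b, nd v b ∈ L v)
    (hne : ∀ v ∈ V(G), nd v false ≠ nd v true) (u : α) (a : Bool) (v : α) :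
    conflicts G H nd u a v false + conflicts G H nd u a v true ≤ edgeMult G u v := by
  classical
  unfold conflicts
  split_ifs with huv
  · obtain ⟨F, hF, hinj⟩ := exists_link_injOn hG hL huv (hnd u huv.left_mem a)
    have hfin := finite_links hG hL huv (hnd u huv.left_mem a)
    have hsub : ∀ b, {f | H.IsLink f (nd u a) (nd v b)} ⊆
        {f | ∃ y ∈ L v, H.IsLink f (nd u a) y} :=
      fun b f hf => ⟨_, hnd v huv.right_mem b, hf⟩
    rw [← Set.ncard_union_eq ?_ (hfin.subset (hsub _)) (hfin.subset (hsub _))]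
    · refine Set.ncard_le_ncard_of_injOn F (fun f hf => hF f ?_)
        (hinj.mono (Set.union_subset (hsub _) (hsub _))) (hG.finite_isLink u v)
      exact Set.union_subset (hsub _) (hsub _) hf
    · rw [Set.disjoint_left]
      intro f hf hf'
      exact hne v huv.right_mem (hf.right_unique hf')
  · simp

/-- The network of a cover. -/
noncomputable def coverNetwork (hG : IsFiniteMultigraph G) {L : α → Set γ}
    (hL : IsTwoFoldCover G L H) {nd : α → Bool → γ} (hnd : ∀ v ∈ V(G), ∀ b, nd v b ∈ L v)
    (hne : ∀ v ∈ V(G), nd v false ≠ nd v true) : ConflictNetwork α where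
  mult := edgeMult G
  conf := conflicts G H nd
  edges T := E(G.induce (T : Set α)).ncard
  mult_symm := edgeMult_comm G
  mult_self := hG.edgeMult_self
  conf_symm := conflicts_comm nd
  conf_le := conflicts_le hG hL hnd hne
  two_mul_edges := hG.two_mul_ncard_edgeSet_induce

lemma exists_isDefectiveColoring (hG : IsFiniteMultigraph G) {L : α → Set γ}
    (hL : IsTwoFoldCover G L H) {P R : Set γ} (hPR : Disjoint P R) {nd : α → Bool → γ}
    (hnd : ∀ v ∈ V(G), ∀ b, nd v b ∈ L v) (hne : ∀ v ∈ V(G), nd v false ≠ nd v true)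
    (hP : ∀ v ∈ V(G), nd v false ∈ P) (hR : ∀ v ∈ V(G), nd v true ∈ R) {i j : ℕ}
    (h : (coverNetwork hG hL hnd hne).Colorable hG.finite_vertexSet.toFinset
      fun _ b => if b then j + 1 else i + 1) :
    ∃ φ : V(G) → γ, IsDefectiveColoring G L H P R i j φ := by
  classical
  have hGl := hG.loopless
  have hHl := hL.loopless
  obtain ⟨c, hc⟩ := h
  set S := hG.finite_vertexSet.toFinset with hS
  have hmem : ∀ v, v ∈ S ↔ v ∈ V(G) := fun v => hG.finite_vertexSet.mem_toFinset
  have key : ∀ v ∈ V(G), degree (H.induce (Set.range fun v : V(G) => nd v (c v))) (nd v (c v))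
      ≤ ((∑ u ∈ S, conflicts G H nd v (c v) u (c u) : ℕ) : ℕ∞) := by
    intro v hv
    have hsub : (H.induce (Set.range fun v : V(G) => nd v (c v))).incidenceSet (nd v (c v)) ⊆
        ⋃ u ∈ S.filter (G.Adj v), {f | H.IsLink f (nd v (c v)) (nd u (c u))} := by
      rintro f ⟨y, hf, -, ⟨u, rfl⟩⟩
      have hu := u.2
      simp only [Set.mem_iUnion]
      refine ⟨u, ?_, hf⟩
      rw [mem_filter]
      refine ⟨(hmem _).2 hu, hL.adj v hv u hu ?_ ⟨_, hnd v hv _, _, hnd u hu _, ⟨f, hf⟩⟩⟩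
      intro h
      apply hf.ne
      simp only [h]
    refine (Set.encard_le_encard hsub).trans ?_
    have : ((⋃ u ∈ S.filter (G.Adj v), {f | H.IsLink f (nd v (c v)) (nd u (c u))}).encard) ≤
        ∑ u ∈ S.filter (G.Adj v), {f | H.IsLink f (nd v (c v)) (nd u (c u))}.encard := by
      induction S.filter (G.Adj v) using Finset.induction_on with
      | empty => simp
      | insert a s ha ih =>
        rw [sum_insert ha, Finset.set_biUnion_insert]
        exact (Set.encard_union_le _ _).trans (by gcongr)
    refine this.trans ?_
    rw [← sum_filter_add_sum_filter_not S (G.Adj v)]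
    push_cast
    refine le_add_right (sum_le_sum fun u hu => ?_)
    have huv := (mem_filter.1 hu).2
    rw [conflicts, if_pos huv, Set.Finite.cast_ncard_eq]
    exact (finite_links hG hL huv (hnd v hv (c v))).subset
      fun f hf => ⟨_, hnd u huv.right_mem _, hf⟩
  refine ⟨fun v => nd v (c v), ?_, fun v => hnd v v.2 _, ?_, ?_⟩
  · intro u v huv
    by_contra hne'
    have := hL.disjoint u.2 v.2 (fun h => hne' (Subtype.ext h))
    refine Set.disjoint_left.1 this (hnd u u.2 (c u)) ?_
    have h2 : nd u (c u) = nd v (c v) := huv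
    rw [h2]
    exact hnd v v.2 _
  · rintro _ ⟨v, rfl⟩ hv
    have h1 : c v = false := by
      by_contra h
      rw [Bool.not_eq_false] at h
      simp only [h] at hv
      exact Set.disjoint_left.1 hPR hv (hR v v.2)
    have h2 := hc v ((hmem _).2 v.2)
    refine (key v v.2).trans ?_
    simp only [h1, Bool.false_eq_true, if_false] at h2
    rw [h1]
    exact_mod_cast Nat.lt_succ_iff.1 h2
  · rintro _ ⟨v, rfl⟩ hv
    have h1 : c v = true := by
      by_contra h
      rw [Bool.not_eq_true] at h
      simp only [h] at hv
      exact Set.disjoint_left.1 hPR (hP v v.2) hv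
    have h2 := hc v ((hmem _).2 v.2)
    refine (key v v.2).trans ?_
    simp only [h1, if_true] at h2
    rw [h1]
    exact_mod_cast Nat.lt_succ_iff.1 h2

/-- A graph is colorable if all networks with its edge counts are. -/
lemma isColorable_of_network (hG : IsFiniteMultigraph G) {i j : ℕ}
    (h : ∀ N : ConflictNetwork α, (∀ T : Finset α, N.edges T = E(G.induce (T : Set α)).ncard) →
      N.Colorable hG.finite_vertexSet.toFinset fun _ b => if b then j + 1 else i + 1) :
    IsColorable i j G := by
  classical
  intro γ δ L H P R hL hPR
  have hpr : ∀ Q : Set γ, (∀ v ∈ V(G), (L v ∩ Q).ncard = 1) → ∀ v : V(G), ∃ x, x ∈ L v ∩ Q :=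
    fun Q hQ v => by
      obtain ⟨x, hx⟩ := Set.ncard_eq_one.1 (hQ v v.2)
      exact ⟨x, hx ▸ rfl⟩
  choose p hp using hpr P hPR.poor
  choose r hr using hpr R hPR.rich
  rcases Set.eq_empty_or_nonempty V(G) with hV | ⟨w, hw⟩
  · have : IsEmpty V(G) := Set.isEmpty_coe_sort.2 hV
    refine ⟨isEmptyElim, fun v => isEmptyElim v, fun v => isEmptyElim v, ?_, ?_⟩ <;>
    · rintro _ ⟨v, -⟩
      exact isEmptyElim v
  -- The value outside `V(G)` is a dummy; it is the reason for treating empty `V(G)` separately.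
  · set nd : α → Bool → γ := fun v b => if hv : v ∈ V(G) then (if b then r ⟨v, hv⟩ else p ⟨v, hv⟩)
      else p ⟨w, hw⟩ with hnd
    have h1 : ∀ v ∈ V(G), nd v false ∈ L v ∩ P := fun v hv => by
      simpa [hnd, hv] using hp ⟨v, hv⟩
    have h2 : ∀ v ∈ V(G), nd v true ∈ L v ∩ R := fun v hv => by
      simpa [hnd, hv] using hr ⟨v, hv⟩
    refine exists_isDefectiveColoring hG hL hPR.disjoint (nd := nd) ?_ ?_
      (fun v hv => (h1 v hv).2) (fun v hv => (h2 v hv).2) (h _ fun T => rfl)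
    · rintro v hv (_ | _)
      exacts [(h1 v hv).1, (h2 v hv).1]
    · intro v hv heq
      exact Set.disjoint_left.1 hPR.disjoint (h1 v hv).2 (heq ▸ (h2 v hv).2)

lemma AllSubgraphsSparse.le_of_subset {f : ℚ → ℚ} (h : AllSubgraphsSparse f G) {T : Finset α}
    (hT : (T : Set α) ⊆ V(G)) (hne : T.Nonempty) :
    (E(G.induce (T : Set α)).ncard : ℚ) ≤ f T.card := by
  have := h (G.induce (T : Set α)) (Graph.induce_le hT) (by simpa using hne)
  simpa using this

theorem isColorable_zero (hG : IsFiniteMultigraph G) {j : ℕ}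
    (h : AllSubgraphsSparse (fun n => n + j - 1) G) : IsColorable 0 j G := by
  classical
  refine isColorable_of_network hG fun N hN => N.colorable_of_edges_le _ fun T hT hne => ?_
  have h1 := h.le_of_subset (fun v hv => hG.finite_vertexSet.mem_toFinset.1 (hT hv)) hne
  rw [← hN] at h1
  have : (N.edges T + 1 : ℚ) ≤ T.card + j := by linarith
  exact_mod_cast this

theorem isColorable_of_two_mul_lt (hG : IsFiniteMultigraph G) {i j : ℕ} (hi : 1 ≤ i)
    (hj : 2 * i + 1 ≤ j)
    (h : AllSubgraphsSparse (fun n => ((2 * i + 1) * n - (2 * i - j + 1)) / (i + 1)) G) :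
    IsColorable i j G := by
  classical
  obtain ⟨τ, rfl⟩ := Nat.exists_eq_add_of_le hj
  refine isColorable_of_network hG fun N hN =>
    N.colorable_of_hasRichPotential hi (τ := τ) _ _ (by simp) fun T hT hne => ?_
  have h1 := h.le_of_subset (fun v hv => hG.finite_vertexSet.mem_toFinset.1 (hT hv)) hne
  rw [← hN, le_div_iff₀ (by positivity)] at h1
  have h2 : (N.edges T * (i + 1) : ℤ) ≤ (2 * i + 1) * T.card - (2 * i - (2 * i + 1 + τ : ℕ) + 1) := by
    exact_mod_cast h1
  have h3 : ∀ v ∈ T, richPotential i τ (i + 1) (2 * i + 1 + τ + 1) = 2 * i + 1 := fun _ _ => by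
    simp only [richPotential]
    rw [if_neg (by omega), min_eq_left (by omega)]
    omega
  have h4 : N.richRho i τ (fun _ b => if b then 2 * i + 1 + τ + 1 else i + 1) T
      = (2 * i + 1) * T.card - (i + 1) * N.edges T := by
    simp only [ConflictNetwork.richRho, ConflictNetwork.potential, if_true, Bool.false_eq_true,
      if_false]
    rw [sum_congr rfl h3, sum_const, nsmul_eq_mul]
    ring
  refine ⟨?_, fun ⟨v, _, hv⟩ => absurd hv (by simp)⟩
  rw [h4]
  push_cast at h2
  linarith

theorem isColorable_of_le_two_mul (hG : IsFiniteMultigraph G) {i j : ℕ} (hij : i + 2 ≤ j)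
    (hj : j ≤ 2 * i) (h : AllSubgraphsSparse (fun n => (2 * j * n + 1) / (j + 1)) G) :
    IsColorable i j G := by
  classical
  refine isColorable_of_network hG fun N hN => N.colorable_of_hasPotential
    (isPotentialFunction_of_le_two_mul hij hj) _ _ (by simp) fun T hT hne => ?_
  have h1 := h.le_of_subset (fun v hv => hG.finite_vertexSet.mem_toFinset.1 (hT hv)) hne
  rw [← hN, le_div_iff₀ (by positivity)] at h1
  have h2 : (N.edges T * (j + 1) : ℤ) ≤ 2 * j * T.card + 1 := by exact_mod_cast h1
  simp only [ConflictNetwork.potential, if_true, Bool.false_eq_true, if_false, sum_const,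
    nsmul_eq_mul]
  have h3 : min (2 * max (((i + 1 : ℕ) : ℤ)) ((j + 1 : ℕ) : ℤ) - 2)
      (2 * min ((i + 1 : ℕ) : ℤ) ((j + 1 : ℕ) : ℤ) + j - 1) = 2 * j := by omega
  rw [h3]
  linarith

theorem isColorable_succ (hG : IsFiniteMultigraph G) {i : ℕ} (hi : 1 ≤ i)
    (h : AllSubgraphsSparse
      (fun n => (2 * i ^ 2 + 4 * i + 1) / (i ^ 2 + 3 * i + 1) * n) G) :
    IsColorable i (i + 1) G := by
  classical
  refine isColorable_of_network hG fun N hN => N.colorable_of_hasPotential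
    (isPotentialFunction_of_eq_succ hi) _ _ (by simp) fun T hT hne => ?_
  have h1 := h.le_of_subset (fun v hv => hG.finite_vertexSet.mem_toFinset.1 (hT hv)) hne
  rw [← hN, div_mul_eq_mul_div, le_div_iff₀ (by positivity)] at h1
  have h2 : (N.edges T * (i ^ 2 + 3 * i + 1) : ℤ) ≤ (2 * i ^ 2 + 4 * i + 1) * T.card := by
    exact_mod_cast h1
  simp only [ConflictNetwork.potential, if_true, Bool.false_eq_true, if_false, sum_const,
    nsmul_eq_mul]
  rw [if_neg (by omega)]
  push_cast
  nlinarith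

theorem isColorable_self (hG : IsFiniteMultigraph G) {i : ℕ} (hi : 1 ≤ i)
    (h : AllSubgraphsSparse (fun n => ((2 * i + 2) * n - 1) / (i + 2)) G) :
    IsColorable i i G := by
  classical
  refine isColorable_of_network hG fun N hN => N.colorable_of_hasPotential
    (isPotentialFunction_of_eq hi) _ _ (by simp) fun T hT hne => ?_
  have h1 := h.le_of_subset (fun v hv => hG.finite_vertexSet.mem_toFinset.1 (hT hv)) hne
  rw [← hN, le_div_iff₀ (by positivity)] at h1
  have h2 : (N.edges T * (i + 2) : ℤ) ≤ (2 * i + 2) * T.card - 1 := by exact_mod_cast h1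
  simp only [ConflictNetwork.potential, if_true, Bool.false_eq_true, if_false, sum_const,
    nsmul_eq_mul]
  push_cast
  nlinarith

end Conversion

end DefectiveDP

/-! ### Signed edge lists and rooted gadgets. -/

namespace DefectiveDP

open Finset

/-- A list of edges between vertices in `V`. An edge `(u, v, s)` stands for a perfect matching of
the cover graph between the lists of `u` and `v`: if `s` is `false`, it joins the vertices of equal
colors, otherwise those of different colors. -/
abbrev EdgeList (V : Type) := List (V × V × Bool)

namespace EdgeList

variable {V V₁ V₂ : Type}

open Classical in
/-- The number of edges inside `T`. -/
noncomputable def edgesIn (l : EdgeList V) (T : Finset V) : ℕ :=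
  l.countP fun e => e.1 ∈ T ∧ e.2.1 ∈ T

open Classical in
/-- The number of conflicts of the vertex `v` in the coloring `c`. -/
noncomputable def conflictsAt (l : EdgeList V) (c : V → Bool) (v : V) : ℕ :=
  l.countP fun e => (e.1 = v ∨ e.2.1 = v) ∧ xor (c e.1) (c e.2.1) = e.2.2

/-- No edge is a loop. -/
def Loopless (l : EdgeList V) : Prop := ∀ e ∈ l, e.1 ≠ e.2.1

/-- No vertex has more conflicts than the capacity of its color. -/
def Valid (cap : Bool → ℕ) (l : EdgeList V) (c : V → Bool) : Prop :=
  ∀ v, l.conflictsAt c v ≤ cap (c v)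

/-- The potential of a set of vertices. -/
noncomputable def potential (N D : ℤ) (l : EdgeList V) (T : Finset V) : ℤ :=
  N * T.card - D * l.edgesIn T

/-- The disjoint union of two edge lists, with further edges between `r₁` and `r₂`. -/
def join (l₁ : EdgeList V₁) (r₁ : V₁) (l₂ : EdgeList V₂) (r₂ : V₂) (ss : List Bool) :
    EdgeList (V₁ ⊕ V₂) :=
  l₁.map (Prod.map Sum.inl (Prod.map Sum.inl id)) ++
    (l₂.map (Prod.map Sum.inr (Prod.map Sum.inr id)) ++
      ss.map fun s => (Sum.inl r₁, Sum.inr r₂, s))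

variable {l : EdgeList V} {l₁ : EdgeList V₁} {r₁ : V₁} {l₂ : EdgeList V₂} {r₂ : V₂}
  {ss : List Bool} {N D : ℤ} {cap : Bool → ℕ}

lemma Loopless.join (h₁ : l₁.Loopless) (h₂ : l₂.Loopless) : (join l₁ r₁ l₂ r₂ ss).Loopless := by
  intro e he
  simp only [EdgeList.join, List.mem_append, List.mem_map] at he
  rcases he with ⟨e, he, rfl⟩ | ⟨e, he, rfl⟩ | ⟨s, -, rfl⟩
  · simpa using h₁ e he
  · simpa using h₂ e he
  · simp

open Classical in
lemma edgesIn_join (T : Finset (V₁ ⊕ V₂)) :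
    (join l₁ r₁ l₂ r₂ ss).edgesIn T = l₁.edgesIn T.toLeft + l₂.edgesIn T.toRight +
      if r₁ ∈ T.toLeft ∧ r₂ ∈ T.toRight then ss.length else 0 := by
  simp only [edgesIn, join, List.countP_append, List.countP_map, add_assoc]
  congr 1
  · congr 1
    ext e
    simp
  congr 1
  · congr 1
    ext e
    simp
  split_ifs with h
  · rw [List.countP_eq_length]
    intro s _
    simpa using h
  · rw [List.countP_eq_zero]
    intro s _
    simpa using h

open Classical in
lemma potential_join (T : Finset (V₁ ⊕ V₂)) :
    (join l₁ r₁ l₂ r₂ ss).potential N D T =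
      l₁.potential N D T.toLeft + l₂.potential N D T.toRight -
      if r₁ ∈ T.toLeft ∧ r₂ ∈ T.toRight then ss.length * D else 0 := by
  simp only [potential, edgesIn_join, ← T.card_toLeft_add_card_toRight]
  split_ifs <;> push_cast <;> ring

@[simp] lemma potential_empty : l.potential N D ∅ = 0 := by
  simp [potential, edgesIn]

open Classical in
lemma conflictsAt_join_inl (c : V₁ ⊕ V₂ → Bool) (v : V₁) :
    (join l₁ r₁ l₂ r₂ ss).conflictsAt c (Sum.inl v) = l₁.conflictsAt (c ∘ Sum.inl) v +
      if v = r₁ then ss.count (xor (c (Sum.inl r₁)) (c (Sum.inr r₂))) else 0 := by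
  simp only [conflictsAt, join, List.countP_append, List.countP_map]
  congr 1
  · congr 1
    ext e
    simp
  rw [List.countP_eq_zero.2 (by simp), zero_add]
  split_ifs with h
  · rw [List.count]
    congr 1
    ext s
    rw [Bool.eq_iff_iff]
    simp [h]
    exact eq_comm
  · rw [List.countP_eq_zero]
    simp [Ne.symm h]

open Classical in
lemma conflictsAt_join_inr (c : V₁ ⊕ V₂ → Bool) (v : V₂) :
    (join l₁ r₁ l₂ r₂ ss).conflictsAt c (Sum.inr v) = l₂.conflictsAt (c ∘ Sum.inr) v +
      if v = r₂ then ss.count (xor (c (Sum.inl r₁)) (c (Sum.inr r₂))) else 0 := by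
  simp only [conflictsAt, join, List.countP_append, List.countP_map]
  rw [List.countP_eq_zero.2 (by simp), zero_add]
  congr 1
  · congr 1
    ext e
    simp
  split_ifs with h
  · rw [List.count]
    congr 1
    ext s
    rw [Bool.eq_iff_iff]
    simp [h]
    exact eq_comm
  · rw [List.countP_eq_zero]
    simp [Ne.symm h]

lemma Valid.left {c : V₁ ⊕ V₂ → Bool} (h : Valid cap (join l₁ r₁ l₂ r₂ ss) c) :
    Valid cap l₁ (c ∘ Sum.inl) := fun v => by
  have := h (Sum.inl v)
  rw [conflictsAt_join_inl] at this
  exact (Nat.le_add_right _ _).trans this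

lemma Valid.right {c : V₁ ⊕ V₂ → Bool} (h : Valid cap (join l₁ r₁ l₂ r₂ ss) c) :
    Valid cap l₂ (c ∘ Sum.inr) := fun v => by
  have := h (Sum.inr v)
  rw [conflictsAt_join_inr] at this
  exact (Nat.le_add_right _ _).trans this

end EdgeList

/-- There is an edge list on `n` vertices with a root `r` such that the set of all vertices has
potential `A`, all other sets that contain `r` have larger potential, nonempty sets that do not
contain `r` have potential at least `θ`, and in all valid colorings the color and the number of
conflicts of `r` satisfy `Q`. -/
def HasGadget (N D θ : ℤ) (cap : Bool → ℕ) (n : ℕ) (A : ℤ) (Q : Bool → ℕ → Prop) : Prop :=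
  ∃ (V : Type) (_ : Fintype V) (l : EdgeList V) (r : V), Fintype.card V = n ∧ l.Loopless ∧
    l.potential N D univ = A ∧ (∀ T, r ∈ T → T ≠ univ → A + 1 ≤ l.potential N D T) ∧
    (∀ T, T.Nonempty → r ∉ T → θ ≤ l.potential N D T) ∧
    ∀ c, l.Valid cap c → Q (c r) (l.conflictsAt c r)

namespace HasGadget

variable {N D θ A A₁ A₂ : ℤ} {cap : Bool → ℕ} {n n₁ n₂ : ℕ} {Q Q' Q₁ Q₂ : Bool → ℕ → Prop}

lemma single (N D θ : ℤ) (cap : Bool → ℕ) :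
    HasGadget N D θ cap 1 N fun _ t => t = 0 := by
  refine ⟨Unit, inferInstance, [], (), rfl, by simp [EdgeList.Loopless], ?_, ?_, ?_, ?_⟩
  · simp [EdgeList.potential, EdgeList.edgesIn]
  · intro T hT hne
    exact absurd (eq_univ_iff_forall.2 fun _ => hT) hne
  · rintro T ⟨⟨⟩, h⟩ h'
    exact absurd h h'
  · simp [EdgeList.conflictsAt]

lemma mono (h : HasGadget N D θ cap n A Q) (hQ : ∀ b t, Q b t → t ≤ cap b → Q' b t) :
    HasGadget N D θ cap n A Q' := by
  obtain ⟨V, _, l, r, h1, h2, h3, h4, h5, h6⟩ := h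
  exact ⟨V, _, l, r, h1, h2, h3, h4, h5, fun c hc => hQ _ _ (h6 c hc) (hc r)⟩

lemma toLeft_eq_univ_or {V₁ V₂ : Type} [Fintype V₁] [Fintype V₂] {T : Finset (V₁ ⊕ V₂)}
    (h : T ≠ univ) : T.toLeft ≠ univ ∨ T.toRight ≠ univ := by
  by_contra! h'
  refine h (eq_univ_iff_forall.2 ?_)
  rintro (v | v)
  · exact mem_toLeft.1 (h'.1 ▸ mem_univ v)
  · exact mem_toRight.1 (h'.2 ▸ mem_univ v)

/-- The joined gadget keeps the first root. The hypothesis `A₂ < ss.length * D` ensures that leaving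
out the second gadget strictly raises the potential. -/
lemma join (h₁ : HasGadget N D θ cap n₁ A₁ Q₁) (h₂ : HasGadget N D θ cap n₂ A₂ Q₂)
    (ss : List Bool) (hθ : 0 ≤ θ) (hA : θ ≤ A₂) (hA' : A₂ < ss.length * D) :
    HasGadget N D θ cap (n₁ + n₂) (A₁ + A₂ - ss.length * D) fun b t =>
      ∃ t₁ b₂ t₂, Q₁ b t₁ ∧ Q₂ b₂ t₂ ∧ t = t₁ + ss.count (xor b b₂) ∧
        t₂ + ss.count (xor b b₂) ≤ cap b₂ := by
  classical
  obtain ⟨V₁, _, l₁, r₁, card₁, ll₁, univ₁, mem₁, not₁, col₁⟩ := h₁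
  obtain ⟨V₂, _, l₂, r₂, card₂, ll₂, univ₂, mem₂, not₂, col₂⟩ := h₂
  have le₁ : ∀ T, r₁ ∈ T → A₁ ≤ l₁.potential N D T := fun T hT => by
    by_cases h : T = univ
    · rw [h, univ₁]
    · linarith [mem₁ T hT h]
  have le₂ : ∀ T, r₂ ∈ T → A₂ ≤ l₂.potential N D T := fun T hT => by
    by_cases h : T = univ
    · rw [h, univ₂]
    · linarith [mem₂ T hT h]
  have pos₂ : ∀ T, T.Nonempty → θ ≤ l₂.potential N D T := fun T hT => by
    by_cases h : r₂ ∈ T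
    · linarith [le₂ T h]
    · exact not₂ T hT h
  have nonneg₂ : ∀ T, 0 ≤ l₂.potential N D T := fun T => by
    rcases T.eq_empty_or_nonempty with rfl | h
    · simp
    · linarith [pos₂ T h]
  refine ⟨V₁ ⊕ V₂, inferInstance, EdgeList.join l₁ r₁ l₂ r₂ ss, Sum.inl r₁, by simp [*],
    ll₁.join ll₂, ?_, ?_, ?_, ?_⟩
  · rw [EdgeList.potential_join, if_pos (by simp)]
    have h1 : (univ : Finset (V₁ ⊕ V₂)).toLeft = univ := by ext; simp
    have h2 : (univ : Finset (V₁ ⊕ V₂)).toRight = univ := by ext; simp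
    rw [h1, h2, univ₁, univ₂]
  · intro T hT hne
    have hT' : r₁ ∈ T.toLeft := mem_toLeft.2 hT
    rw [EdgeList.potential_join]
    split_ifs with h
    · rcases toLeft_eq_univ_or hne with h' | h'
      · linarith [mem₁ _ hT' h', le₂ _ h.2]
      · linarith [le₁ _ hT', mem₂ _ h.2 h']
    · linarith [le₁ _ hT', nonneg₂ T.toRight]
  · intro T hT hr
    have hr' : r₁ ∉ T.toLeft := fun h => hr (mem_toLeft.1 h)
    rw [EdgeList.potential_join, if_neg fun h => hr' h.1]
    rcases T.toLeft.eq_empty_or_nonempty with h | h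
    · rw [h]
      have : T.toRight.Nonempty := by
        obtain ⟨v | v, hv⟩ := hT
        · exact absurd (mem_toLeft.2 hv) (by simp [h])
        · exact ⟨v, mem_toRight.2 hv⟩
      simpa using pos₂ _ this
    · linarith [not₁ _ h hr', nonneg₂ T.toRight]
  · intro c hc
    have h := hc (Sum.inr r₂)
    rw [EdgeList.conflictsAt_join_inr, if_pos rfl] at h
    refine ⟨_, _, _, col₁ _ hc.left, col₂ _ hc.right, ?_, h⟩
    rw [EdgeList.conflictsAt_join_inl, if_pos rfl]
    rfl

/-- Join the root by two edges, which always produce exactly one conflict, to each of `m` new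
vertices. -/
lemma addLeaves (h : HasGadget N D θ cap n A Q) (m : ℕ) (hθ : 0 ≤ θ) (hN : θ ≤ N)
    (hN' : N < 2 * D) :
    HasGadget N D θ cap (n + m) (A - m * (2 * D - N)) fun b t => ∃ t₁, Q b t₁ ∧ t = t₁ + m := by
  induction m with
  | zero => simpa using h
  | succ m ih =>
    have := ih.join (single N D θ cap) [false, true] hθ hN (by simpa using hN')
    have hA : A - ((m + 1 : ℕ) : ℤ) * (2 * D - N) =
        A - m * (2 * D - N) + N - ([false, true].length : ℕ) * D := by
      simp only [List.length_cons, List.length_nil]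
      push_cast
      ring
    rw [hA]
    refine this.mono ?_
    · rintro b t ⟨t₁, b₂, t₂, ⟨t₃, h, rfl⟩, rfl, rfl, -⟩ -
      refine ⟨t₃, h, ?_⟩
      cases xor b b₂ <;> simp [add_assoc]

/-- A vertex with `m` double leaves. -/
lemma star (N D θ : ℤ) (cap : Bool → ℕ) (m : ℕ) (hθ : 0 ≤ θ) (hN : θ ≤ N) (hN' : N < 2 * D) :
    HasGadget N D θ cap (m + 1) (N - m * (2 * D - N)) fun _ t => t = m := by
  rw [add_comm]
  exact ((single N D θ cap).addLeaves m hθ hN hN').mono (by simp)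

end HasGadget

end DefectiveDP

/-! ### The multigraph and the cover of a signed edge list. -/

namespace DefectiveDP

open Finset

lemma encard_getElem?_eq_countP {X : Type*} (l : List X) (p : X → Bool) :
    {k : ℕ | ∃ e, l[k]? = some e ∧ p e}.encard = l.countP p := by
  induction l with
  | nil => simp
  | cons a l ih =>
    have h : {k : ℕ | ∃ e, (a :: l)[k]? = some e ∧ p e} =
        {k | k = 0 ∧ p a} ∪ Nat.succ '' {k : ℕ | ∃ e, l[k]? = some e ∧ p e} := by
      ext (_ | k) <;> simp
    rw [h, Set.encard_union_eq, Nat.succ_injective.encard_image, ih, List.countP_cons, add_comm]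
    · cases p a <;> simp
    · rw [Set.disjoint_left]
      rintro _ ⟨rfl, -⟩ ⟨k, -, h⟩
      exact absurd h (Nat.succ_ne_zero k)

namespace EdgeList

variable {V : Type}

/-- The multigraph of an edge list, with vertices renamed by `ι`. -/
def toGraph (l : EdgeList V) (ι : V → ℕ) : Graph ℕ ℕ where
  vertexSet := Set.range ι
  IsLink k x y := ∃ e, l[k]? = some e ∧ (ι e.1 = x ∧ ι e.2.1 = y ∨ ι e.1 = y ∧ ι e.2.1 = x)
  isLink_symm := fun k _ => ⟨fun x y ⟨e, he, h⟩ => ⟨e, he, h.symm⟩⟩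
  eq_or_eq_of_isLink_of_isLink := by
    rintro k x y v w ⟨e, he, h⟩ ⟨e', he', h'⟩
    obtain rfl : e = e' := Option.some.inj (he.symm.trans he')
    grind
  left_mem_of_isLink := by
    rintro k x y ⟨e, -, ⟨rfl, -⟩ | ⟨-, rfl⟩⟩ <;> exact ⟨_, rfl⟩

/-- The graph of the cover of an edge list. -/
def coverGraph (l : EdgeList V) : Graph (V × Bool) (V ⊕ ℕ × Bool) where
  vertexSet := Set.univ
  IsLink f x y := match f with
    | Sum.inl v => x = (v, false) ∧ y = (v, true) ∨ x = (v, true) ∧ y = (v, false)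
    -- The two cover edges of edge `k` are indexed by the color at its first end.
    | Sum.inr (k, b) => ∃ e, l[k]? = some e ∧ (x = (e.1, b) ∧ y = (e.2.1, xor b e.2.2) ∨
        x = (e.2.1, xor b e.2.2) ∧ y = (e.1, b))
  isLink_symm := by
    rintro (v | ⟨k, b⟩) -
    · exact ⟨fun x y h => by grind⟩
    · exact ⟨fun x y h => by grind⟩
  eq_or_eq_of_isLink_of_isLink := by
    rintro (v | ⟨k, b⟩) x y v w h h'
    · grind
    · obtain ⟨e, he, h⟩ := h
      obtain ⟨e', he', h'⟩ := h'
      obtain rfl : e = e' := Option.some.inj (he.symm.trans he')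
      grind
  left_mem_of_isLink := fun _ _ _ _ => Set.mem_univ _

/-- The lists of the cover of an edge list. -/
def lists (ι : V → ℕ) (x : ℕ) : Set (V × Bool) := {p | ι p.1 = x}

variable {l : EdgeList V} {ι : V → ℕ}

lemma lists_apply (hι : ι.Injective) (v : V) : lists ι (ι v) = {(v, false), (v, true)} := by
  ext ⟨u, b⟩
  simp only [lists, Set.mem_ofPred_eq, hι.eq_iff, Set.mem_insert_iff, Set.mem_singleton_iff,
    Prod.mk.injEq]
  cases b <;> simp

lemma Loopless.getElem? (hl : l.Loopless) {k : ℕ} {e : V × V × Bool} (h : l[k]? = some e) :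
    e.1 ≠ e.2.1 := hl e (List.mem_of_getElem? h)

lemma edgeSet_toGraph : E(l.toGraph ι) = {k | k < l.length} := by
  ext k
  refine ⟨?_, fun h => ⟨_, _, _, List.getElem?_eq_getElem h, Or.inl ⟨rfl, rfl⟩⟩⟩
  rintro ⟨x, y, e, he, -⟩
  exact (List.getElem?_eq_some_iff.1 he).1

lemma isFiniteMultigraph_toGraph [Finite V] (hι : ι.Injective) (hl : l.Loopless) :
    IsFiniteMultigraph (l.toGraph ι) where
  loopless := ⟨fun k x ⟨e, he, h⟩ => by
    have := hl.getElem? he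
    apply this
    apply hι
    grind⟩
  finite_vertexSet := Set.finite_range ι
  finite_edgeSet := by
    rw [edgeSet_toGraph]
    exact Set.finite_lt_nat _

lemma isTwoFoldCover (hι : ι.Injective) (hl : l.Loopless) :
    IsTwoFoldCover (l.toGraph ι) (lists ι) l.coverGraph where
  loopless := by
    refine ⟨?_⟩
    rintro (v | ⟨k, b⟩) x h
    · rcases h with ⟨h, h'⟩ | ⟨h, h'⟩ <;> simp [h] at h'
    · obtain ⟨e, he, h⟩ := h
      have := hl.getElem? he
      grind
  disjoint := by
    intro x _ y _ hxy
    refine Set.disjoint_left.2 fun p hx hy => hxy ?_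
    exact (show ι p.1 = x from hx).symm.trans hy
  union := by
    refine Set.eq_univ_of_forall fun p => ?_
    simp only [Set.mem_iUnion]
    exact ⟨ι p.1, ⟨p.1, rfl⟩, rfl⟩
  card := by
    rintro _ ⟨v, rfl⟩
    rw [lists_apply hι, Set.ncard_pair]
    simp
  complete := by
    rintro _ ⟨v, rfl⟩ x hx y hy hxy
    rw [lists_apply hι] at hx hy
    refine ⟨Sum.inl v, ?_, ?_⟩
    · rcases hx with rfl | rfl <;> rcases hy with rfl | rfl
      · exact absurd rfl hxy
      · exact Or.inl ⟨rfl, rfl⟩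
      · exact Or.inr ⟨rfl, rfl⟩
      · exact absurd rfl hxy
    · have hx1 : x.1 = v := by rcases hx with rfl | rfl <;> rfl
      have hy1 : y.1 = v := by rcases hy with rfl | rfl <;> rfl
      rintro (u | ⟨k, b⟩) h
      · rcases h with ⟨rfl, -⟩ | ⟨rfl, -⟩ <;> exact congrArg Sum.inl hx1
      · obtain ⟨e, he, h⟩ := h
        have := hl.getElem? he
        grind
  adj := by
    rintro _ ⟨u, rfl⟩ _ ⟨v, rfl⟩ huv ⟨x, hx, y, hy, f, hf⟩
    have hx1 : x.1 = u := hι hx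
    have hy1 : y.1 = v := hι hy
    rcases f with w | ⟨k, b⟩
    · rcases hf with ⟨rfl, rfl⟩ | ⟨rfl, rfl⟩ <;> exact absurd (hx.symm.trans hy) huv
    · obtain ⟨e, he, h⟩ := hf
      refine ⟨k, e, he, ?_⟩
      grind
  matchings := by
    refine ⟨fun k => {f | ∃ b, f = Sum.inr (k, b)}, ?_, ?_⟩
    · have key : ∀ k e, l[k]? = some e → ∀ u v, (e.1 = u ∧ e.2.1 = v ∨ e.1 = v ∧ e.2.1 = u) →
          ∀ x ∈ lists ι (ι u),
            ∃! f, f ∈ {f : V ⊕ ℕ × Bool | ∃ b, f = Sum.inr (k, b)} ∧ l.coverGraph.Inc f x := by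
        intro k e he u v huv ⟨w, b⟩ hx
        obtain rfl : w = u := hι hx
        have hne := hl.getElem? he
        rcases huv with ⟨rfl, -⟩ | ⟨-, rfl⟩
        · refine ⟨Sum.inr (k, b), ⟨⟨b, rfl⟩, _, e, he, Or.inl ⟨rfl, rfl⟩⟩, ?_⟩
          rintro _ ⟨⟨b', rfl⟩, y, e', he', h⟩
          obtain rfl : e = e' := Option.some.inj (he.symm.trans he')
          grind
        · refine ⟨Sum.inr (k, xor b e.2.2), ⟨⟨_, rfl⟩, (e.1, xor b e.2.2), e, he,
            Or.inr ⟨by simp, rfl⟩⟩, ?_⟩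
          rintro _ ⟨⟨b', rfl⟩, y, e', he', h⟩
          obtain rfl : e = e' := Option.some.inj (he.symm.trans he')
          rcases h with ⟨h, -⟩ | ⟨h, -⟩
          · exact absurd (congrArg Prod.fst h).symm hne
          · have : b = xor b' e.2.2 := congrArg Prod.snd h
            simp [this]
      rintro k _ _ ⟨e, he, h⟩
      obtain ⟨u, v, rfl, rfl, h'⟩ : ∃ u v, ι u = _ ∧ ι v = _ ∧
          (e.1 = u ∧ e.2.1 = v ∨ e.1 = v ∧ e.2.1 = u) := by
        rcases h with h | h
        · exact ⟨e.1, e.2.1, h.1, h.2, Or.inl ⟨rfl, rfl⟩⟩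
        · exact ⟨e.2.1, e.1, h.2, h.1, Or.inr ⟨rfl, rfl⟩⟩
      refine ⟨?_, key k e he u v h', key k e he v u h'.symm⟩
      rintro _ ⟨b, rfl⟩
      rcases h' with ⟨rfl, rfl⟩ | ⟨rfl, rfl⟩
      · exact ⟨(e.1, b), rfl, (e.2.1, xor b e.2.2), rfl, e, he, Or.inl ⟨rfl, rfl⟩⟩
      · exact ⟨(e.2.1, xor b e.2.2), rfl, (e.1, b), rfl, e, he, Or.inr ⟨rfl, rfl⟩⟩
    · rintro _ ⟨u, rfl⟩ _ ⟨v, rfl⟩ huv f x hx y hy hf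
      have hx1 : x.1 = u := hι hx
      have hy1 : y.1 = v := hι hy
      rcases f with w | ⟨k, b⟩
      · rcases hf with ⟨rfl, rfl⟩ | ⟨rfl, rfl⟩ <;> exact absurd (hx.symm.trans hy) huv
      · obtain ⟨e, he, h⟩ := hf
        refine ⟨k, ⟨e, he, ?_⟩, b, rfl⟩
        grind

lemma isPoorRichPartition (hι : ι.Injective) :
    IsPoorRichPartition (l.toGraph ι) (lists ι) l.coverGraph {p | p.2 = false} {p | p.2 = true} where
  union := by
    refine Set.eq_univ_of_forall ?_
    rintro ⟨v, _ | _⟩ <;> simp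
  disjoint := by
    rw [Set.disjoint_left]
    rintro ⟨v, _ | _⟩ <;> simp
  poor := by
    rintro _ ⟨v, rfl⟩
    rw [Set.ncard_eq_one]
    refine ⟨(v, false), ?_⟩
    rw [lists_apply hι]
    ext ⟨u, _ | _⟩ <;> simp
  rich := by
    rintro _ ⟨v, rfl⟩
    rw [Set.ncard_eq_one]
    refine ⟨(v, true), ?_⟩
    rw [lists_apply hι]
    ext ⟨u, _ | _⟩ <;> simp

lemma not_isColorable_toGraph (hι : ι.Injective) (hl : l.Loopless) {i j : ℕ}
    (h : ∀ c, ¬ l.Valid (fun b => if b then j else i) c) : ¬ IsColorable i j (l.toGraph ι) := by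
  classical
  intro hcol
  obtain ⟨φ, hφ⟩ := hcol _ _ _ _ _ _ (isTwoFoldCover hι hl) (isPoorRichPartition hι)
  set c : V → Bool := fun v => (φ ⟨ι v, v, rfl⟩).2 with hc
  have hφc : ∀ v, φ ⟨ι v, v, rfl⟩ = (v, c v) := fun v =>
    Prod.ext (hι (hφ.mem ⟨ι v, v, rfl⟩)) rfl
  have hrange : ∀ v, (v, c v) ∈ Set.range φ := fun v => ⟨_, hφc v⟩
  refine h c fun v => ?_
  have hdeg : (l.conflictsAt c v : ℕ∞) ≤
      degree (l.coverGraph.induce (Set.range φ)) (v, c v) := by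
    rw [conflictsAt, ← encard_getElem?_eq_countP]
    -- A conflicting edge `k` is sent to its cover edge at the chosen color of its first end. The
    -- value for indices out of range is a dummy.
    refine Set.encard_le_encard_of_injOn
      (f := fun k => Sum.inr (k, if hk : k < l.length then c (l[k]).1 else false)) ?_ ?_
    · rintro k ⟨e, he, h⟩
      obtain ⟨hk, rfl⟩ := List.getElem?_eq_some_iff.1 he
      simp only [hk, dif_pos]
      simp only [decide_eq_true_eq] at h
      set e := l[k] with he'
      have hs : xor (c e.1) e.2.2 = c e.2.1 := by rw [← h.2]; simp
      rcases h.1 with h1 | h1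
      · exact ⟨(e.2.1, c e.2.1), ⟨e, he, Or.inl ⟨by rw [← h1], by rw [hs]⟩⟩, hrange _, hrange _⟩
      · exact ⟨(e.1, c e.1), ⟨e, he, Or.inr ⟨by rw [← h1, hs], rfl⟩⟩, hrange _, hrange _⟩
    · intro k _ k' _ hkk
      simpa using congrArg (fun f => Sum.elim (fun _ => 0) Prod.fst f) hkk
  cases hcv : c v
  · have := hdeg.trans (hφ.poor (v, c v) (hrange v) hcv)
    simpa using this
  · have := hdeg.trans (hφ.rich (v, c v) (hrange v) hcv)
    simpa using this

lemma ncard_edgeSet_le_edgesIn (T : Finset V) {H : Graph ℕ ℕ} (hH : H ≤ l.toGraph ι)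
    (hT : ∀ v, ι v ∈ V(H) → v ∈ T) : E(H).ncard ≤ l.edgesIn T := by
  classical
  have h : E(H).encard ≤ l.edgesIn T := by
    rw [edgesIn, ← encard_getElem?_eq_countP]
    refine Set.encard_le_encard fun k hk => ?_
    obtain ⟨x, y, hxy⟩ := Graph.exists_isLink_of_mem_edgeSet hk
    obtain ⟨e, he, h⟩ := hxy.mono hH
    refine ⟨e, he, ?_⟩
    have hx := hxy.left_mem
    have hy := hxy.right_mem
    rcases h with ⟨rfl, rfl⟩ | ⟨rfl, rfl⟩
    · simp [hT _ hx, hT _ hy]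
    · simp [hT _ hx, hT _ hy]
  have hfin : E(H).Finite := Set.finite_of_encard_le_coe h
  rw [← hfin.cast_ncard_eq] at h
  exact_mod_cast h

lemma edgesIn_univ [Fintype V] : l.edgesIn univ = l.length := by
  simp [edgesIn]

/-- An edge list without valid colorings, in which all proper subsets have large potential,
witnesses sharpness. -/
lemma sharpAt [Fintype V] (hl : l.Loopless) {i j : ℕ}
    (h : ∀ c, ¬ l.Valid (fun b => if b then j else i) c) {N D θ : ℤ} (hD : 1 ≤ D)
    (huniv : l.potential N D univ = θ - 1)
    (hT : ∀ T, T.Nonempty → T ≠ univ → θ ≤ l.potential N D T) {f g : ℚ → ℚ}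
    (hf : ∀ n, f n = (N * n - θ) / D) (hg : ∀ n, g n = (N * n - (θ - 1)) / D) :
    SharpAt i j f g (Fintype.card V) := by
  classical
  set ι : V → ℕ := fun v => Fintype.equivFin V v with hιdef
  have hι : ι.Injective := Fin.val_injective.comp (Fintype.equivFin V).injective
  have hD' : (0 : ℚ) < D := by exact_mod_cast (show 0 < D by omega)
  have hV : V(l.toGraph ι).ncard = Fintype.card V := by
    rw [← Nat.card_coe_set_eq, ← Nat.card_eq_fintype_card]
    exact Nat.card_range_of_injective hι
  have hE : E(l.toGraph ι).ncard = l.length := by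
    rw [edgeSet_toGraph, Set.ncard_eq_toFinset_card']
    simp
  rw [potential, edgesIn_univ, card_univ] at huniv
  refine ⟨l.toGraph ι, isFiniteMultigraph_toGraph hι hl, hV, ?_, ?_,
    not_isColorable_toGraph hι hl h⟩
  · rw [hE, hg, eq_div_iff hD'.ne']
    have : (N * Fintype.card V - D * l.length : ℚ) = θ - 1 := by exact_mod_cast huniv
    linarith
  · intro H hH hne
    rw [hf, le_div_iff₀ hD']
    set T : Finset V := univ.filter fun v => ι v ∈ V(H) with hTdef
    have hTV : V(H).ncard = T.card := by
      rw [← Set.ncard_image_of_injective _ hι |>.trans (Set.ncard_coe_finset T)]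
      congr 1
      ext x
      simp only [hTdef, coe_filter, mem_univ, true_and, Set.mem_image, Set.mem_ofPred_eq]
      refine ⟨fun hx => ?_, ?_⟩
      · obtain ⟨v, rfl⟩ := hH.le.vertexSet_mono hx
        exact ⟨v, hx, rfl⟩
      · rintro ⟨v, hv, rfl⟩
        exact hv
    have hTE := ncard_edgeSet_le_edgesIn (l := l) T hH.le fun v hv => by simpa [hTdef] using hv
    have key : (D * E(H).ncard : ℤ) ≤ N * T.card - θ := by
      by_cases hTu : T = univ
      -- A proper spanning subgraph misses an edge, which raises the potential by at least `D ≥ 1`.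
      · have hlt : E(H).ncard < l.length := by
          rw [← hE]
          refine Set.ncard_lt_ncard ?_ ?_
          · rcases Graph.vertexSet_ssubset_or_edgeSet_ssubset_of_lt hH with h' | h'
            · exfalso
              refine h'.not_subset ?_
              rintro _ ⟨v, rfl⟩
              have := mem_univ v
              rw [← hTu] at this
              simpa [hTdef] using this
            · exact h'
          · rw [edgeSet_toGraph]
            exact Set.finite_lt_nat _
        rw [hTu, card_univ]
        have : (E(H).ncard + 1 : ℤ) ≤ l.length := by exact_mod_cast hlt
        nlinarith
      · have hTne : T.Nonempty := by
          rw [← card_pos, ← hTV, Set.ncard_pos ((Set.finite_range ι).subset hH.le.vertexSet_mono)]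
          exact hne
        have h1 := hT T hTne hTu
        rw [potential] at h1
        have : (E(H).ncard : ℤ) ≤ l.edgesIn T := by exact_mod_cast hTE
        nlinarith
    rw [hTV]
    have : (D * E(H).ncard : ℚ) ≤ N * T.card - θ := by exact_mod_cast key
    linarith

end EdgeList

/-- Proper sets with the root exceed `θ - 1` by the gadget property; those without it have potential
at least `0`, whence `θ ≤ 0`. -/
lemma HasGadget.sharpAt {N D θ A : ℤ} {i j n : ℕ}
    (h : HasGadget N D 0 (fun b => if b then j else i) n A fun _ _ => False) (hD : 1 ≤ D)
    (hA : A = θ - 1) (hθ : θ ≤ 0) {f g : ℚ → ℚ}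
    (hf : ∀ n, f n = (N * n - θ) / D) (hg : ∀ n, g n = (N * n - (θ - 1)) / D) :
    SharpAt i j f g n := by
  obtain ⟨V, _, l, r, rfl, hl, huniv, hmem, hnot, hcol⟩ := h
  refine EdgeList.sharpAt hl hcol hD (huniv.trans hA) (fun T hT hTu => ?_) hf hg
  by_cases hr : r ∈ T
  · linarith [hmem T hr hTu]
  · linarith [hnot T hT hr]

end DefectiveDP

/-! ### Gadgets without valid colorings for `i < j`. -/

namespace DefectiveDP

namespace HasGadget

/-- A chain of `k + 1` stars, with root color forced to be rich. -/
lemma exists_chain {i j : ℕ} (k : ℕ) :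
    HasGadget (2 * i + 1) (i + 1) 0 (fun b => if b then j else i) (i + 2 + k * (i + 1)) i
      fun b _ => b = true := by
  induction k with
  | zero =>
    have := star (2 * i + 1) (i + 1) 0 (fun b => if b then j else i) (i + 1) le_rfl (by omega)
      (by omega)
    convert this.mono (Q' := fun b _ => b = true) ?_ using 1
    · ring
    · push_cast
      ring
    · rintro (_ | _) t rfl h
      · simp at h
      · rfl
  | succ k ih =>
    have h := star (2 * i + 1) (i + 1) 0 (fun b => if b then j else i) i le_rfl (by omega)
      (by omega)
    -- The root has `i` conflicts from its leaves, and the crossed edge to a rich root adds one if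
    -- it is poor. The potential stays at `i`.
    have := h.join ih [true] le_rfl (by omega) (by simp)
    convert this.mono (Q' := fun b _ => b = true) ?_ using 1
    · ring
    · simp
      ring
    · rintro (_ | _) t ⟨t₁, b₂, t₂, rfl, rfl, rfl, -⟩ h
      · simp at h
      · rfl

/-- The `j > i` double leaves exclude the poor color; the straight edge to a rich root then gives a
rich vertex one conflict too many. -/
lemma exists_of_lt {i j : ℕ} (hij : i < j) (k : ℕ) :
    HasGadget (2 * i + 1) (i + 1) 0 (fun b => if b then j else i) (j + i + 3 + k * (i + 1))
      (2 * i - j) fun _ _ => False := by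
  have h := star (2 * i + 1) (i + 1) 0 (fun b => if b then j else i) j le_rfl (by omega)
    (by omega)
  have := h.join (exists_chain k) [false] le_rfl (by omega) (by simp)
  convert this.mono (Q' := fun _ _ => False) ?_ using 1
  · ring
  · simp
    ring
  · rintro (_ | _) t ⟨t₁, b₂, t₂, rfl, rfl, rfl, -⟩ h
    · simp at h
      omega
    · simp at h

/-- A vertex forced to be rich by a chain with rich saturated root. -/
lemma guard_of_le_two_mul {i j n : ℕ}
    (h : HasGadget (2 * j) (j + 1) 0 (fun b => if b then j else i) n 0 fun b t => b = true ∧ t = j) :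
    HasGadget (2 * j) (j + 1) 0 (fun b => if b then j else i) (1 + n) (j - 1)
      fun b _ => b = true := by
  have := (single (2 * j) (j + 1) 0 (fun b => if b then j else i)).join h [true] le_rfl le_rfl
    (by simp)
  convert this.mono (Q' := fun b _ => b = true) ?_ using 1
  · simp
    ring
  · rintro (_ | _) t ⟨t₁, b₂, t₂, rfl, ⟨rfl, rfl⟩, rfl, h⟩ -
    · simp at h
    · rfl

/-- With `j - 1 > i` double leaves the root is rich, and the straight edge to a guard supplies its
last permitted conflict. The guard and its edge change the potential by `-2`, exactly as a double
leaf does. -/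
lemma exists_saturated_of_le_two_mul {i j : ℕ} (hi : 1 ≤ i) (hij : i + 2 ≤ j) (k : ℕ) :
    HasGadget (2 * j) (j + 1) 0 (fun b => if b then j else i) ((k + 1) * (j + 1)) 0
      fun b t => b = true ∧ t = j := by
  induction k with
  | zero =>
    have := star (2 * j) (j + 1) 0 (fun b => if b then j else i) j le_rfl (by omega) (by omega)
    convert this.mono (Q' := fun b t => b = true ∧ t = j) ?_ using 1
    · ring
    · ring
    · rintro (_ | _) t rfl h
      · simp at h
        omega
      · exact ⟨rfl, rfl⟩
  | succ k ih =>
    have h := star (2 * j) (j + 1) 0 (fun b => if b then j else i) (j - 1) le_rfl (by omega)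
      (by omega)
    have := h.join (guard_of_le_two_mul ih) [false] le_rfl (by omega) (by simp)
    convert this.mono (Q' := fun b t => b = true ∧ t = j) ?_ using 1
    · obtain ⟨j, rfl⟩ : ∃ j', j = j' + 1 := ⟨j - 1, by omega⟩
      simp
      ring
    · obtain ⟨j, rfl⟩ : ∃ j', j = j' + 1 := ⟨j - 1, by omega⟩
      simp
      ring
    · rintro (_ | _) t ⟨t₁, b₂, t₂, rfl, rfl, rfl, -⟩ h
      · simp at h
        omega
      · simp
        omega

lemma exists_of_le_two_mul {i j : ℕ} (hi : 1 ≤ i) (hij : i + 2 ≤ j) (k : ℕ) :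
    HasGadget (2 * j) (j + 1) 0 (fun b => if b then j else i) (j + 2 + (k + 1) * (j + 1)) (-2)
      fun _ _ => False := by
  have h := star (2 * j) (j + 1) 0 (fun b => if b then j else i) j le_rfl (by omega) (by omega)
  have := h.join (guard_of_le_two_mul (exists_saturated_of_le_two_mul hi hij k)) [false] le_rfl
    (by omega) (by simp)
  convert this.mono (Q' := fun _ _ => False) ?_ using 1
  · ring
  · simp
    ring
  · rintro (_ | _) t ⟨t₁, b₂, t₂, rfl, rfl, rfl, -⟩ h
    · simp at h
      omega
    · simp at h

/-- A vertex of a forced color, by an edge to a gadget with a saturated root. -/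
lemma guard_of_eq_succ {i n : ℕ} {β : Bool} (β' : Bool)
    (h : HasGadget (2 * i ^ 2 + 4 * i + 1) (i ^ 2 + 3 * i + 1) 0 (fun b => if b then i + 1 else i) n
      i fun b t => b = β ∧ t = if β then i + 1 else i) :
    HasGadget (2 * i ^ 2 + 4 * i + 1) (i ^ 2 + 3 * i + 1) 0 (fun b => if b then i + 1 else i)
      (1 + n) (i ^ 2 + 2 * i) fun b t => b = β' ∧ t = 0 := by
  have := (single (2 * i ^ 2 + 4 * i + 1) (i ^ 2 + 3 * i + 1) 0
    -- The sign is chosen so that color `!β'` of the new vertex would conflict with the saturated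
    -- root.
    (fun b => if b then i + 1 else i)).join h [xor (!β') β] le_rfl (by omega) (by
      simp; nlinarith)
  convert this.mono (Q' := fun b t => b = β' ∧ t = 0) ?_ using 1
  · simp
    ring
  · rintro b t ⟨t₁, b₂, t₂, rfl, ⟨rfl, rfl⟩, rfl, h⟩ -
    cases b <;> cases β' <;> cases b₂ <;> simp_all

/-- A star with rich saturated root. -/
lemma saturated_star_of_eq_succ (i : ℕ) :
    HasGadget (2 * i ^ 2 + 4 * i + 1) (i ^ 2 + 3 * i + 1) 0 (fun b => if b then i + 1 else i)
      (i + 2) i fun b t => b = true ∧ t = if true then i + 1 else i := by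
  have := star (2 * i ^ 2 + 4 * i + 1) (i ^ 2 + 3 * i + 1) 0 (fun b => if b then i + 1 else i)
    (i + 1) le_rfl (by positivity) (by nlinarith)
  convert this.mono (Q' := fun b t => b = true ∧ t = if true then i + 1 else i) ?_ using 1
  · push_cast
    ring
  · rintro (_ | _) t rfl h
    · simp at h
    · exact ⟨rfl, rfl⟩

/-- Join the root of a gadget by crossed edges to `m` vertices that must be rich. -/
lemma addGuards {i n : ℕ} {A : ℤ} (m : ℕ)
    (h : HasGadget (2 * i ^ 2 + 4 * i + 1) (i ^ 2 + 3 * i + 1) 0 (fun b => if b then i + 1 else i) n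
      A fun b t => b = false ∧ t = 0) :
    HasGadget (2 * i ^ 2 + 4 * i + 1) (i ^ 2 + 3 * i + 1) 0 (fun b => if b then i + 1 else i)
      (n + m * (i + 3)) (A - m * (i + 1)) fun b t => b = false ∧ t = m := by
  induction m with
  | zero => simpa using h
  | succ m ih =>
    have := ih.join (guard_of_eq_succ true (saturated_star_of_eq_succ i)) [true] le_rfl
      (by positivity) (by simp; omega)
    convert this.mono (Q' := fun b t => b = false ∧ t = m + 1) ?_ using 1
    · ring
    · simp
      ring
    · rintro b t ⟨t₁, b₂, t₂, ⟨rfl, rfl⟩, ⟨rfl, rfl⟩, rfl, -⟩ -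
      simp

/-- A poor guard attached to the previous root is saturated by `i` rich guards; each lowers the
potential by `i + 1`, from `i ^ 2 + 2 * i` back to `i`, so the step repeats. -/
lemma exists_saturated_of_eq_succ (i k : ℕ) : ∃ n, k ≤ n ∧ ∃ β,
    HasGadget (2 * i ^ 2 + 4 * i + 1) (i ^ 2 + 3 * i + 1) 0 (fun b => if b then i + 1 else i) n
      i fun b t => b = β ∧ t = if β then i + 1 else i := by
  induction k with
  | zero => exact ⟨_, Nat.zero_le _, true, saturated_star_of_eq_succ i⟩
  | succ k ih =>
    obtain ⟨n, hn, β, h⟩ := ih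
    refine ⟨1 + n + i * (i + 3), ?_, false, ?_⟩
    · have := Nat.zero_le (i * (i + 3))
      omega
    · convert addGuards i (guard_of_eq_succ false h) using 1
      · ring
      · simp

/-- A crossed edge joins a vertex forced to be poor to a saturated rich root, which cannot take the
conflict. -/
lemma exists_of_eq_succ (i k : ℕ) : ∃ n, k ≤ n ∧
    HasGadget (2 * i ^ 2 + 4 * i + 1) (i ^ 2 + 3 * i + 1) 0 (fun b => if b then i + 1 else i) n
      (-1) fun _ _ => False := by
  obtain ⟨n, hn, β, h⟩ := exists_saturated_of_eq_succ i k
  have := (guard_of_eq_succ false h).join (saturated_star_of_eq_succ i) [true] le_rfl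
    (by positivity) (by simp; nlinarith)
  refine ⟨1 + n + (i + 2), by omega, ?_⟩
  · convert this.mono (Q' := fun _ _ => False) ?_ using 1
    · simp
      ring
    · rintro b t ⟨t₁, b₂, t₂, ⟨rfl, rfl⟩, ⟨rfl, rfl⟩, rfl, h⟩ -
      simp at h

end HasGadget

end DefectiveDP

/-! ### Paths and cycles of saturated stars for `i = j`. -/

namespace DefectiveDP

open Finset

/-- There is an edge list on `n` vertices with a root `r` and a marked vertex `a` such that the set
of all vertices has potential `A`, all other sets that contain `r` and `a` have larger potential,
sets that contain `r` have potential at least `A`, nonempty sets have positive potential, and in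
all valid colorings the marked vertex has `m` conflicts, and its color, the color of `r` and the
number of conflicts of `r` satisfy `Q`. If `p` holds, then `r` is not marked. -/
def HasMarkedGadget (N D : ℤ) (cap : Bool → ℕ) (n : ℕ) (A : ℤ) (m : ℕ) (p : Prop)
    (Q : Bool → Bool → ℕ → Prop) : Prop :=
  ∃ (V : Type) (_ : Fintype V) (l : EdgeList V) (r a : V), Fintype.card V = n ∧ l.Loopless ∧
    (p → r ≠ a) ∧ l.potential N D univ = A ∧
    (∀ T, r ∈ T → a ∈ T → T ≠ univ → A + 1 ≤ l.potential N D T) ∧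
    (∀ T, r ∈ T → A ≤ l.potential N D T) ∧
    (∀ T, T.Nonempty → 1 ≤ l.potential N D T) ∧
    ∀ c, l.Valid cap c → l.conflictsAt c a = m ∧ Q (c a) (c r) (l.conflictsAt c r)

lemma HasGadget.hasMarkedGadget {N D A : ℤ} {cap : Bool → ℕ} {n m : ℕ}
    (h : HasGadget N D 1 cap n A fun _ t => t = m) (hA : 1 ≤ A) :
    HasMarkedGadget N D cap n A m False fun b b' t => b = b' ∧ t = m := by
  obtain ⟨V, _, l, r, card, ll, huniv, hmem, hnot, col⟩ := h
  have hle : ∀ T, r ∈ T → A ≤ l.potential N D T := fun T hT => by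
    by_cases h : T = univ
    · rw [h, huniv]
    · linarith [hmem T hT h]
  refine ⟨V, _, l, r, r, card, ll, False.elim, huniv, fun T hT _ => hmem T hT, hle, fun T hT => ?_,
    fun c hc => ⟨col c hc, rfl, col c hc⟩⟩
  by_cases h : r ∈ T
  · linarith [hle T h]
  · exact hnot T hT h

namespace HasMarkedGadget

variable {N D A A₁ A₂ : ℤ} {cap : Bool → ℕ} {n n₁ n₂ m : ℕ} {p : Prop} {Q₁ : Bool → ℕ → Prop}
  {Q Q' Q₂ : Bool → Bool → ℕ → Prop}

lemma mono (h : HasMarkedGadget N D cap n A m p Q) (hQ : ∀ b b' t, Q b b' t → t ≤ cap b' → Q' b b' t) :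
    HasMarkedGadget N D cap n A m p Q' := by
  obtain ⟨V, _, l, r, a, h1, h2, h3, h4, h5, h6, h7, h8⟩ := h
  exact ⟨V, _, l, r, a, h1, h2, h3, h4, h5, h6, h7,
    fun c hc => ⟨(h8 c hc).1, hQ _ _ _ (h8 c hc).2 (hc r)⟩⟩

/-- Join a new root to the root of a marked gadget by an edge. -/
lemma join (h₁ : HasGadget N D 1 cap n₁ A₁ Q₁) (h₂ : HasMarkedGadget N D cap n₂ A₂ m p Q₂)
    (hm : ∀ b, m = cap b) (s : Bool) (hA : A₂ ≤ D) (hA' : D + 1 ≤ A₁ + A₂) :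
    HasMarkedGadget N D cap (n₁ + n₂) (A₁ + A₂ - D) m True fun b b' t =>
      ∃ t₁ b₂ t₂, Q₁ b' t₁ ∧ Q₂ b b₂ t₂ ∧ t = t₁ + [s].count (xor b' b₂) ∧
        t₂ + [s].count (xor b' b₂) ≤ cap b₂ := by
  classical
  obtain ⟨V₁, _, l₁, r₁, card₁, ll₁, univ₁, mem₁, not₁, col₁⟩ := h₁
  obtain ⟨V₂, _, l₂, r₂, a, card₂, ll₂, -, univ₂, memr₂, mem₂, pos₂, col₂⟩ := h₂
  have le₁ : ∀ T, r₁ ∈ T → A₁ ≤ l₁.potential N D T := fun T hT => by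
    by_cases h : T = univ
    · rw [h, univ₁]
    · linarith [mem₁ T hT h]
  have nonneg₂ : ∀ T, 0 ≤ l₂.potential N D T := fun T => by
    rcases T.eq_empty_or_nonempty with rfl | h
    · simp
    · linarith [pos₂ T h]
  have hle : ∀ T : Finset (V₁ ⊕ V₂), Sum.inl r₁ ∈ T →
      A₁ + A₂ - D ≤ (EdgeList.join l₁ r₁ l₂ r₂ [s]).potential N D T := by
    intro T hT
    have hT' : r₁ ∈ T.toLeft := mem_toLeft.2 hT
    rw [EdgeList.potential_join]
    split_ifs with h
    · simp only [List.length_singleton]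
      push_cast
      linarith [le₁ _ hT', mem₂ _ h.2]
    · linarith [le₁ _ hT', nonneg₂ T.toRight]
  refine ⟨V₁ ⊕ V₂, inferInstance, EdgeList.join l₁ r₁ l₂ r₂ [s], Sum.inl r₁, Sum.inr a,
    by simp [*], ll₁.join ll₂, by simp, ?_, ?_, hle, ?_, ?_⟩
  · rw [EdgeList.potential_join, if_pos (by simp)]
    have h1 : (univ : Finset (V₁ ⊕ V₂)).toLeft = univ := by ext; simp
    have h2 : (univ : Finset (V₁ ⊕ V₂)).toRight = univ := by ext; simp
    rw [h1, h2, univ₁, univ₂]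
    simp
  · intro T hT ha hne
    have hT' : r₁ ∈ T.toLeft := mem_toLeft.2 hT
    have ha' : a ∈ T.toRight := mem_toRight.2 ha
    rw [EdgeList.potential_join]
    split_ifs with h
    · simp only [List.length_singleton]
      push_cast
      rcases HasGadget.toLeft_eq_univ_or hne with h' | h'
      · linarith [mem₁ _ hT' h', mem₂ _ h.2]
      · linarith [le₁ _ hT', memr₂ _ h.2 ha' h']
    · linarith [le₁ _ hT', pos₂ T.toRight ⟨a, ha'⟩]
  · intro T hT
    by_cases hr : Sum.inl r₁ ∈ T
    · linarith [hle T hr]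
    have hr' : r₁ ∉ T.toLeft := fun h => hr (mem_toLeft.1 h)
    rw [EdgeList.potential_join, if_neg fun h => hr' h.1]
    rcases T.toLeft.eq_empty_or_nonempty with h | h
    · rw [h]
      have : T.toRight.Nonempty := by
        obtain ⟨v | v, hv⟩ := hT
        · exact absurd (mem_toLeft.2 hv) (by simp [h])
        · exact ⟨v, mem_toRight.2 hv⟩
      simpa using pos₂ _ this
    · linarith [not₁ _ h hr', nonneg₂ T.toRight]
  · intro c hc
    have h := hc (Sum.inr r₂)
    rw [EdgeList.conflictsAt_join_inr, if_pos rfl] at h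
    have ha := hc (Sum.inr a)
    rw [← hm] at ha
    refine ⟨le_antisymm ha ?_, _, _, _, col₁ _ hc.left, (col₂ _ hc.right).2, ?_, h⟩
    · rw [EdgeList.conflictsAt_join_inr, (col₂ _ hc.right).1]
      exact Nat.le_add_right _ _
    · rw [EdgeList.conflictsAt_join_inl, if_pos rfl]
      rfl

/-- Closing a path whose root and marked vertex have different colors by a crossed edge. -/
lemma sharpAt {i : ℕ} (h : HasMarkedGadget N D (fun _ => i) n A i True fun b b' _ => b ≠ b')
    (hA : A = D) (hD : 1 ≤ D) {f g : ℚ → ℚ}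
    (hf : ∀ n, f n = (N * n - 1) / D) (hg : ∀ n, g n = N * n / D) : SharpAt i i f g n := by
  classical
  obtain ⟨V, _, l, r, a, rfl, hl, hra, huniv, hmema, hmem, hpos, hcol⟩ := h
  have hpot : ∀ T, EdgeList.potential N D ((r, a, true) :: l) T =
      l.potential N D T - if r ∈ T ∧ a ∈ T then D else 0 := by
    intro T
    simp only [EdgeList.potential, EdgeList.edgesIn, List.countP_cons, decide_eq_true_eq]
    split_ifs <;> push_cast <;> ring
  refine EdgeList.sharpAt (l := (r, a, true) :: l) (N := N) (D := D) (θ := 1) ?_ ?_ hD ?_ ?_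
    (by simpa using hf) (by simpa using hg)
  · intro e he
    rcases List.mem_cons.1 he with rfl | he
    · exact hra trivial
    · exact hl e he
  · intro c hc
    have hconf : ∀ v, EdgeList.conflictsAt ((r, a, true) :: l) c v = l.conflictsAt c v +
        if (r = v ∨ a = v) ∧ xor (c r) (c a) = true then 1 else 0 := by
      intro v
      simp only [EdgeList.conflictsAt, List.countP_cons, decide_eq_true_eq]
    have hc' : l.Valid (fun _ => i) c := fun v => by
      have h := hc v
      rw [hconf] at h
      exact (Nat.le_add_right _ _).trans (h.trans_eq (ite_self i))
    have h1 := hc a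
    -- The marked vertex already has `i` conflicts, and the closing edge adds another because the
    -- ends differ.
    rw [hconf, (hcol c hc').1, if_pos ⟨Or.inr rfl, by simpa using (hcol c hc').2.symm⟩] at h1
    simp at h1
  · rw [hpot, if_pos ⟨mem_univ _, mem_univ _⟩, huniv, hA]
    ring
  · intro T hT hne
    rw [hpot]
    split_ifs with h
    · linarith [hmema T h.1 h.2 hne]
    · linarith [hpos T hT]

variable {i : ℕ}

/-- The `i` double leaves saturate the root in either color, since the capacities agree. -/
lemma star_of_eq (i : ℕ) :
    HasGadget (2 * i + 2) (i + 2) 1 (fun _ => i) (i + 1) 2 fun _ t => t = i := by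
  convert HasGadget.star (2 * i + 2) (i + 2) 1 (fun _ => i) i zero_le_one (by omega) (by omega)
    using 1
  ring

/-- Add a vertex to a path, joined to a root of full capacity. -/
lemma addSingle (h : HasMarkedGadget (2 * i + 2) (i + 2) (fun _ => i) n 2 i p
      fun b b' t => b = b' ∧ t = i) (hi : 1 ≤ i) :
    HasMarkedGadget (2 * i + 2) (i + 2) (fun _ => i) (1 + n) (i + 2) i True
      fun b b' _ => b ≠ b' := by
  have := join (HasGadget.single (2 * i + 2) (i + 2) 1 (fun _ => i)) h (fun _ => rfl) false
    (by omega) (by omega)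
  convert this.mono (Q' := fun b b' _ => b ≠ b') ?_ using 1
  · ring
  · rintro b b' t ⟨t₁, b₂, t₂, rfl, ⟨rfl, rfl⟩, rfl, h⟩ -
    cases b <;> cases b' <;> simp at h ⊢

/-- Add a star to a path. -/
lemma addStar (h : HasMarkedGadget (2 * i + 2) (i + 2) (fun _ => i) n (i + 2) i p
      fun b b' _ => b ≠ b') :
    HasMarkedGadget (2 * i + 2) (i + 2) (fun _ => i) (i + 1 + n) 2 i True
      fun b b' t => b = b' ∧ t = i := by
  have := join (star_of_eq i) h (fun _ => rfl) false (by omega) (by omega)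
  convert this.mono (Q' := fun b b' t => b = b' ∧ t = i) ?_ using 1
  · ring
  · rintro b b' t ⟨t₁, b₂, t₂, rfl, h, rfl, -⟩ h'
    cases b <;> cases b' <;> cases b₂ <;> simp at h h' ⊢

/-- Straight edges to saturated roots must be free of conflicts, so colors alternate along the path;
after an odd number of edges the ends differ. -/
lemma exists_path (hi : 1 ≤ i) (k : ℕ) :
    HasMarkedGadget (2 * i + 2) (i + 2) (fun _ => i) ((k + 1) * (i + 2)) (i + 2) i True
      fun b b' _ => b ≠ b' := by
  induction k with
  | zero =>
    convert addSingle ((star_of_eq i).hasMarkedGadget (by norm_num)) hi using 1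
    ring
  | succ k ih =>
    convert addSingle (addStar ih) hi using 1
    ring

end HasMarkedGadget

/-! ### Sharpness in the five cases and the main theorem. -/

lemma infinite_of_forall_exists_le {p : ℕ → Prop} (h : ∀ k, ∃ n, k ≤ n ∧ p n) :
    {n | p n}.Infinite :=
  Set.infinite_of_forall_exists_gt fun k => by
    obtain ⟨n, hn, hs⟩ := h (k + 1)
    exact ⟨n, hs, hn⟩

theorem sharpAt_zero {j n : ℕ} (hj : 1 ≤ j) (hn : 2 * j + 2 ≤ n) :
    SharpAt 0 j (fun n => n + j - 1) (fun n => n + j) n := by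
  -- For `i = 0` the gadgets have `j + 3 + k` vertices, and `j + 3 ≤ 2 * j + 2` because `j ≥ 1`.
  obtain ⟨k, rfl⟩ := Nat.exists_eq_add_of_le (show j + 3 ≤ n by omega)
  have h := HasGadget.exists_of_lt (i := 0) (j := j) (by omega) k
  simp only [zero_add, add_zero, mul_one] at h
  refine h.sharpAt (θ := 1 - j) (by simp) (by push_cast; ring) (by omega) ?_ ?_ <;>
  · intro n
    push_cast
    ring

theorem infinite_sharpAt_of_two_mul_lt {i j : ℕ} (hj : 2 * i + 1 ≤ j) :
    {n : ℕ | SharpAt i j (fun n => ((2 * i + 1) * n - (2 * i - j + 1)) / (i + 1))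
        (fun n => ((2 * i + 1) * n - (2 * i - j)) / (i + 1)) n}.Infinite := by
  refine infinite_of_forall_exists_le fun k =>
    ⟨j + i + 3 + k * (i + 1), by nlinarith [Nat.zero_le (k * i)], ?_⟩
  refine (HasGadget.exists_of_lt (by omega) k).sharpAt (θ := 2 * i - j + 1) (by omega) (by ring)
    (by omega) ?_ ?_ <;>
  · intro n
    push_cast
    ring

theorem infinite_sharpAt_of_le_two_mul {i j : ℕ} (hi : 1 ≤ i) (hij : i + 2 ≤ j) :
    {n : ℕ | SharpAt i j (fun n => (2 * j * n + 1) / (j + 1))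
        (fun n => (2 * j * n + 2) / (j + 1)) n}.Infinite := by
  refine infinite_of_forall_exists_le fun k =>
    ⟨j + 2 + (k + 1) * (j + 1), by nlinarith [Nat.zero_le (k * j)], ?_⟩
  refine (HasGadget.exists_of_le_two_mul hi hij k).sharpAt (θ := -1) (by omega) (by ring)
    (by omega) ?_ ?_ <;>
  · intro n
    push_cast
    ring

theorem infinite_sharpAt_succ (i : ℕ) :
    {n : ℕ | SharpAt i (i + 1)
        (fun n => (2 * i ^ 2 + 4 * i + 1) / (i ^ 2 + 3 * i + 1) * n)
        (fun n => ((2 * i ^ 2 + 4 * i + 1) * n + 1) / (i ^ 2 + 3 * i + 1)) n}.Infinite := by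
  refine infinite_of_forall_exists_le fun k => ?_
  obtain ⟨n, hn, h⟩ := HasGadget.exists_of_eq_succ i k
  refine ⟨n, hn, h.sharpAt (θ := 0) (by nlinarith) (by ring) le_rfl ?_ ?_⟩ <;>
  · intro n
    push_cast
    ring

theorem infinite_sharpAt_self {i : ℕ} (hi : 1 ≤ i) :
    {n : ℕ | SharpAt i i (fun n => ((2 * i + 2) * n - 1) / (i + 2))
        (fun n => (2 * i + 2) * n / (i + 2)) n}.Infinite := by
  refine infinite_of_forall_exists_le fun k => ⟨(k + 1) * (i + 2), by nlinarith, ?_⟩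
  refine (HasMarkedGadget.exists_path hi k).sharpAt rfl (by omega) ?_ ?_ <;>
  · intro n
    push_cast
    ring

end DefectiveDP

theorem mainTheorem5 {α β : Type*} :
    -- the case `i = 0`
    (∀ j : ℕ, 1 ≤ j →
      (∀ G : Graph α β, DefectiveDP.IsFiniteMultigraph G →
        DefectiveDP.AllSubgraphsSparse (fun n => n + j - 1) G →
        DefectiveDP.IsColorable 0 j G) ∧
      (∀ n : ℕ, 2 * j + 2 ≤ n →
        DefectiveDP.SharpAt 0 j (fun n => n + j - 1) (fun n => n + j) n)) ∧
    -- the case `j ≥ 2 i + 1`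
    (∀ i j : ℕ, 1 ≤ i → 2 * i + 1 ≤ j →
      (∀ G : Graph α β, DefectiveDP.IsFiniteMultigraph G →
        DefectiveDP.AllSubgraphsSparse
          (fun n => ((2 * i + 1) * n - (2 * i - j + 1)) / (i + 1)) G →
        DefectiveDP.IsColorable i j G) ∧
      {n : ℕ | DefectiveDP.SharpAt i j
        (fun n => ((2 * i + 1) * n - (2 * i - j + 1)) / (i + 1))
        (fun n => ((2 * i + 1) * n - (2 * i - j)) / (i + 1)) n}.Infinite) ∧
    -- the case `i + 2 ≤ j ≤ 2 i`
    (∀ i j : ℕ, 1 ≤ i → i + 2 ≤ j → j ≤ 2 * i →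
      (∀ G : Graph α β, DefectiveDP.IsFiniteMultigraph G →
        DefectiveDP.AllSubgraphsSparse (fun n => (2 * j * n + 1) / (j + 1)) G →
        DefectiveDP.IsColorable i j G) ∧
      {n : ℕ | DefectiveDP.SharpAt i j
        (fun n => (2 * j * n + 1) / (j + 1))
        (fun n => (2 * j * n + 2) / (j + 1)) n}.Infinite) ∧
    -- the case `j = i + 1`
    (∀ i : ℕ, 1 ≤ i →
      (∀ G : Graph α β, DefectiveDP.IsFiniteMultigraph G →
        DefectiveDP.AllSubgraphsSparse
          (fun n => (2 * i ^ 2 + 4 * i + 1) / (i ^ 2 + 3 * i + 1) * n) G →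
        DefectiveDP.IsColorable i (i + 1) G) ∧
      {n : ℕ | DefectiveDP.SharpAt i (i + 1)
        (fun n => (2 * i ^ 2 + 4 * i + 1) / (i ^ 2 + 3 * i + 1) * n)
        (fun n => ((2 * i ^ 2 + 4 * i + 1) * n + 1) / (i ^ 2 + 3 * i + 1)) n}.Infinite) ∧
    -- the case `j = i`
    (∀ i : ℕ, 1 ≤ i →
      (∀ G : Graph α β, DefectiveDP.IsFiniteMultigraph G →
        DefectiveDP.AllSubgraphsSparse (fun n => ((2 * i + 2) * n - 1) / (i + 2)) G →
        DefectiveDP.IsColorable i i G) ∧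
      {n : ℕ | DefectiveDP.SharpAt i i
        (fun n => ((2 * i + 2) * n - 1) / (i + 2))
        (fun n => (2 * i + 2) * n / (i + 2)) n}.Infinite) := by
  refine ⟨fun j hj => ⟨fun G hG h => DefectiveDP.isColorable_zero hG h,
      fun n hn => DefectiveDP.sharpAt_zero hj hn⟩,
    fun i j hi hj => ⟨fun G hG h => DefectiveDP.isColorable_of_two_mul_lt hG hi hj h,
      DefectiveDP.infinite_sharpAt_of_two_mul_lt hj⟩,
    fun i j hi hij hj => ⟨fun G hG h => DefectiveDP.isColorable_of_le_two_mul hG hij hj h,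
      DefectiveDP.infinite_sharpAt_of_le_two_mul hi hij⟩,
    fun i hi => ⟨fun G hG h => DefectiveDP.isColorable_succ hG hi h,
      DefectiveDP.infinite_sharpAt_succ i⟩,
    fun i hi => ⟨fun G hG h => DefectiveDP.isColorable_self hG hi h,
      DefectiveDP.infinite_sharpAt_self hi⟩⟩
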